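/- Let $\nu>0$, $\varepsilon_0>0$ and $\mathbb R_+=[0,\infty)$; function spaces without domain are over $\mathbb R^3$, and $D(u)$ is the symmetric part of $\nabla u$. For $0<\varepsilon<\varepsilon_0$ let $v_\varepsilon$ be a divergence free vector field in $$L^\infty_{\rm loc}(\mathbb R_+;L^2)\cap L^2_{\rm loc}(\mathbb R_+;H^1)\cap C^0_w(\mathbb R_+;L^2),$$ bounded in this space independently of $\varepsilon$ (for each $T>0$ the norms on $[0,T]$ are bounded by a constant independent of $\varepsilon$). Assume: (a) $v_\varepsilon$ solves the Navier–Stokes equations outside the moving ball $B(h_\varepsilon(t),\varepsilon)$ with initial data $v_\varepsilon(0)$, in the sense that $$-\int_0^\infty\!\!\int_{\mathbb R^3} v_\varepsilon\cdot\partial_t\varphi+\nu\int_0^\infty\!\!\int_{\mathbb R^3}\nabla v_\varepsilon:\nabla\varphi+\int_0^\infty\!\!\int_{\mathbb R^3}(v_\varepsilon\cdot\nabla v_\varepsilon)\cdot\varphi=\int_{\mathbb R^3}v_\varepsilon(0)\cdot\varphi(0)$$ for every divergence free $\varphi\in W^{1,\infty}(\mathbb R_+\times\mathbb R^3;\mathbb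 R^3)$, compactly supported in $\mathbb R_+\times\mathbb R^3$, such that for all $t\ge0$ the function $\varphi(t,\cdot)$ is smooth and compactly supported in $\{x:|x-h_\varepsilon(t)|>\varepsilon\}$; (b) $v_\varepsilon(0)$ converges weakly in $L^2$ to some $v_0$ as $\varepsilon\to0$; (c) $h_\varepsilon\in W^{1,\infty}(\mathbb R_+;\mathbb R^3)$ for every $\varepsilon$, and $\varepsilon^{3/2}h_\varepsilon'\to0$ in $L^\infty_{\rm loc}(\mathbb R_+)$ as $\varepsilon\to0$. Then every sequence of values of $\varepsilon$ tending to $0$ has a subsequence $\varepsilon_k$ such that $v_{\varepsilon_k}$ converges weak-$*$ in $L^\infty_{\rm loc}(\mathbb R_+;L^2)$, weakly in $L^2_{\rm loc}(\mathbb R_+;H^1)$ and strongly in $L^2_{\rm loc}(\mathbb R_+\times\mathbb R^3)$ to some $v\in L^\infty_{\rm loc}(\mathbb R_+;L^2)\cap L^2_{\rm loc}(\mathbb R_+;H^1)\cap C^0_w(\mathbb R_+;L^2)$ which is a solution of the Navier–Stokes equations in $\mathbb R^3$ in the sense of distributions with initial data $v_0$: $v$ is divergence free, $v(0)=v_0$,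 and $$-\int_0^\infty\!\!\int_{\mathbb R^3} v\cdot\partial_t\varphi+\nu\int_0^\infty\!\!\int_{\mathbb R^3}\nabla v:\nabla\varphi+\int_0^\infty\!\!\int_{\mathbb R^3}(v\cdot\nabla v)\cdot\varphi=\int_{\mathbb R^3}v_0\cdot\varphi(0)$$ for every divergence free $\varphi\in C^\infty_0(\mathbb R_+\times\mathbb R^3;\mathbb R^3)$. Moreover, if in addition $v_\varepsilon(0)\to v_0$ strongly in $L^2$ and $$\forall t\ge0\quad \|v_\varepsilon(t)\|^2_{L^2(\mathbb R^3\setminus B(h_\varepsilon(t),\varepsilon))}+4\nu\int_0^t\|D(v_\varepsilon(s))\|^2_{L^2(\mathbb R^3\setminus B(h_\varepsilon(s),\varepsilon))}\,ds\le\|v_\varepsilon(0)\|^2_{L^2(\mathbb R^3)}+o(1)\quad(\varepsilon\to0),$$ where the $o(1)$ may depend on $t$, then this limit $v$ satisfies $$\forall t\ge0\quad \|v(t)\|^2_{L^2(\mathbb R^3)}+4\nu\int_0^t\|D(v(s))\|^2_{L^2(\mathbb R^3)}\,ds\le\|v_0\|^2_{L^2(\mathbb R^3)}.$$ -/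

import Mathlib

open Set Filter Topology MeasureTheory
open scoped ENNReal NNReal ContDiff

noncomputable section

namespace MovingBall

/-- The Euclidean space `ℝ³`. -/
abbrev E3 : Type := EuclideanSpace ℝ (Fin 3)

/-- The Hilbert space `L²(ℝ³; ℝ³)` of square integrable vector fields. -/
abbrev L2 : Type := Lp E3 2 (volume : Measure E3)

/-- The `i`-th vector of the canonical basis of `ℝ³`. -/
def e (i : Fin 3) : E3 := EuclideanSpace.single i 1

/-- `w` is the weak partial derivative `∂ᵢ u` of the `L²` vector field `u`. -/
def HasWeakPartial (i : Fin 3) (u w : L2) : Prop :=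
  ∀ ψ : E3 → ℝ, ContDiff ℝ ∞ ψ → HasCompactSupport ψ →
    ∫ x, (fderiv ℝ ψ x (e i)) • (u x) = - ∫ x, (ψ x) • (w x)

/-- A weak partial derivative in `L²` is unique. -/
theorem HasWeakPartial.unique {i : Fin 3} {u w w' : L2}
    (h : HasWeakPartial i u w) (h' : HasWeakPartial i u w') : w = w' := by
  have hl : ∀ z : L2, LocallyIntegrable (z : E3 → E3) volume := fun z =>
    (Lp.memLp z).locallyIntegrable (by norm_num)
  refine Lp.ext ?_
  refine ae_eq_of_integral_contDiff_smul_eq (hl w) (hl w') ?_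
  intro g hg hc
  have h1 := h g hg hc
  have h2 := h' g hg hc
  rw [h1] at h2
  exact neg_injective h2

/-- `u ∈ H¹(ℝ³)`: the `L²` vector field `u` has all its weak partial derivatives in `L²`. -/
def InH1 (u : L2) : Prop := ∀ i, ∃ w, HasWeakPartial i u w

open Classical in
/-- The weak partial derivative `∂ᵢ u` (and `0` if it does not exist in `L²`). -/
def weakPartial (i : Fin 3) (u : L2) : L2 :=
  if h : ∃ w, HasWeakPartial i u w then h.choose else 0

theorem HasWeakPartial.weakPartial_eq {i : Fin 3} {u w : L2} (h : HasWeakPartial i u w) :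
    weakPartial i u = w := by
  have hex : ∃ w, HasWeakPartial i u w := ⟨w, h⟩
  unfold weakPartial
  rw [dif_pos hex]
  exact hex.choose_spec.unique h

/-- `div u = 0` in the sense of distributions on `ℝ³`: `∫ u · ∇ψ = 0` for all test functions. -/
def WeakDivFree (u : L2) : Prop :=
  ∀ ψ : E3 → ℝ, ContDiff ℝ ∞ ψ → HasCompactSupport ψ → ∫ x, fderiv ℝ ψ x (u x) = 0

/-- The classical divergence `∑ᵢ ∂ᵢ fᵢ`. -/
def div (f : E3 → E3) (x : E3) : ℝ := ∑ i, (fderiv ℝ f x (e i)) i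

/-- `|D(u)|²(x)`, the squared Frobenius norm of the symmetric part of the gradient. -/
def symGradSq (u : L2) (x : E3) : ℝ :=
  ∑ i, ∑ j, (((weakPartial i u x) j + (weakPartial j u x) i) / 2) ^ 2

/-- `f ∈ C⁰_w(ℝ₊; L²)`: weak continuity on `[0, ∞)` with values in `L²`. -/
def WeaklyContinuous (f : ℝ → L2) : Prop :=
  ∀ g : L2, ContinuousOn (fun t => inner ℝ (f t) g) (Ici 0)

/-- `f ∈ L^∞_loc(ℝ₊; L²) ∩ L²_loc(ℝ₊; H¹) ∩ C⁰_w(ℝ₊; L²)`. -/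
structure InEnergySpace (f : ℝ → L2) : Prop where
  memLp_top : ∀ T > 0, MemLp f ⊤ (volume.restrict (Ioo 0 T))
  ae_inH1 : ∀ᵐ t ∂(volume.restrict (Ioi 0)), InH1 (f t)
  memLp_partial : ∀ i, ∀ T > 0,
    MemLp (fun t => weakPartial i (f t)) 2 (volume.restrict (Ioo 0 T))
  weaklyContinuous : WeaklyContinuous f

/-- The norm bounds of `L^∞_loc(ℝ₊; L²) ∩ L²_loc(ℝ₊; H¹) ∩ C⁰_w(ℝ₊; L²)`, with constants that
depend on the time `T` only, for the family `v ε`, `ε ∈ (0, ε₀)`. -/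
def UniformlyBounded (ε₀ : ℝ) (v : ℝ → ℝ → L2) : Prop :=
  ∀ T > 0, ∃ C : ℝ≥0, ∀ ε ∈ Ioo 0 ε₀,
    (∀ t ∈ Icc 0 T, ‖v ε t‖ ≤ C) ∧
    eLpNorm (v ε) ⊤ (volume.restrict (Ioo 0 T)) ≤ C ∧
    eLpNorm (v ε) 2 (volume.restrict (Ioo 0 T)) ≤ C ∧
    ∀ i, eLpNorm (fun t => weakPartial i (v ε t)) 2 (volume.restrict (Ioo 0 T)) ≤ C

/-- `W^{1,∞}` on a convex set (with the continuous representative): bounded and Lipschitz. -/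
def W1InfOn {X Y : Type*} [PseudoMetricSpace X] [SeminormedAddCommGroup Y]
    (f : X → Y) (s : Set X) : Prop :=
  (∃ C : ℝ, ∀ x ∈ s, ‖f x‖ ≤ C) ∧ ∃ K : ℝ≥0, LipschitzOnWith K f s

/-- The weak form of `∂ₜ v - ν Δ v + v · ∇ v = - ∇ π`, `v(0) = v₀`, tested with `φ`:
`- ∫∫ v · ∂ₜφ + ν ∫∫ ∇v : ∇φ + ∫∫ (v · ∇v) · φ = ∫ v₀ · φ(0)`. -/
def WeakNSIdentity (ν : ℝ) (v : ℝ → L2) (v₀ : L2) (φ : ℝ → E3 → E3) : Prop :=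
  - (∫ t in Ioi (0 : ℝ), ∫ x, inner ℝ (v t x) (deriv (fun s => φ s x) t))
    + ν * (∫ t in Ioi (0 : ℝ), ∫ x,
        ∑ i, inner ℝ (weakPartial i (v t) x) (fderiv ℝ (φ t) x (e i)))
    + (∫ t in Ioi (0 : ℝ), ∫ x,
        ∑ i, (v t x) i * inner ℝ (weakPartial i (v t) x) (φ t x))
  = ∫ x, inner ℝ (v₀ x) (φ 0 x)

/-- Test fields for the exterior of the moving ball `B(h(t), ε)`: divergence free fields in
`W^{1,∞}(ℝ₊ × ℝ³)`, compactly supported in `ℝ₊ × ℝ³`, `ℝ₊ = [0, ∞)`, such that for all `t` the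
map `φ(t, ·)` is smooth and compactly supported in `{x | |x - h(t)| > ε}`. -/
structure IsExteriorTest (ε : ℝ) (h : ℝ → E3) (φ : ℝ → E3 → E3) : Prop where
  w1inf : W1InfOn (fun p : ℝ × E3 => φ p.1 p.2) (Ici 0 ×ˢ univ)
  compact : ∃ K : Set (ℝ × E3), IsCompact K ∧ ∀ t ≥ 0, ∀ x, (t, x) ∉ K → φ t x = 0
  divFree : ∀ t ≥ 0, ∀ x, div (φ t) x = 0
  smooth : ∀ t ≥ 0, ContDiff ℝ ∞ (φ t)
  hasCompactSupport : ∀ t ≥ 0, HasCompactSupport (φ t)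
  exterior : ∀ t ≥ 0, tsupport (φ t) ⊆ {x | ε < ‖x - h t‖}

/-- Test fields for the whole space: `C^∞` and compactly supported in `ℝ₊ × ℝ³` (restrictions to
`t ≥ 0` of smooth compactly supported fields on `ℝ × ℝ³`), divergence free for `t ≥ 0`. -/
structure IsTest (φ : ℝ → E3 → E3) : Prop where
  smooth : ContDiff ℝ ∞ (fun p : ℝ × E3 => φ p.1 p.2)
  hasCompactSupport : HasCompactSupport (fun p : ℝ × E3 => φ p.1 p.2)
  divFree : ∀ t ≥ 0, ∀ x, div (φ t) x = 0

/-- `v` solves the Navier-Stokes equations in the exterior of the ball `B(h(t), ε)`, with initial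
data `v(0)`. -/
def SolvesNSOutsideBall (ν ε : ℝ) (h : ℝ → E3) (v : ℝ → L2) : Prop :=
  ∀ φ, IsExteriorTest ε h φ → WeakNSIdentity ν v (v 0) φ

/-- `v` is a solution in the sense of distributions of the Navier-Stokes equations in `ℝ³` with
initial data `v₀`. -/
def IsNSSolution (ν : ℝ) (v : ℝ → L2) (v₀ : L2) : Prop :=
  (∀ t ≥ 0, WeakDivFree (v t)) ∧ v 0 = v₀ ∧ ∀ φ, IsTest φ → WeakNSIdentity ν v v₀ φ

/-- Weak-* convergence in `L^∞_loc(ℝ₊; L²)`. -/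
def WeakStarConv (u : ℕ → ℝ → L2) (v : ℝ → L2) : Prop :=
  ∀ T > 0, ∀ g : Lp L2 1 (volume.restrict (Ioo (0 : ℝ) T)),
    Tendsto (fun k => ∫ t in Ioo 0 T, inner ℝ (u k t) (g t)) atTop
      (𝓝 (∫ t in Ioo 0 T, inner ℝ (v t) (g t)))

/-- Weak convergence in `L²_loc(ℝ₊; H¹)`: the fields and all their first order partial derivatives
converge weakly in `L²(0, T; L²)` for all `T`. -/
def WeakConvH1 (u : ℕ → ℝ → L2) (v : ℝ → L2) : Prop :=
  ∀ T > 0, ∀ g : Lp L2 2 (volume.restrict (Ioo (0 : ℝ) T)),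
    Tendsto (fun k => ∫ t in Ioo 0 T, inner ℝ (u k t) (g t)) atTop
      (𝓝 (∫ t in Ioo 0 T, inner ℝ (v t) (g t))) ∧
    ∀ i, Tendsto (fun k => ∫ t in Ioo 0 T, inner ℝ (weakPartial i (u k t)) (g t)) atTop
      (𝓝 (∫ t in Ioo 0 T, inner ℝ (weakPartial i (v t)) (g t)))

/-- Strong convergence in `L²_loc(ℝ₊ × ℝ³)`. -/
def StrongConvL2Loc (u : ℕ → ℝ → L2) (v : ℝ → L2) : Prop :=
  ∀ T > 0, ∀ R > 0,
    Tendsto (fun k => ∫⁻ t in Ioo 0 T, ∫⁻ x in Metric.ball 0 R, ‖u k t x - v t x‖ₑ ^ 2) atTop (𝓝 0)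

/-- `‖v(t)‖²_{L²(ℝ³ \ B(h(t), ε))} + 4ν ∫₀ᵗ ‖D(v)‖²_{L²(ℝ³ \ B(h(s), ε))} ds`. -/
def exteriorEnergy (ν ε : ℝ) (h : ℝ → E3) (v : ℝ → L2) (t : ℝ) : ℝ :=
  (∫ x in (Metric.ball (h t) ε)ᶜ, ‖v t x‖ ^ 2)
    + 4 * ν * ∫ s in Ioo 0 t, ∫ x in (Metric.ball (h s) ε)ᶜ, symGradSq (v s) x

/-- The exterior energy inequality
`exteriorEnergy (v_ε) (t) ≤ ‖v_ε(0)‖²_{L²} + o(1)` as `ε → 0`, for all `t ≥ 0`. -/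
def ExteriorEnergyInequality (ν ε₀ : ℝ) (h : ℝ → ℝ → E3) (v : ℝ → ℝ → L2) : Prop :=
  ∃ r : ℝ → ℝ → ℝ, ∀ t ≥ 0, Tendsto (fun ε => r ε t) (𝓝[>] 0) (𝓝 0) ∧
    ∀ ε ∈ Ioo 0 ε₀, exteriorEnergy ν ε (h ε) (v ε) t ≤ ‖v ε 0‖ ^ 2 + r ε t

/-- The energy inequality `‖v(t)‖² + 4ν ∫₀ᵗ ‖D(v)‖² ≤ ‖v₀‖²` for all `t ≥ 0`. -/
def EnergyInequality (ν : ℝ) (v : ℝ → L2) (v₀ : L2) : Prop :=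
  ∀ t ≥ 0, ‖v t‖ ^ 2 + 4 * ν * (∫ s in Ioo 0 t, ∫ x, symGradSq (v s) x) ≤ ‖v₀‖ ^ 2

end MovingBall

end

set_option autoImplicit false

noncomputable section

namespace MovingBall

open scoped BoundedContinuousFunction

/-! The ball shrinks to a point, and a point is invisible to the weak formulation provided that a
test field of the whole space can be modified near the ball at vanishing cost. Let `φ` be such a
field. Near the centre `c`, a divergence free field `f = φ(t, c + ·)` is the curl of `Φ × y`, where
`Φ(y) = ∫₀¹ s f(sy) ds` (`radialPotential_euler`, `div_radialPotential`). With a cutoff `b` at scale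
`ε`, the field `curl((1 - b) Φ × y)` is divergence free, vanishes near the ball and equals `f` away
from it (`div_truncation`). Its difference from `φ` is a correction `G`, supported in a ball of
radius `3ε`, bounded uniformly in `ε`, with space derivatives `O(1/ε)` and time derivative `O(1 +
|h'|/ε)` once `c = h(t)` (`IsTest.exists_correction`).

The contributions of `G` are estimated by a Hardy type bound, `‖u‖_{L²(ball of radius ρ)} ≲ ρ ‖∇u‖`
(`integral_ball_norm_sq_le`). The time derivative costs `(1 + |h'|/ε) · ε · ε^{3/2} ‖∇u‖`, hence
`ε^{5/2} + ε^{3/2} |h'|`, which is exactly where `ε^{3/2} h' → 0` enters; the viscous term costs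
`ε^{1/2} ‖∇u‖` and the convective one `ε ‖∇u‖²` (`IsCorrection.abs_correctionForm_le`). Multiplying
by a piecewise affine cutoff in time and using weak continuity turns the space-time formulation into
an identity at each time (`IsCorrection.identity`). Together these show that the fields solve the
Navier–Stokes equations in the whole space up to an error that tends to zero uniformly on bounded
time intervals (`exists_approximate_identity`); from there the ball plays no role until the energy
inequality.

Compactness needs neither a bound on `∂ₜv` in a dual space nor an Aubin–Lions theorem. The
approximate identity gives equicontinuity in time of the pairing with each solenoidal test field
(`IsApproximateSolution.equicontinuous`). Pairings with gradients vanish, and solenoidal fields and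
gradients span a dense subspace of `L²`, by Liouville's theorem for square integrable harmonic
functions (`eq_zero_of_orthogonal_solenoidal`). A diagonal extraction thus gives weak convergence in
`L²` at every time (`IsApproximateSolution.exists_subseq_weak`). Mollification turns this into local
strong convergence, the error being controlled by the gradients
(`IsApproximateSolution.strongConv`). Strong convergence of the field and weak convergence of its
gradient pass to the limit in the convective term.

For the energy inequality, lower semicontinuity is proved by testing with the limit itself; the part
of the pairing inside the ball is negligible because a fixed integrable function has small integral
on small balls, wherever their centres are (`exterior_norm_sq_ge`, `tendsto_ballMass`). -/

/-! ### `L²` fields, test fields and weak derivatives. -/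

lemma inner_eq_integral (u v : L2) : inner ℝ u v = ∫ x, inner ℝ (u x) (v x) :=
  L2.inner_def u v

lemma norm_sq_eq_integral (u : L2) : ‖u‖ ^ 2 = ∫ x, ‖u x‖ ^ 2 := by
  rw [← real_inner_self_eq_norm_sq, inner_eq_integral]
  simp only [real_inner_self_eq_norm_sq]

lemma integrable_inner (u v : L2) : Integrable (fun x => inner ℝ (u x) (v x)) volume :=
  L2.integrable_inner u v

lemma integrable_norm_sq (u : L2) : Integrable (fun x => ‖u x‖ ^ 2) volume := by
  simpa only [real_inner_self_eq_norm_sq] using integrable_inner u u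

/-- The class in `L²` of a continuous compactly supported field. -/
def ccLp (f : E3 → E3) (hf : Continuous f) (hc : HasCompactSupport f) : L2 :=
  (hf.memLp_of_hasCompactSupport (p := 2) (μ := volume) hc).toLp f

lemma coeFn_ccLp {f : E3 → E3} (hf : Continuous f) (hc : HasCompactSupport f) :
    ccLp f hf hc =ᵐ[volume] f := MemLp.coeFn_toLp _

lemma inner_ccLp (u : L2) {f : E3 → E3} (hf : Continuous f) (hc : HasCompactSupport f) :
    inner ℝ u (ccLp f hf hc) = ∫ x, inner ℝ (u x) (f x) := by
  rw [inner_eq_integral]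
  refine integral_congr_ae ?_
  filter_upwards [coeFn_ccLp hf hc] with x hx
  rw [hx]

/-- Smooth compactly supported vector fields. -/
structure IsTestField (ψ : E3 → E3) : Prop where
  smooth : ContDiff ℝ ∞ ψ
  compact : HasCompactSupport ψ

namespace IsTestField
variable {ψ : E3 → E3}

lemma continuous (h : IsTestField ψ) : Continuous ψ := h.smooth.continuous

lemma contDiff_partial (h : IsTestField ψ) (y : E3) :
    ContDiff ℝ ∞ (fun x => fderiv ℝ ψ x y) :=
  (h.smooth.fderiv_right (by simp)).clm_apply contDiff_const

lemma partial' (h : IsTestField ψ) (y : E3) : IsTestField (fun x => fderiv ℝ ψ x y) :=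
  ⟨h.contDiff_partial y, h.compact.fderiv_apply ℝ y⟩

/-- The class in `L²` of a test field. -/
def toL2 (h : IsTestField ψ) : L2 := ccLp ψ h.continuous h.compact

lemma coeFn_toL2 (h : IsTestField ψ) : h.toL2 =ᵐ[volume] ψ := coeFn_ccLp _ _

lemma inner_toL2 (h : IsTestField ψ) (u : L2) : inner ℝ u h.toL2 = ∫ x, inner ℝ (u x) (ψ x) :=
  inner_ccLp u _ _

end IsTestField

lemma dense_testFields : Dense {u : L2 | ∃ ψ, ∃ h : IsTestField ψ, u = h.toL2} := by
  refine (Lp.dense_hasCompactSupport_contDiff (F := E3) (E := E3) (μ := volume) (p := 2)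
    (by norm_num)).mono ?_
  rintro u ⟨g, hg, hc, hs⟩
  refine ⟨g, ⟨hs, hc⟩, Lp.ext ?_⟩
  exact hg.trans (IsTestField.coeFn_toL2 _).symm

lemma locallyIntegrable (u : L2) : LocallyIntegrable (u : E3 → E3) volume :=
  (Lp.memLp u).locallyIntegrable (by norm_num)

lemma integrable_smul {a : E3 → ℝ} (ha : Continuous a) (hc : HasCompactSupport a) (u : L2) :
    Integrable (fun x => a x • u x) volume :=
  (locallyIntegrable u).integrable_smul_left_of_hasCompactSupport ha hc

lemma isTestField_smul_const {a : E3 → ℝ} (ha : ContDiff ℝ ∞ a) (hc : HasCompactSupport a)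
    (c : E3) : IsTestField (fun x => a x • c) :=
  ⟨ha.smul contDiff_const, hc.smul_right⟩

/-- The `j`-th coordinate of a vector. -/
def coordL (j : Fin 3) : E3 →L[ℝ] ℝ := EuclideanSpace.proj j

@[simp] lemma coordL_apply (j : Fin 3) (x : E3) : coordL j x = x j := rfl

lemma E3.sum_inner (a b : E3) : inner ℝ a b = ∑ j, a j * b j := by
  simp [PiLp.inner_apply, mul_comm]

/-- Scalar test functions are traded for vector ones so that weak differentiability becomes a
duality in the Hilbert space `L2`, stable under weak limits. One direction works coordinate by
coordinate, the other tests with `ψ • c` for a constant vector `c`. -/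
lemma hasWeakPartial_iff {i : Fin 3} {u w : L2} :
    HasWeakPartial i u w ↔ ∀ ψ (h : IsTestField ψ),
      inner ℝ u (h.partial' (e i)).toL2 = - inner ℝ w h.toL2 := by
  constructor
  · intro H ψ h
    rw [IsTestField.inner_toL2, IsTestField.inner_toL2]
    have hcomp : ∀ j, ContDiff ℝ ∞ (fun x => ψ x j) := fun j =>
      (coordL j).contDiff.comp h.smooth
    have hcs : ∀ j, HasCompactSupport (fun x => ψ x j) := fun j =>
      h.compact.comp_left (g := fun y : E3 => y j) (by simp)
    have hder : ∀ j x, fderiv ℝ (fun x => ψ x j) x (e i) = (fderiv ℝ ψ x (e i)) j := by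
      intro j x
      have h1 := ((coordL j).hasFDerivAt.comp x
        (h.smooth.differentiable (by simp) x).hasFDerivAt).fderiv
      have h2 : (⇑(coordL j) ∘ ψ) = fun x => ψ x j := rfl
      rw [h2] at h1
      rw [h1]; rfl
    have key : ∀ j, ∫ x, (fderiv ℝ ψ x (e i)) j * u x j = - ∫ x, ψ x j * w x j := by
      intro j
      have h0 := H _ (hcomp j) (hcs j)
      have h1 := congrArg (fun z : E3 => z j) h0
      have c1 := (coordL j).integral_comp_comm
        (integrable_smul ((hcomp j).continuous) (hcs j) w)
      have c2 := (coordL j).integral_comp_comm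
        (integrable_smul (a := fun x => fderiv ℝ (fun x => ψ x j) x (e i))
          (by
            have := ((hcomp j).fderiv_right (m := ∞) (by simp)).clm_apply
              (contDiff_const (c := e i))
            exact this.continuous) ((hcs j).fderiv_apply ℝ (e i)) u)
      simp only [coordL_apply, PiLp.smul_apply, smul_eq_mul, PiLp.neg_apply] at c1 c2 h1
      rw [← c1, ← c2] at h1
      simpa only [hder] using h1
    have i1 : ∀ j, Integrable (fun x => (fderiv ℝ ψ x (e i)) j * u x j) volume := fun j =>
      ((coordL j).integrable_comp
        (integrable_smul (a := fun x => (fderiv ℝ ψ x (e i)) j)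
          ((coordL j).continuous.comp (h.partial' (e i)).continuous)
          ((h.partial' (e i)).compact.comp_left (g := fun y : E3 => y j) (by simp)) u))
    have i2 : ∀ j, Integrable (fun x => ψ x j * w x j) volume := fun j =>
      ((coordL j).integrable_comp
        (integrable_smul ((hcomp j).continuous) (hcs j) w))
    have e1 : ∀ (a b : E3), inner ℝ a b = ∑ j, b j * a j := fun a b => by
      rw [E3.sum_inner]; simp only [mul_comm]
    simp only [e1]
    rw [integral_finsetSum _ (fun j _ => i1 j), integral_finsetSum _ (fun j _ => i2 j),
      ← Finset.sum_neg_distrib]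
    exact Finset.sum_congr rfl fun j _ => key j
  · intro H ψ hψ hc
    refine ext_inner_right ℝ fun c => ?_
    have h := isTestField_smul_const hψ hc c
    have h1 := H _ h
    rw [IsTestField.inner_toL2, IsTestField.inner_toL2] at h1
    have hd : ∀ x, fderiv ℝ (fun x => ψ x • c) x (e i) = fderiv ℝ ψ x (e i) • c := fun x => by
      rw [fderiv_smul_const (hψ.differentiable (by simp) x)]; rfl
    simp only [hd, inner_smul_right] at h1
    have hs : ContDiff ℝ ∞ (fun x => fderiv ℝ ψ x (e i)) :=
      (hψ.fderiv_right (by simp)).clm_apply contDiff_const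
    rw [real_inner_comm, ← integral_inner (integrable_smul hs.continuous (hc.fderiv_apply ℝ _) u),
      inner_neg_left, real_inner_comm, ← integral_inner (integrable_smul hψ.continuous hc w)]
    simp only [inner_smul_right]
    simpa only [real_inner_comm c] using h1

lemma InH1.hasWeakPartial {u : L2} (h : InH1 u) (i : Fin 3) :
    HasWeakPartial i u (weakPartial i u) := by
  obtain ⟨w, hw⟩ := h i
  rw [hw.weakPartial_eq]; exact hw

/-- Being divergence free is orthogonality to the gradients of test functions. -/
lemma weakDivFree_iff {u : L2} :
    WeakDivFree u ↔ ∀ ψ : E3 → ℝ, ContDiff ℝ ∞ ψ → HasCompactSupport ψ →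
      ∀ h : IsTestField (fun x => ∑ i, fderiv ℝ ψ x (e i) • e i), inner ℝ u h.toL2 = 0 := by
  have key : ∀ (ψ : E3 → ℝ) (x : E3) (y : E3),
      inner ℝ y (∑ i, fderiv ℝ ψ x (e i) • e i) = fderiv ℝ ψ x y := by
    intro ψ x y
    have : y = ∑ i, y i • e i := by
      ext j; simp [e, Finset.sum_apply, Pi.single_apply]
    conv_rhs => rw [this]
    rw [inner_sum, map_sum]
    refine Finset.sum_congr rfl fun i _ => ?_
    rw [inner_smul_right, map_smul, smul_eq_mul, mul_comm]
    congr 1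
    simp [e, EuclideanSpace.inner_single_right]
  constructor
  · intro H ψ h1 h2 h
    rw [h.inner_toL2]
    simp only [key]
    exact H ψ h1 h2
  · intro H ψ h1 h2
    have h : IsTestField (fun x => ∑ i, fderiv ℝ ψ x (e i) • e i) := by
      refine ⟨ContDiff.sum fun i _ => ?_, ?_⟩
      · exact ((h1.fderiv_right (by simp)).clm_apply contDiff_const).smul contDiff_const
      · exact (h2.fderiv ℝ).comp_left (g := fun L : E3 →L[ℝ] ℝ => ∑ i, L (e i) • e i) (by simp)
    have := H ψ h1 h2 h
    rw [h.inner_toL2] at this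
    simpa only [key] using this

/-! ### Multiplication by bounded matrix fields, and curves of kernels. -/

lemma memLp_clm_apply (A : E3 →ᵇ (E3 →L[ℝ] E3)) (u : L2) :
    MemLp (fun x => A x (u x)) 2 (volume : Measure E3) := by
  refine (Lp.memLp u).of_le_mul (c := ‖A‖) ?_ (Eventually.of_forall fun x => ?_)
  · exact (ContinuousLinearMap.apply ℝ E3).flip.aestronglyMeasurable_comp₂
      A.continuous.aestronglyMeasurable (Lp.aestronglyMeasurable u)
  · exact (A x).le_of_opNorm_le (A.norm_coe_le_norm x) _

/-- Pointwise multiplication of an `L²` field by a bounded continuous field of matrices. -/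
def mulLp (A : E3 →ᵇ (E3 →L[ℝ] E3)) (u : L2) : L2 := (memLp_clm_apply A u).toLp _

lemma coeFn_mulLp (A : E3 →ᵇ (E3 →L[ℝ] E3)) (u : L2) :
    mulLp A u =ᵐ[volume] fun x => A x (u x) := (memLp_clm_apply A u).coeFn_toLp

lemma norm_mulLp_le (A : E3 →ᵇ (E3 →L[ℝ] E3)) (u : L2) : ‖mulLp A u‖ ≤ ‖A‖ * ‖u‖ := by
  refine Lp.norm_le_mul_norm_of_ae_le_mul ?_
  filter_upwards [coeFn_mulLp A u] with x hx
  rw [hx]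
  exact (A x).le_of_opNorm_le (A.norm_coe_le_norm x) _

lemma mulLp_add_left (A B : E3 →ᵇ (E3 →L[ℝ] E3)) (u : L2) :
    mulLp (A + B) u = mulLp A u + mulLp B u := by
  refine Lp.ext ?_
  filter_upwards [Lp.coeFn_add (mulLp A u) (mulLp B u), coeFn_mulLp A u, coeFn_mulLp B u,
    coeFn_mulLp (A + B) u] with x h1 h2 h3 h4
  rw [h1, Pi.add_apply, h2, h3, h4]; rfl

lemma mulLp_smul_left (c : ℝ) (A : E3 →ᵇ (E3 →L[ℝ] E3)) (u : L2) :
    mulLp (c • A) u = c • mulLp A u := by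
  refine Lp.ext ?_
  filter_upwards [Lp.coeFn_smul c (mulLp A u), coeFn_mulLp A u, coeFn_mulLp (c • A) u]
    with x h1 h2 h3
  rw [h1, Pi.smul_apply, h2, h3]; rfl

lemma mulLp_add_right (A : E3 →ᵇ (E3 →L[ℝ] E3)) (u v : L2) :
    mulLp A (u + v) = mulLp A u + mulLp A v := by
  refine Lp.ext ?_
  filter_upwards [Lp.coeFn_add (mulLp A u) (mulLp A v), coeFn_mulLp A u, coeFn_mulLp A v,
    coeFn_mulLp A (u + v), Lp.coeFn_add u v] with x h1 h2 h3 h4 h5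
  rw [h1, Pi.add_apply, h2, h3, h4, h5, Pi.add_apply, map_add]

lemma mulLp_smul_right (c : ℝ) (A : E3 →ᵇ (E3 →L[ℝ] E3)) (u : L2) :
    mulLp A (c • u) = c • mulLp A u := by
  refine Lp.ext ?_
  filter_upwards [Lp.coeFn_smul c (mulLp A u), coeFn_mulLp A u, coeFn_mulLp A (c • u),
    Lp.coeFn_smul c u] with x h1 h2 h3 h4
  rw [h1, Pi.smul_apply, h2, h3, h4, Pi.smul_apply, map_smul]

lemma isBoundedBilinearMap_mulLp :
    IsBoundedBilinearMap ℝ (fun p : (E3 →ᵇ (E3 →L[ℝ] E3)) × L2 => mulLp p.1 p.2) where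
  add_left := mulLp_add_left
  smul_left := mulLp_smul_left
  add_right := mulLp_add_right
  smul_right := mulLp_smul_right
  bound := ⟨1, one_pos, fun A u => by rw [one_mul]; exact norm_mulLp_le A u⟩

lemma continuous_mulLp :
    Continuous (fun p : (E3 →ᵇ (E3 →L[ℝ] E3)) × L2 => mulLp p.1 p.2) :=
  isBoundedBilinearMap_mulLp.continuous

lemma inner_mulLp (A : E3 →ᵇ (E3 →L[ℝ] E3)) (u v : L2) :
    inner ℝ v (mulLp A u) = ∫ x, inner ℝ (v x) (A x (u x)) := by
  rw [inner_eq_integral]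
  refine integral_congr_ae ?_
  filter_upwards [coeFn_mulLp A u] with x hx
  rw [hx]

/-- A jointly continuous compactly supported map is a continuous curve of bounded functions. -/
lemma exists_bcf_curve {P F : Type*} [NormedAddCommGroup P] [NormedAddCommGroup F]
    (K : P × E3 → F) (hK : Continuous K) (hc : HasCompactSupport K) :
    ∃ k : P → E3 →ᵇ F, Continuous k ∧ ∀ p x, k p x = K (p, x) := by
  obtain ⟨C, hC⟩ := hK.bounded_above_of_compact_support hc
  have hu := hc.uniformContinuous_of_continuous hK
  refine ⟨fun p => BoundedContinuousFunction.ofNormedAddCommGroup (fun x => K (p, x))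
    (hK.comp (by fun_prop)) C (fun x => hC _), ?_, fun p x => rfl⟩
  rw [Metric.continuous_iff]
  intro p ε hε
  obtain ⟨δ, hδ, H⟩ := Metric.uniformContinuous_iff.1 hu (ε / 2) (by positivity)
  refine ⟨δ, hδ, fun q hq => lt_of_le_of_lt ?_ (half_lt_self hε)⟩
  refine (BoundedContinuousFunction.dist_le (by positivity)).2 fun x => ?_
  refine (H ?_).le
  rw [Prod.dist_eq]; simpa using hq

lemma HasCompactSupport.slice {P F : Type*} [NormedAddCommGroup P] [NormedAddCommGroup F]
    {K : P × E3 → F} (hc : HasCompactSupport K) (p : P) :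
    HasCompactSupport (fun x => K (p, x)) := by
  refine HasCompactSupport.of_support_subset_isCompact (hc.isCompact.image continuous_snd) ?_
  intro x hx
  exact ⟨(p, x), subset_tsupport _ hx, rfl⟩

/-- A jointly continuous compactly supported map is a continuous curve in `L²`. -/
lemma continuous_ccLp_curve {P : Type*} [NormedAddCommGroup P]
    (K : P × E3 → E3) (hK : Continuous K) (hc : HasCompactSupport K) :
    Continuous (fun p => ccLp (fun x => K (p, x)) (hK.comp (by fun_prop))
      (HasCompactSupport.slice hc p)) := by
  obtain ⟨R, hR⟩ := (hc.isCompact.image continuous_snd).isBounded.subset_closedBall (0 : E3)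
  set B : Set E3 := Metric.closedBall 0 R
  have hBfin : volume B ≠ ⊤ := measure_closedBall_lt_top.ne
  have hz : ∀ p x, x ∉ B → K (p, x) = 0 := by
    intro p x hx
    by_contra h
    exact hx (hR ⟨(p, x), subset_tsupport _ h, rfl⟩)
  have hu := hc.uniformContinuous_of_continuous hK
  rw [Metric.continuous_iff]
  intro p ε hε
  -- `V` is the `L²` norm of the indicator of `B`, which carries the supports of all slices. A
  -- uniform error `ε / (V + 1)` costs at most `ε V / (V + 1) < ε` in `L²`; the `+ 1` covers `V =
  -- 0`.
  set V : ℝ := (volume B).toReal ^ (1 / (2 : ℝ≥0∞).toReal)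
  have hV : 0 ≤ V := by positivity
  obtain ⟨δ, hδ, H⟩ := Metric.uniformContinuous_iff.1 hu (ε / (V + 1)) (by positivity)
  refine ⟨δ, hδ, fun q hq => ?_⟩
  rw [dist_eq_norm]
  have hind := norm_indicatorConstLp (p := 2) (μ := (volume : Measure E3)) (s := B)
    (c := (ε / (V + 1) : ℝ)) (hs := Metric.isClosed_closedBall.measurableSet) (hμs := hBfin) (by norm_num)
    (by norm_num)
  have hle : ‖ccLp (fun x => K (q, x)) (hK.comp (by fun_prop)) (HasCompactSupport.slice hc q)
      - ccLp (fun x => K (p, x)) (hK.comp (by fun_prop)) (HasCompactSupport.slice hc p)‖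
      ≤ ‖indicatorConstLp (p := 2) (μ := (volume : Measure E3)) (s := B)
        Metric.isClosed_closedBall.measurableSet hBfin (ε / (V + 1) : ℝ)‖ := by
    refine Lp.norm_le_norm_of_ae_le ?_
    filter_upwards [Lp.coeFn_sub (ccLp (fun x => K (q, x)) (hK.comp (by fun_prop))
      (HasCompactSupport.slice hc q)) (ccLp (fun x => K (p, x)) (hK.comp (by fun_prop))
      (HasCompactSupport.slice hc p)),
      coeFn_ccLp (f := fun x => K (q, x)) (hK.comp (by fun_prop)) (HasCompactSupport.slice hc q),
      coeFn_ccLp (f := fun x => K (p, x)) (hK.comp (by fun_prop)) (HasCompactSupport.slice hc p),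
      indicatorConstLp_coeFn (p := 2) (μ := (volume : Measure E3)) (s := B)
        (hs := Metric.isClosed_closedBall.measurableSet) (hμs := hBfin) (c := (ε / (V + 1) : ℝ))]
      with x h1 h2 h3 h4
    rw [h1, Pi.sub_apply, h2, h3, h4]
    by_cases hx : x ∈ B
    · rw [indicator_of_mem hx, ← dist_eq_norm]
      refine le_trans (H ?_).le (le_abs_self _)
      rw [Prod.dist_eq]; simpa using hq
    · simp [hz _ _ hx, indicator_of_notMem hx]
  refine hle.trans_lt ?_
  rw [hind, Real.norm_of_nonneg (by positivity)]
  change ε / (V + 1) * V < ε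
  rw [div_mul_eq_mul_div, div_lt_iff₀ (by positivity)]
  nlinarith

/-! ### Weak limits in Hilbert spaces. -/

/-- A bounded sequence in a Hilbert space whose inner products with every vector converge has a
weak limit. -/
lemma exists_weak_limit {H : Type*} [NormedAddCommGroup H] [InnerProductSpace ℝ H]
    [CompleteSpace H] (z : ℕ → H) (C : ℝ) (hC : ∀ n, ‖z n‖ ≤ C)
    (hz : ∀ g, ∃ l, Tendsto (fun n => inner ℝ (z n) g) atTop (𝓝 l)) :
    ∃ w : H, ‖w‖ ≤ C ∧ ∀ g, Tendsto (fun n => inner ℝ (z n) g) atTop (𝓝 (inner ℝ w g)) := by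
  choose l hl using hz
  have hC0 : 0 ≤ C := (norm_nonneg _).trans (hC 0)
  let L : H →ₗ[ℝ] ℝ :=
    { toFun := l
      map_add' := fun a b => tendsto_nhds_unique (hl (a + b)) (by
        simpa only [inner_add_right] using (hl a).add (hl b))
      map_smul' := fun c a => tendsto_nhds_unique (hl (c • a)) (by
        simpa only [inner_smul_right, RingHom.id_apply, smul_eq_mul] using (hl a).const_mul c) }
  have hL : ∀ g, ‖L g‖ ≤ C * ‖g‖ := fun g => by
    refine le_of_tendsto (hl g).norm (Eventually.of_forall fun n => ?_)
    exact (norm_inner_le_norm _ _).trans (mul_le_mul_of_nonneg_right (hC n) (norm_nonneg _))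
  let Lc : H →L[ℝ] ℝ := L.mkContinuous C hL
  refine ⟨(InnerProductSpace.toDual ℝ H).symm Lc, ?_, fun g => ?_⟩
  · rw [LinearIsometryEquiv.norm_map]
    exact L.mkContinuous_norm_le hC0 hL
  · rw [InnerProductSpace.toDual_symm_apply]
    exact hl g

/-- The vectors against which a sequence converges form a subspace. -/
def convSubmodule {H : Type*} [NormedAddCommGroup H] [InnerProductSpace ℝ H] (z : ℕ → H) :
    Submodule ℝ H where
  carrier := {g | ∃ l, Tendsto (fun n => inner ℝ (z n) g) atTop (𝓝 l)}
  add_mem' := by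
    rintro a b ⟨l, hl⟩ ⟨m, hm⟩
    exact ⟨l + m, by simpa only [inner_add_right] using hl.add hm⟩
  zero_mem' := ⟨0, by simp⟩
  smul_mem' := by
    rintro c a ⟨l, hl⟩
    exact ⟨c * l, by simpa only [inner_smul_right] using hl.const_mul c⟩

/-- Replacing `g` by a nearby `g'` changes all the pairings uniformly, since the sequence is
bounded. Weak convergence therefore needs to be checked only on vectors spanning a dense subspace.
-/
lemma isClosed_convSubmodule {H : Type*} [NormedAddCommGroup H] [InnerProductSpace ℝ H]
    (z : ℕ → H) (C : ℝ) (hC : ∀ n, ‖z n‖ ≤ C) : IsClosed (convSubmodule z : Set H) := by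
  have hC0 : 0 ≤ C := (norm_nonneg _).trans (hC 0)
  refine isClosed_of_closure_subset fun g hg => ?_
  refine cauchySeq_tendsto_of_complete ?_
  rw [Metric.cauchySeq_iff']
  intro ε hε
  obtain ⟨g', ⟨l, hl⟩, hgg⟩ := Metric.mem_closure_iff.1 hg (ε / (4 * (C + 1))) (by positivity)
  obtain ⟨N, hN⟩ := Metric.cauchySeq_iff'.1 hl.cauchySeq (ε / 4) (by positivity)
  refine ⟨N, fun n hn => ?_⟩
  have h1 := hN n hn
  rw [Real.dist_eq] at h1 ⊢
  have hb : ∀ m, |inner ℝ (z m) g - inner ℝ (z m) g'| ≤ ε / 4 := fun m => by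
    rw [← inner_sub_right]
    refine (abs_real_inner_le_norm _ _).trans ?_
    rw [← dist_eq_norm]
    calc ‖z m‖ * dist g g' ≤ (C + 1) * (ε / (4 * (C + 1))) :=
          mul_le_mul ((hC m).trans (by linarith)) hgg.le dist_nonneg (by linarith)
      _ = ε / 4 := by field_simp
  have h2 := hb n
  have h3 := hb N
  rw [abs_le] at h2 h3
  rw [abs_lt] at h1 ⊢
  constructor <;> linarith [h1.1, h1.2, h2.1, h2.2, h3.1, h3.2]

/-! ### Translations and difference quotients. -/

/-- Translation of an `L²` field: `(translate y u) x = u (x - y)`. -/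
def translate (y : E3) (u : L2) : L2 :=
  Lp.compMeasurePreserving (fun x => x - y) (measurePreserving_sub_right volume y) u

lemma coeFn_translate (y : E3) (u : L2) : translate y u =ᵐ[volume] fun x => u (x - y) :=
  Lp.coeFn_compMeasurePreserving u (measurePreserving_sub_right volume y)

lemma norm_translate (y : E3) (u : L2) : ‖translate y u‖ = ‖u‖ :=
  Lp.norm_compMeasurePreserving u (measurePreserving_sub_right volume y)

lemma translate_sub (y : E3) (u v : L2) : translate y (u - v) = translate y u - translate y v :=
  map_sub _ _ _

lemma translate_zero (u : L2) : translate 0 u = u := by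
  refine Lp.ext ?_
  filter_upwards [coeFn_translate 0 u] with x hx
  rw [hx, sub_zero]

lemma continuous_translate (u : L2) : Continuous (fun y => translate y u) := by
  have hg : Continuous (fun y : E3 => (ContinuousMap.mk (fun x : E3 => x - y) (by fun_prop))) :=
    ContinuousMap.continuous_of_continuous_uncurry _ (by
      simp only [Function.uncurry_def, ContinuousMap.coe_mk]; fun_prop)
  exact (continuous_const (y := u)).compMeasurePreservingLp hg
    (fun y => measurePreserving_sub_right volume y) (by norm_num)

lemma inner_translate (y : E3) (u v : L2) :
    inner ℝ (translate y u) v = inner ℝ u (translate (-y) v) := by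
  have h1 : inner ℝ (translate y u) v = ∫ x, inner ℝ (u (x - y)) (v x) := by
    rw [inner_eq_integral]
    refine integral_congr_ae ?_
    filter_upwards [coeFn_translate y u] with x hx
    rw [hx]
  have h2 : inner ℝ u (translate (-y) v) = ∫ x, inner ℝ (u x) (v (x + y)) := by
    rw [inner_eq_integral]
    refine integral_congr_ae ?_
    filter_upwards [coeFn_translate (-y) v] with x hx
    rw [hx, sub_neg_eq_add]
  rw [h1, h2, ← integral_sub_right_eq_self (fun x => (inner ℝ (u x) (v (x + y)) : ℝ)) y]
  simp

namespace IsTestField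
variable {ψ : E3 → E3}

lemma translated (h : IsTestField ψ) (y : E3) : IsTestField (fun x => ψ (x - y)) :=
  ⟨h.smooth.comp (contDiff_id.sub contDiff_const),
    h.compact.comp_homeomorph (Homeomorph.subRight y)⟩

lemma translate_toL2 (h : IsTestField ψ) (y : E3) :
    translate y h.toL2 = (h.translated y).toL2 := by
  refine Lp.ext ?_
  have h1 := (measurePreserving_sub_right volume y).quasiMeasurePreserving.ae_eq_comp
    h.coeFn_toL2
  filter_upwards [coeFn_translate y h.toL2, (h.translated y).coeFn_toL2, h1] with x h1 h2 h3
  rw [h1, h2]; exact h3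

lemma inner_translate_toL2 (h : IsTestField ψ) (u : L2) (y : E3) :
    inner ℝ u (translate y h.toL2) = ∫ x, inner ℝ (u x) (ψ (x - y)) := by
  rw [h.translate_toL2, inner_toL2]

/-- As a function of `y` the pairing is the convolution of `u` with the reflected field `z ↦ ψ
(-z)`, so all derivatives fall on the smooth factor; the reflection produces the sign. -/
lemma hasFDerivAt_inner_translate (h : IsTestField ψ) (u : L2) (y : E3) :
    ∃ A : E3 →L[ℝ] ℝ, HasFDerivAt (fun y => inner ℝ u (translate y h.toL2)) A y ∧
      ∀ k, A k = - inner ℝ u (translate y (h.partial' k).toL2) := by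
  set ψ' : E3 → E3 := fun z => ψ (-z)
  have hs : ContDiff ℝ ∞ ψ' := h.smooth.comp contDiff_neg
  have hc : HasCompactSupport ψ' := h.compact.comp_homeomorph (Homeomorph.neg E3)
  have key := hc.hasFDerivAt_convolution_right (innerSL ℝ) (locallyIntegrable u)
    (hs.of_le (by exact_mod_cast le_top)) y
  refine ⟨_, key.congr_of_eventuallyEq (Eventually.of_forall fun z => ?_), fun k => ?_⟩
  · simp only []
    rw [inner_translate_toL2, convolution_def]
    simp only [ψ', neg_sub]; rfl
  · rw [convolution_precompR_apply _ (locallyIntegrable u) (hc.fderiv ℝ)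
      (hs.continuous_fderiv (by simp)), inner_translate_toL2, convolution_def, ← integral_neg]
    congr 1
    ext x
    have : fderiv ℝ ψ' (y - x) = - fderiv ℝ ψ (x - y) := by
      have h1 : HasFDerivAt ψ (fderiv ℝ ψ (x - y)) (-(y - x)) := by
        rw [neg_sub]; exact (h.smooth.differentiable (by simp) _).hasFDerivAt
      have h2 := (h1.comp (y - x) (hasFDerivAt_id (𝕜 := ℝ) (y - x)).neg).fderiv
      have h3 : ψ ∘ Neg.neg = ψ' := rfl
      rw [h3] at h2
      rw [h2]; ext z; simp
    rw [this, neg_apply, map_neg]; rfl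

lemma inner_translate_partial (h : IsTestField ψ) {u w : L2} {i : Fin 3}
    (hw : HasWeakPartial i u w) (y : E3) :
    inner ℝ u (translate y (h.partial' (e i)).toL2) = - inner ℝ w (translate y h.toL2) := by
  rw [inner_translate_toL2, h.translate_toL2, ← hasWeakPartial_iff.1 hw, inner_toL2]
  congr 1; ext x
  congr 1
  have : (fun x => ψ (x - y)) = ψ ∘ (fun x => x - y) := rfl
  rw [fderiv_comp_sub]

end IsTestField

lemma E3.eq_sum (k : E3) : k = ∑ i, k i • e i := by
  ext j; simp [e, Finset.sum_apply, Pi.single_apply]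

lemma E3.abs_apply_le (k : E3) (i : Fin 3) : |k i| ≤ ‖k‖ := by
  simpa using PiLp.norm_apply_le k i

/-- The mean value inequality: the gradient of the pairing in `y` is minus the pairing of `u` with a
translated derivative of `ψ`, which equals the pairing of the weak derivatives of `u` with the
translated `ψ`. -/
lemma IsTestField.abs_inner_translate_sub_le {ψ : E3 → E3} (h : IsTestField ψ) {u : L2}
    {w : Fin 3 → L2} (hw : ∀ i, HasWeakPartial i u (w i)) (y : E3) :
    |inner ℝ u (translate y h.toL2 - h.toL2)| ≤ (∑ i, ‖w i‖) * ‖h.toL2‖ * ‖y‖ := by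
  choose A hA hAk using fun z => h.hasFDerivAt_inner_translate u z
  have hb : ∀ z, ‖A z‖ ≤ (∑ i, ‖w i‖) * ‖h.toL2‖ := by
    intro z
    refine ContinuousLinearMap.opNorm_le_bound _ (by positivity) fun k => ?_
    conv_lhs => rw [E3.eq_sum k]
    rw [map_sum, Finset.sum_mul, Finset.sum_mul]
    refine (norm_sum_le _ _).trans (Finset.sum_le_sum fun i _ => ?_)
    rw [map_smul, hAk, h.inner_translate_partial (hw i), norm_smul, neg_neg]
    calc ‖k i‖ * ‖inner ℝ (w i) (translate z h.toL2)‖ ≤ ‖k‖ * (‖w i‖ * ‖h.toL2‖) := by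
          refine mul_le_mul (E3.abs_apply_le k i) ?_ (norm_nonneg _) (norm_nonneg _)
          rw [← norm_translate z h.toL2]
          exact norm_inner_le_norm _ _
      _ = _ := by ring
  have := convex_univ.norm_image_sub_le_of_norm_hasFDerivWithin_le
    (fun z _ => (hA z).hasFDerivWithinAt) (fun z _ => hb z) (mem_univ 0) (mem_univ y)
  rw [translate_zero, sub_zero, ← inner_sub_right] at this
  exact this

lemma induction_testField {P : L2 → Prop} (hP : IsClosed {v | P v})
    (H : ∀ ψ (h : IsTestField ψ), P h.toL2) (v : L2) : P v := by
  refine hP.closure_subset_iff.2 ?_ (dense_testFields v)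
  rintro _ ⟨ψ, h, rfl⟩
  exact H ψ h

lemma norm_le_of_abs_inner_testField_le {u : L2} {C : ℝ} (hC : 0 ≤ C)
    (H : ∀ ψ (h : IsTestField ψ), |inner ℝ u h.toL2| ≤ C * ‖h.toL2‖) : ‖u‖ ≤ C := by
  have H' : ∀ v : L2, |inner ℝ u v| ≤ C * ‖v‖ := by
    intro v
    have hcl : IsClosed {v : L2 | |inner ℝ u v| ≤ C * ‖v‖} :=
      isClosed_le (by fun_prop) (by fun_prop)
    exact induction_testField hcl H v
  have h1 := H' u
  rw [real_inner_self_eq_norm_sq, abs_of_nonneg (by positivity), sq] at h1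
  by_contra! hlt
  have : 0 < ‖u‖ := hC.trans_lt hlt
  nlinarith

/-- `‖u(· - y) - u‖ ≤ |y| ∑ ‖∂ᵢ u‖` for `u ∈ H¹`. -/
lemma norm_translate_sub_le {u : L2} {w : Fin 3 → L2} (hw : ∀ i, HasWeakPartial i u (w i))
    (y : E3) : ‖translate y u - u‖ ≤ (∑ i, ‖w i‖) * ‖y‖ := by
  refine norm_le_of_abs_inner_testField_le (by positivity) fun ψ h => ?_
  have : inner ℝ (translate y u - u) h.toL2
      = inner ℝ u (translate (-y) h.toL2 - h.toL2) := by
    rw [inner_sub_left, inner_translate, inner_sub_right]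
  rw [this]
  refine (h.abs_inner_translate_sub_le hw (-y)).trans_eq ?_
  rw [norm_neg]; ring

lemma norm_e (i : Fin 3) : ‖e i‖ = 1 := by simp [e]

/-- Difference quotients converge to the weak derivative strongly, that is, uniformly over `z` in
bounded sets. For a test field, the derivative of the left side in `s` is the pairing of `z` with
`translate (-s • e i) w - w`, small by continuity of translations; both sides are continuous in `z`,
so density concludes. -/
lemma abs_inner_translate_sub_sub_le {u w : L2} {i : Fin 3} (hw : HasWeakPartial i u w)
    {δ η : ℝ} (hδ : ∀ r : ℝ, |r| ≤ δ → ‖translate (r • e i) w - w‖ ≤ η) (s : ℝ)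
    (hs : |s| ≤ δ) (z : L2) :
    |inner ℝ u (translate (s • e i) z - z) - s * inner ℝ w z| ≤ η * |s| * ‖z‖ := by
  have hT : ∀ ψ (h : IsTestField ψ),
      |inner ℝ u (translate (s • e i) h.toL2 - h.toL2) - s * inner ℝ w h.toL2|
        ≤ η * |s| * ‖h.toL2‖ := by
    intro ψ h
    have hd : ∀ r : ℝ, HasDerivAt (fun r : ℝ => inner ℝ u (translate (r • e i) h.toL2)
        - r * inner ℝ w h.toL2)
        (inner ℝ w (translate (r • e i) h.toL2) - inner ℝ w h.toL2) r := by
      intro r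
      obtain ⟨A, hA, hAk⟩ := h.hasFDerivAt_inner_translate u (r • e i)
      have h1 : HasDerivAt (fun r : ℝ => r • e i) (e i) r := by
        simpa using (hasDerivAt_id r).smul_const (e i)
      have h2 := hA.comp_hasDerivAt r h1
      rw [hAk, h.inner_translate_partial hw, neg_neg] at h2
      exact h2.sub (by simpa using (hasDerivAt_id r).mul_const (inner ℝ w h.toL2))
    have hb : ∀ r ∈ Icc (-δ) δ, ‖inner ℝ w (translate (r • e i) h.toL2) - inner ℝ w h.toL2‖
        ≤ η * ‖h.toL2‖ := by
      intro r hr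
      have : inner ℝ w (translate (r • e i) h.toL2) - inner ℝ w h.toL2
          = inner ℝ (translate ((-r) • e i) w - w) h.toL2 := by
        rw [inner_sub_left, inner_translate, neg_smul, neg_neg]
      rw [this]
      refine (norm_inner_le_norm _ _).trans ?_
      exact mul_le_mul_of_nonneg_right (hδ _ (by rw [abs_neg]; exact abs_le.2 hr)) (norm_nonneg _)
    have h0 : (0 : ℝ) ∈ Icc (-δ) δ := by
      have := (abs_nonneg s).trans hs
      constructor <;> linarith
    have := (convex_Icc (-δ) δ).norm_image_sub_le_of_norm_hasDerivWithin_le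
      (fun r _ => (hd r).hasDerivWithinAt) hb h0 (abs_le.1 hs)
    simp only [zero_smul, translate_zero, zero_mul, sub_zero] at this
    rw [inner_sub_right]
    refine le_trans (le_of_eq ?_) (this.trans_eq ?_)
    · rw [Real.norm_eq_abs]; congr 1; ring
    · rw [Real.norm_eq_abs]; ring
  have hct : Continuous (fun z => translate (s • e i) z) :=
    (Lp.isometry_compMeasurePreserving (measurePreserving_sub_right volume (s • e i))).continuous
  have hcl : IsClosed {z : L2 |
      |inner ℝ u (translate (s • e i) z - z) - s * inner ℝ w z| ≤ η * |s| * ‖z‖} :=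
    isClosed_le (by fun_prop) (by fun_prop)
  exact induction_testField hcl hT z

/-- Integration by parts for fields having a weak partial derivative in `L²`. -/
lemma inner_weakPartial_left {u w z y : L2} {i : Fin 3} (hu : HasWeakPartial i u w)
    (hz : HasWeakPartial i z y) : inner ℝ w z = - inner ℝ u y := by
  refine eq_of_sub_eq_zero (abs_eq_zero.1 (le_antisymm ?_ (abs_nonneg _)))
  refine le_of_forall_pos_le_add fun ε hε => ?_
  set η : ℝ := ε / (‖z‖ + ‖u‖ + 1)
  have hη : 0 < η := by positivity
  have hcont : ∀ v : L2, ∃ δ > 0, ∀ r : ℝ, |r| ≤ δ → ‖translate (r • e i) v - v‖ ≤ η := by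
    intro v
    have hc : Continuous (fun r : ℝ => translate (r • e i) v) :=
      (continuous_translate v).comp (by fun_prop)
    obtain ⟨δ, hδ, H⟩ := Metric.continuousAt_iff.1 (hc.continuousAt (x := 0)) η hη
    refine ⟨δ / 2, by positivity, fun r hr => ?_⟩
    have := H (x := r) (by rw [Real.dist_eq, sub_zero]; linarith)
    rw [zero_smul, translate_zero, dist_eq_norm] at this
    exact this.le
  obtain ⟨δ₁, hδ₁, H₁⟩ := hcont w
  obtain ⟨δ₂, hδ₂, H₂⟩ := hcont y
  set s := min δ₁ δ₂
  have hs : 0 < s := lt_min hδ₁ hδ₂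
  have a1 := abs_inner_translate_sub_sub_le hu H₁ s
    (by rw [abs_of_pos hs]; exact min_le_left _ _) z
  have a2 := abs_inner_translate_sub_sub_le hz H₂ (-s)
    (by rw [abs_neg, abs_of_pos hs]; exact min_le_right _ _) u
  -- Discrete integration by parts: the difference operators of steps `s` and `-s` are adjoint. The
  -- two expansions `a1` and `a2` thus describe the same number, with main terms `s ⟨w, z⟩` and `-s
  -- ⟨u, y⟩`.
  have e1 : inner ℝ z (translate ((-s) • e i) u - u) = inner ℝ u (translate (s • e i) z - z) := by
    rw [inner_sub_right, inner_sub_right, ← real_inner_comm, inner_translate, neg_smul, neg_neg,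
      real_inner_comm z u]
  rw [e1, real_inner_comm u y, abs_neg, abs_of_pos hs] at a2
  rw [abs_of_pos hs] at a1
  rw [abs_le] at a1 a2
  have hη' : η * (‖z‖ + ‖u‖ + 1) = ε := by simp only [η]; field_simp
  rw [zero_add, abs_le]
  constructor
  · by_contra! hlt
    nlinarith [a1.1, a1.2, a2.1, a2.2, norm_nonneg z, norm_nonneg u]
  · by_contra! hlt
    nlinarith [a1.1, a1.2, a2.1, a2.2, norm_nonneg z, norm_nonneg u]

/-! ### Product rule and Hardy's inequality. -/

/-- The product rule for weak partial derivatives. -/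
lemma HasWeakPartial.smul {f : E3 → ℝ} (hf : ContDiff ℝ ∞ f) {u w a b : L2} {i : Fin 3}
    (hw : HasWeakPartial i u w) (ha : a =ᵐ[volume] fun x => f x • u x)
    (hb : b =ᵐ[volume] fun x => fderiv ℝ f x (e i) • u x + f x • w x) : HasWeakPartial i a b := by
  intro ψ hψ hc
  have h1 := hw (fun x => ψ x * f x) (hψ.mul hf) hc.mul_right
  have hd : ∀ x, fderiv ℝ (fun x => ψ x * f x) x (e i)
      = fderiv ℝ ψ x (e i) * f x + ψ x * fderiv ℝ f x (e i) := by
    intro x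
    rw [fderiv_fun_mul (hψ.differentiable (by simp) x) (hf.differentiable (by simp) x)]
    simp; ring
  have cf : Continuous (fun x => fderiv ℝ f x (e i)) :=
    ((hf.continuous_fderiv (by simp)).clm_apply continuous_const)
  have cψ : Continuous (fun x => fderiv ℝ ψ x (e i)) :=
    ((hψ.continuous_fderiv (by simp)).clm_apply continuous_const)
  have i1 := integrable_smul (a := fun x => fderiv ℝ ψ x (e i) * f x)
    (cψ.mul hf.continuous) (hc.fderiv_apply ℝ (e i)).mul_right u
  have i2 := integrable_smul (a := fun x => ψ x * fderiv ℝ f x (e i))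
    (hψ.continuous.mul cf) hc.mul_right u
  have i3 := integrable_smul (a := fun x => ψ x * f x)
    (hψ.continuous.mul hf.continuous) hc.mul_right w
  simp only [hd, add_smul] at h1
  rw [integral_add i1 i2] at h1
  have e1 : ∫ x, fderiv ℝ ψ x (e i) • a x = ∫ x, (fderiv ℝ ψ x (e i) * f x) • u x := by
    refine integral_congr_ae ?_
    filter_upwards [ha] with x hx
    rw [hx, smul_smul]
  have e2 : ∫ x, ψ x • b x = ∫ x, ((ψ x * fderiv ℝ f x (e i)) • u x + (ψ x * f x) • w x) := by
    refine integral_congr_ae ?_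
    filter_upwards [hb] with x hx
    rw [hx, smul_add, smul_smul, smul_smul]
  rw [e1, e2, integral_add i2 i3, neg_add, ← h1]
  abel

lemma memLp_smul {f : E3 → ℝ} (hf : Continuous f) {C : ℝ} (hC : ∀ x, |f x| ≤ C) (u : L2) :
    MemLp (fun x => f x • u x) 2 (volume : Measure E3) := by
  refine (Lp.memLp u).of_le_mul (c := C) ?_ (Eventually.of_forall fun x => ?_)
  · exact hf.aestronglyMeasurable.smul (Lp.aestronglyMeasurable u)
  · rw [norm_smul]
    exact mul_le_mul_of_nonneg_right (hC x) (norm_nonneg _)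

lemma E3.norm_sq_eq (k : E3) : ‖k‖ ^ 2 = ∑ i, k i ^ 2 := by
  rw [EuclideanSpace.norm_sq_eq]; simp

/-- A form of Hardy's inequality: the mass of an `H¹` field in a ball of radius `ρ` is
`O(ρ²) ‖∇u‖²`. -/
lemma integral_ball_norm_sq_le {u : L2} {w : Fin 3 → L2} (hw : ∀ i, HasWeakPartial i u (w i))
    (c : E3) {ρ : ℝ} (hρ : 0 < ρ) :
    ∫ x in Metric.ball c ρ, ‖u x‖ ^ 2 ≤ 8 * ρ ^ 2 * ∑ i, ‖w i‖ ^ 2 := by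
  set q : E3 → ℝ := fun x => ρ ^ 2 + ‖x - c‖ ^ 2
  have hq : ∀ x, 0 < q x := fun x => by positivity
  have hqs : ContDiff ℝ ∞ q := contDiff_const.add ((contDiff_id.sub contDiff_const).norm_sq ℝ)
  -- The multiplier of Hardy's inequality, `y / |y|²`, regularised at scale `ρ` so as to be smooth
  -- with bounded components and bounded divergence.
  set f : Fin 3 → E3 → ℝ := fun i x => (x - c) i * (q x)⁻¹
  have hfs : ∀ i, ContDiff ℝ ∞ (f i) := fun i =>
    ((coordL i).contDiff.comp (contDiff_id.sub contDiff_const)).mul (hqs.inv fun x => (hq x).ne')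
  set f' : Fin 3 → E3 → ℝ := fun i x => (q x)⁻¹ - 2 * (x - c) i ^ 2 * (q x)⁻¹ ^ 2
  have hfd : ∀ i x, fderiv ℝ (f i) x (e i) = f' i x := by
    intro i x
    have h0 : HasFDerivAt (fun x : E3 => x - c) (ContinuousLinearMap.id ℝ E3) x :=
      (hasFDerivAt_id x).sub_const c
    have h1 : HasFDerivAt q _ x := (h0.norm_sq).const_add (ρ ^ 2)
    have h2 := (hasDerivAt_inv (hq x).ne').comp_hasFDerivAt x h1
    have h3 := ((coordL i).hasFDerivAt.comp x h0).mul h2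
    have h4 : (⇑(coordL i) ∘ fun x => x - c) * (Inv.inv ∘ q) = f i := rfl
    rw [h4] at h3
    rw [h3.fderiv]
    simp [e, f', EuclideanSpace.inner_single_right]
    ring
  have hq1 : ∀ x, ‖x - c‖ ^ 2 * (q x)⁻¹ ≤ 1 := fun x => by
    rw [← div_eq_mul_inv, div_le_one (hq x)]
    simp only [q]; nlinarith
  have hqi : ∀ x, 0 < (q x)⁻¹ := fun x => inv_pos.2 (hq x)
  have hyi : ∀ i x, (x - c) i ^ 2 ≤ ‖x - c‖ ^ 2 := fun i x => by
    rw [E3.norm_sq_eq (x - c)]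
    exact Finset.single_le_sum (f := fun i => (x - c) i ^ 2) (fun i _ => sq_nonneg _)
      (Finset.mem_univ i)
  have hfb : ∀ i x, |f i x| ≤ ρ⁻¹ := by
    intro i x
    simp only [f]
    rw [abs_mul, abs_of_pos (hqi x), ← div_eq_mul_inv, div_le_iff₀ (hq x), inv_mul_eq_div,
      le_div_iff₀ hρ]
    have := E3.abs_apply_le (x - c) i
    simp only [q]
    nlinarith [sq_nonneg (ρ - ‖x - c‖), norm_nonneg (x - c)]
  have hf'b : ∀ i x, |f' i x| ≤ (ρ ^ 2)⁻¹ := by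
    intro i x
    have h1 : (q x)⁻¹ ≤ (ρ ^ 2)⁻¹ := inv_anti₀ (by positivity) (by simp only [q]; nlinarith [sq_nonneg ‖x - c‖])
    have h2 : (x - c) i ^ 2 * (q x)⁻¹ ≤ 1 :=
      (mul_le_mul_of_nonneg_right (hyi i x) (hqi x).le).trans (hq1 x)
    have h3 : 0 ≤ (x - c) i ^ 2 * (q x)⁻¹ := mul_nonneg (sq_nonneg _) (hqi x).le
    have h4 : f' i x = (q x)⁻¹ * (1 - 2 * ((x - c) i ^ 2 * (q x)⁻¹)) := by simp only [f']; ring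
    rw [h4, abs_mul, abs_of_pos (hqi x)]
    refine (mul_le_of_le_one_right (hqi x).le ?_).trans h1
    rw [abs_le]; constructor <;> linarith
  have hf'c : ∀ i, Continuous (f' i) := fun i => by
    have : f' i = fun x => fderiv ℝ (f i) x (e i) := by ext x; rw [hfd]
    rw [this]
    exact ((hfs i).continuous_fderiv (by simp)).clm_apply continuous_const
  have ma : ∀ i, MemLp (fun x => f i x • u x) 2 (volume : Measure E3) := fun i =>
    memLp_smul (hfs i).continuous (hfb i) u
  have mb : ∀ i, MemLp (fun x => f' i x • u x + f i x • w i x) 2 (volume : Measure E3) := fun i =>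
    (memLp_smul (hf'c i) (hf'b i) u).add (memLp_smul (hfs i).continuous (hfb i) (w i))
  -- Integration by parts: summed over `i`, this is `∫ (div f) |u|² + 2 ∑ᵢ ∫ fᵢ u · ∂ᵢu = 0`.
  have key : ∀ i, inner ℝ ((mb i).toLp _) u + inner ℝ ((ma i).toLp _) (w i) = 0 := by
    intro i
    have h1 : HasWeakPartial i ((ma i).toLp _) ((mb i).toLp _) := by
      refine (hw i).smul (hfs i) (ma i).coeFn_toLp ?_
      filter_upwards [(mb i).coeFn_toLp] with x hx
      rw [hx, hfd]
    rw [inner_weakPartial_left h1 (hw i)]; ring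
  have hsum : ∫ x, ∑ i, (inner ℝ ((mb i).toLp _ x) (u x) + inner ℝ ((ma i).toLp _ x) (w i x))
      = 0 := by
    rw [integral_finsetSum]
    swap
    · exact fun i _ => (integrable_inner _ _).add (integrable_inner _ _)
    refine Finset.sum_eq_zero fun i _ => ?_
    rw [integral_add (integrable_inner _ _) (integrable_inner _ _), ← inner_eq_integral,
      ← inner_eq_integral, key]
  have hae : ∀ᵐ x, (Metric.ball c ρ).indicator (fun x => (4 * ρ ^ 2)⁻¹ * ‖u x‖ ^ 2) x
      - 2 * ∑ i, ‖w i x‖ ^ 2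
      ≤ ∑ i, (inner ℝ ((mb i).toLp _ x) (u x) + inner ℝ ((ma i).toLp _ x) (w i x)) := by
    have h1 : ∀ᵐ x, ∀ i, (ma i).toLp _ x = f i x • u x :=
      ae_all_iff.2 fun i => (ma i).coeFn_toLp
    have h2 : ∀ᵐ x, ∀ i, (mb i).toLp _ x = f' i x • u x + f i x • w i x :=
      ae_all_iff.2 fun i => (mb i).coeFn_toLp
    filter_upwards [h1, h2] with x h1 h2
    -- Young's inequality `2 fᵢ u · wᵢ ≥ -fᵢ² |u|² / 2 - 2 |wᵢ|²` raises the coefficient of `(x -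
    -- c)ᵢ² / q²` from `2` to `5 / 2`.
    have h3 : ∀ i, ((q x)⁻¹ - 5 / 2 * (x - c) i ^ 2 * (q x)⁻¹ ^ 2) * ‖u x‖ ^ 2
        - 2 * ‖w i x‖ ^ 2
        ≤ inner ℝ ((mb i).toLp _ x) (u x) + inner ℝ ((ma i).toLp _ x) (w i x) := by
      intro i
      rw [h1, h2, inner_add_left, inner_smul_left, inner_smul_left, inner_smul_left,
        real_inner_self_eq_norm_sq, real_inner_comm]
      simp only [RCLike.conj_to_real]
      have h4 := abs_real_inner_le_norm (u x) (w i x)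
      have h5 : -(|f i x| * (‖u x‖ * ‖w i x‖)) ≤ f i x * inner ℝ (u x) (w i x) := by
        refine neg_le_of_abs_le ?_
        rw [abs_mul]
        exact mul_le_mul_of_nonneg_left h4 (abs_nonneg _)
      have h6 : f i x ^ 2 = (x - c) i ^ 2 * (q x)⁻¹ ^ 2 := by simp only [f]; ring
      have h7 : |f i x| ^ 2 = f i x ^ 2 := sq_abs _
      have h8 := sq_nonneg (|f i x| * ‖u x‖ - 2 * ‖w i x‖)
      simp only [f']
      nlinarith
    refine le_trans ?_ (Finset.sum_le_sum fun i _ => h3 i)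
    rw [Finset.sum_sub_distrib, ← Finset.mul_sum, ← Finset.sum_mul]
    refine sub_le_sub_right ?_ _
    have h4 : ∑ i : Fin 3, ((q x)⁻¹ - 5 / 2 * (x - c) i ^ 2 * (q x)⁻¹ ^ 2)
        = 3 * (q x)⁻¹ - 5 / 2 * (‖x - c‖ ^ 2 * (q x)⁻¹) * (q x)⁻¹ := by
      rw [E3.norm_sq_eq (x - c)]
      simp only [Fin.sum_univ_three]; ring
    -- The dimension enters here: since `|x - c|² / q ≤ 1`, the coefficient of `1 / q` is at least
    -- `3 - 5/2 > 0`. On the ball `q ≤ 2ρ²`, which gives the weight `1 / (4ρ²)`.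
    have h5 : 1 / 2 * (q x)⁻¹ ≤ ∑ i : Fin 3, ((q x)⁻¹ - 5 / 2 * (x - c) i ^ 2 * (q x)⁻¹ ^ 2) := by
      rw [h4]; nlinarith [hq1 x, hqi x]
    refine le_trans ?_ (mul_le_mul_of_nonneg_right h5 (sq_nonneg _))
    by_cases hx : x ∈ Metric.ball c ρ
    · rw [indicator_of_mem hx]
      refine mul_le_mul_of_nonneg_right ?_ (sq_nonneg _)
      have : q x ≤ 2 * ρ ^ 2 := by
        rw [mem_ball_iff_norm] at hx
        simp only [q]; nlinarith [norm_nonneg (x - c)]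
      have h6 := inv_anti₀ (hq x) this
      rw [mul_inv] at h6 ⊢
      linarith
    · rw [indicator_of_notMem hx]
      have := hqi x
      positivity
  have i1 : Integrable (fun x => (Metric.ball c ρ).indicator
      (fun x => (4 * ρ ^ 2)⁻¹ * ‖u x‖ ^ 2) x) volume :=
    ((integrable_norm_sq u).const_mul _).indicator Metric.isOpen_ball.measurableSet
  have i2 : Integrable (fun x => 2 * ∑ i, ‖w i x‖ ^ 2) volume :=
    (integrable_finsetSum _ fun i _ => integrable_norm_sq (w i)).const_mul _
  have i3 : Integrable (fun x => ∑ i, (inner ℝ ((mb i).toLp _ x) (u x)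
      + inner ℝ ((ma i).toLp _ x) (w i x))) volume :=
    integrable_finsetSum _ fun i _ => (integrable_inner _ _).add (integrable_inner _ _)
  have hfin := integral_mono_ae (i1.sub i2) i3 hae
  rw [hsum] at hfin
  simp only [Pi.sub_apply] at hfin
  rw [integral_sub i1 i2, integral_indicator Metric.isOpen_ball.measurableSet,
    integral_const_mul, integral_const_mul, integral_finsetSum _ fun i _ => integrable_norm_sq (w i)]
    at hfin
  simp only [← norm_sq_eq_integral] at hfin
  have h9 : (4 * ρ ^ 2)⁻¹ * ∫ x in Metric.ball c ρ, ‖u x‖ ^ 2 ≤ 2 * ∑ i, ‖w i‖ ^ 2 := by linarith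
  rw [inv_mul_le_iff₀ (by positivity)] at h9
  linarith

/-! ### Mollification. -/

lemma lintegral_enorm_sq (u : L2) : ∫⁻ x, ‖u x‖ₑ ^ 2 = ENNReal.ofReal (‖u‖ ^ 2) := by
  rw [norm_sq_eq_integral, ofReal_integral_eq_lintegral_ofReal (integrable_norm_sq u)
    (Eventually.of_forall fun x => sq_nonneg _)]
  refine lintegral_congr fun x => ?_
  rw [ENNReal.ofReal_pow (norm_nonneg _), ofReal_norm]

/-- Jensen's inequality for the `L²` norm of an average of a family of fields. -/
lemma lintegral_enorm_integral_sq_le (m : Measure E3) [IsProbabilityMeasure m]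
    {F : E3 → E3 → E3} (hF : Measurable (Function.uncurry F)) {K : ℝ≥0∞}
    (hK : ∀ᵐ t ∂m, ∫⁻ x, ‖F x t‖ₑ ^ 2 ≤ K) : ∫⁻ x, ‖∫ t, F x t ∂m‖ₑ ^ 2 ≤ K := by
  have h1 : ∀ x, ‖∫ t, F x t ∂m‖ₑ ^ 2 ≤ ∫⁻ t, ‖F x t‖ₑ ^ 2 ∂m := by
    intro x
    have hm : AEStronglyMeasurable (fun t => F x t) m :=
      (hF.comp (measurable_const.prodMk measurable_id)).aestronglyMeasurable
    have h2 := eLpNorm_le_eLpNorm_of_exponent_le (p := 1) (q := 2) (by norm_num) hm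
    rw [eLpNorm_one_eq_lintegral_enorm, eLpNorm_eq_lintegral_rpow_enorm_toReal (by norm_num)
      (by norm_num)] at h2
    have h3 := (enorm_integral_le_lintegral_enorm (μ := m) (fun t => F x t)).trans h2
    have h4 := pow_le_pow_left' h3 2
    refine h4.trans_eq ?_
    rw [← ENNReal.rpow_natCast, ← ENNReal.rpow_mul]
    simp
  have hm2 : Measurable (Function.uncurry fun x t => ‖F x t‖ₑ ^ 2) := by
    have := hF.enorm.pow_const 2
    exact this
  calc ∫⁻ x, ‖∫ t, F x t ∂m‖ₑ ^ 2 ≤ ∫⁻ x, ∫⁻ t, ‖F x t‖ₑ ^ 2 ∂m := lintegral_mono h1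
    _ = ∫⁻ t, (∫⁻ x, ‖F x t‖ₑ ^ 2) ∂m := lintegral_lintegral_swap hm2.aemeasurable
    _ ≤ ∫⁻ _, K ∂m := lintegral_mono_ae hK
    _ = K := by simp

/-- The mollification of an `L²` field by a normalized bump function. -/
def mollify (φ : ContDiffBump (0 : E3)) (u : L2) (x : E3) : E3 :=
  ∫ t, φ.normed volume t • u (x - t)

/-- The probability measure with density a normalized bump function. -/
def bumpMeasure (φ : ContDiffBump (0 : E3)) : Measure E3 :=
  volume.withDensity fun t => ENNReal.ofReal (φ.normed volume t)

lemma continuous_normed (φ : ContDiffBump (0 : E3)) : Continuous (φ.normed (volume : Measure E3)) :=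
  (φ.contDiff_normed (n := 0)).continuous

lemma contDiff_normed (φ : ContDiffBump (0 : E3)) :
    ContDiff ℝ ∞ (φ.normed (volume : Measure E3)) := φ.contDiff_normed

instance (φ : ContDiffBump (0 : E3)) : IsProbabilityMeasure (bumpMeasure φ) := by
  refine ⟨?_⟩
  rw [bumpMeasure, withDensity_apply _ MeasurableSet.univ, setLIntegral_univ,
    ← ofReal_integral_eq_lintegral_ofReal φ.integrable_normed
      (Eventually.of_forall φ.nonneg_normed), φ.integral_normed, ENNReal.ofReal_one]

lemma integral_bumpMeasure (φ : ContDiffBump (0 : E3)) (g : E3 → E3) :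
    ∫ t, g t ∂(bumpMeasure φ) = ∫ t, φ.normed volume t • g t := by
  rw [bumpMeasure, integral_withDensity_eq_integral_toReal_smul
    (continuous_normed φ).measurable.ennreal_ofReal (by simp)]
  refine integral_congr_ae (Eventually.of_forall fun t => ?_)
  simp only [ENNReal.toReal_ofReal (φ.nonneg_normed t)]

lemma integrable_bumpMeasure (φ : ContDiffBump (0 : E3)) (u : L2) (x : E3) :
    Integrable (fun t => u (x - t)) (bumpMeasure φ) := by
  rw [bumpMeasure, integrable_withDensity_iff_integrable_smul'
    (continuous_normed φ).measurable.ennreal_ofReal (by simp)]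
  have h1 : Integrable (fun t => φ.normed volume (x - t) • u t) volume :=
    integrable_smul ((continuous_normed φ).comp (by fun_prop))
      (φ.hasCompactSupport_normed.comp_homeomorph (Homeomorph.subLeft x)) u
  have h2 := h1.comp_sub_left x
  simp only [sub_sub_cancel] at h2
  refine h2.congr (Eventually.of_forall fun t => ?_)
  simp only [ENNReal.toReal_ofReal (φ.nonneg_normed t)]

lemma ae_bumpMeasure_norm_lt (φ : ContDiffBump (0 : E3)) :
    ∀ᵐ t ∂(bumpMeasure φ), ‖t‖ < φ.rOut := by
  rw [bumpMeasure, ae_withDensity_iff (continuous_normed φ).measurable.ennreal_ofReal]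
  refine Eventually.of_forall fun t ht => ?_
  have : t ∈ Function.support (φ.normed (volume : Measure E3)) := by
    intro h; rw [h] at ht; simp at ht
  rw [φ.support_normed_eq] at this
  simpa using this

lemma mollify_eq (φ : ContDiffBump (0 : E3)) (u : L2) (x : E3) :
    mollify φ u x = ∫ t, u (x - t) ∂(bumpMeasure φ) := (integral_bumpMeasure φ _).symm

lemma measurable_coe (u : L2) : Measurable (u : E3 → E3) := (Lp.stronglyMeasurable u).measurable

lemma lintegral_mollify_sq_le (φ : ContDiffBump (0 : E3)) (u : L2) :
    ∫⁻ x, ‖mollify φ u x‖ₑ ^ 2 ≤ ENNReal.ofReal (‖u‖ ^ 2) := by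
  simp only [mollify_eq]
  refine lintegral_enorm_integral_sq_le _ (F := fun x t => u (x - t))
    ((measurable_coe u).comp measurable_sub) (Eventually.of_forall fun t => ?_)
  rw [lintegral_sub_right_eq_self (fun x => ‖u x‖ₑ ^ 2) t, lintegral_enorm_sq]

/-- The difference is an average of `u (· - t) - u` over `‖t‖ < φ.rOut`; Jensen's inequality reduces
it to the bound on translations. The rate is linear in the radius, uniformly on bounded sets of
gradients. -/
lemma lintegral_mollify_sub_sq_le (φ : ContDiffBump (0 : E3)) {u : L2} {w : Fin 3 → L2}
    (hw : ∀ i, HasWeakPartial i u (w i)) :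
    ∫⁻ x, ‖mollify φ u x - u x‖ₑ ^ 2 ≤ ENNReal.ofReal (((∑ i, ‖w i‖) * φ.rOut) ^ 2) := by
  have h1 : ∀ x, mollify φ u x - u x = ∫ t, (u (x - t) - u x) ∂(bumpMeasure φ) := fun x => by
    rw [integral_sub (integrable_bumpMeasure φ u x) (integrable_const _), mollify_eq]
    simp
  simp only [h1]
  refine lintegral_enorm_integral_sq_le _ (F := fun x t => u (x - t) - u x)
    (((measurable_coe u).comp measurable_sub).sub ((measurable_coe u).comp measurable_fst)) ?_
  filter_upwards [ae_bumpMeasure_norm_lt φ] with t ht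
  have h2 : ∫⁻ x, ‖u (x - t) - u x‖ₑ ^ 2 = ENNReal.ofReal (‖translate t u - u‖ ^ 2) := by
    rw [← lintegral_enorm_sq]
    refine lintegral_congr_ae ?_
    filter_upwards [Lp.coeFn_sub (translate t u) u, coeFn_translate t u] with x h1 h2
    rw [h1, Pi.sub_apply, h2]
  rw [h2]
  refine ENNReal.ofReal_le_ofReal (pow_le_pow_left₀ (norm_nonneg _) ?_ 2)
  exact (norm_translate_sub_le hw t).trans
    (mul_le_mul_of_nonneg_left ht.le (by positivity))

lemma isTestField_normed (φ : ContDiffBump (0 : E3)) (c : E3) :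
    IsTestField (fun x => φ.normed volume x • c) :=
  isTestField_smul_const (contDiff_normed φ) φ.hasCompactSupport_normed c

/-- A value of the mollified field is a pairing of `u` with an `L²` vector, so weak convergence of
fields gives pointwise convergence of their mollifications. The evenness of the bump is used to
identify the kernel. -/
lemma inner_mollify (φ : ContDiffBump (0 : E3)) (u : L2) (x c : E3) :
    inner ℝ (mollify φ u x) c = inner ℝ u (translate x (isTestField_normed φ c).toL2) := by
  rw [IsTestField.inner_translate_toL2, mollify, real_inner_comm]
  have h1 : Integrable (fun t => φ.normed volume (x - t) • u t) volume :=
    integrable_smul ((continuous_normed φ).comp (by fun_prop))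
      (φ.hasCompactSupport_normed.comp_homeomorph (Homeomorph.subLeft x)) u
  have h2 := h1.comp_sub_left x
  simp only [sub_sub_cancel] at h2
  rw [← integral_inner h2, ← integral_sub_left_eq_self _ volume x]
  refine integral_congr_ae (Eventually.of_forall fun y => ?_)
  simp only [sub_sub_cancel]
  rw [inner_smul_right, inner_smul_right, real_inner_comm, ← neg_sub y x, φ.normed_neg]

lemma norm_mollify_le (φ : ContDiffBump (0 : E3)) :
    ∃ C : ℝ, 0 ≤ C ∧ ∀ u x, ‖mollify φ u x‖ ≤ C * ‖u‖ := by
  refine ⟨∑ j, ‖(isTestField_normed φ (e j)).toL2‖, by positivity, fun u x => ?_⟩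
  have h1 : ∀ j, |mollify φ u x j| ≤ ‖(isTestField_normed φ (e j)).toL2‖ * ‖u‖ := fun j => by
    have : mollify φ u x j = inner ℝ (mollify φ u x) (e j) := by
      simp [e, EuclideanSpace.inner_single_right]
    rw [this, inner_mollify, mul_comm, ← norm_translate x (isTestField_normed φ (e j)).toL2]
    exact abs_real_inner_le_norm _ _
  rw [Finset.sum_mul]
  refine le_trans ?_ (Finset.sum_le_sum fun j _ => h1 j)
  conv_lhs => rw [E3.eq_sum (mollify φ u x)]
  refine (norm_sum_le _ _).trans (Finset.sum_le_sum fun j _ => ?_)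
  rw [norm_smul, norm_e, mul_one, Real.norm_eq_abs]

lemma continuous_mollify (φ : ContDiffBump (0 : E3)) (u : L2) : Continuous (mollify φ u) := by
  have h1 : ∀ j, Continuous (fun x => mollify φ u x j) := fun j => by
    have : (fun x => mollify φ u x j)
        = fun x => inner ℝ u (translate x (isTestField_normed φ (e j)).toL2) := by
      ext x
      rw [← inner_mollify]
      simp [e, EuclideanSpace.inner_single_right]
    rw [this]
    exact continuous_const.inner (continuous_translate _)
  have : mollify φ u = fun x => ∑ j, (mollify φ u x j) • e j := by
    ext1 x; exact E3.eq_sum _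
  rw [this]
  exact continuous_finsetSum _ fun j _ => (h1 j).smul continuous_const

lemma tendsto_mollify (φ : ContDiffBump (0 : E3)) {z : ℕ → L2} {z₀ : L2}
    (hz : ∀ g, Tendsto (fun n => inner ℝ (z n) g) atTop (𝓝 (inner ℝ z₀ g))) (x : E3) :
    Tendsto (fun n => mollify φ (z n) x) atTop (𝓝 (mollify φ z₀ x)) := by
  have h1 : ∀ u, mollify φ u x
      = ∑ j, (inner ℝ u (translate x (isTestField_normed φ (e j)).toL2) : ℝ) • e j := fun u => by
    conv_lhs => rw [E3.eq_sum (mollify φ u x)]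
    refine Finset.sum_congr rfl fun j _ => ?_
    rw [← inner_mollify]
    simp [e, EuclideanSpace.inner_single_right]
  simp only [h1]
  exact tendsto_finsetSum _ fun j _ => (hz _).smul_const _

/-- Mollification upgrades weak convergence to convergence of local `L²` norms: the values converge
pointwise and are uniformly bounded, and the ball has finite volume. -/
lemma tendsto_lintegral_mollify (φ : ContDiffBump (0 : E3)) {z : ℕ → L2} {z₀ : L2} {C : ℝ}
    (hC : ∀ n, ‖z n‖ ≤ C)
    (hz : ∀ g, Tendsto (fun n => inner ℝ (z n) g) atTop (𝓝 (inner ℝ z₀ g))) (R : ℝ) :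
    Tendsto (fun n => ∫⁻ x in Metric.ball 0 R, ‖mollify φ (z n) x‖ₑ ^ 2) atTop
      (𝓝 (∫⁻ x in Metric.ball 0 R, ‖mollify φ z₀ x‖ₑ ^ 2)) := by
  obtain ⟨K, hK0, hK⟩ := norm_mollify_le φ
  refine tendsto_lintegral_of_dominated_convergence (fun _ => ENNReal.ofReal (K * C) ^ 2)
    (fun n => ((continuous_mollify φ (z n)).measurable.enorm.pow_const 2))
    (fun n => Eventually.of_forall fun x => ?_) ?_ (Eventually.of_forall fun x => ?_)
  · refine pow_le_pow_left' ?_ 2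
    rw [← ofReal_norm]
    exact ENNReal.ofReal_le_ofReal ((hK _ _).trans (mul_le_mul_of_nonneg_left (hC n) hK0))
  · rw [setLIntegral_const]
    exact ENNReal.mul_ne_top (by simp) measure_ball_lt_top.ne
  · exact ((ENNReal.continuous_pow 2).tendsto _).comp ((tendsto_mollify φ hz x).enorm)

lemma eq_zero_of_mollify_eq_zero {u : L2} (h : ∀ φ : ContDiffBump (0 : E3), mollify φ u = 0) :
    u = 0 := by
  -- The ratio of the outer to the inner radius is fixed to `2`, as Lebesgue differentiation along
  -- these kernels requires a bounded ratio.
  let φ : ℕ → ContDiffBump (0 : E3) := fun n =>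
    ⟨1 / ((n : ℝ) + 1) / 2, 1 / ((n : ℝ) + 1), by positivity, half_lt_self (by positivity)⟩
  have h1 : Tendsto (fun n => (φ n).rOut) atTop (𝓝 0) := tendsto_one_div_add_atTop_nhds_zero_nat
  have h2 := ContDiffBump.ae_convolution_tendsto_right_of_locallyIntegrable (φ := φ) (K := 2) h1
    (Eventually.of_forall fun n => by simp [φ]; field_simp; rfl) (locallyIntegrable u)
  refine Lp.ext ?_
  filter_upwards [h2, Lp.coeFn_zero E3 2 (volume : Measure E3)] with x hx h0
  rw [h0]
  refine tendsto_nhds_unique hx ?_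
  have : ∀ n, (convolution ((φ n).normed volume) u (ContinuousLinearMap.lsmul ℝ ℝ) volume) x
      = mollify (φ n) u x := fun n => rfl
  simp only [this, h]
  exact tendsto_const_nhds

/-! ### Liouville's theorem and the totality of solenoidal fields and gradients. -/

/-- Caccioppoli's inequality for a harmonic function, with a cutoff `a`. -/
lemma integral_cutoff_gradient_le {f : E3 → ℝ} {g h : Fin 3 → E3 → ℝ} {a : E3 → ℝ}
    (hfd : Differentiable ℝ f) (hgd : ∀ j, Differentiable ℝ (g j))
    (hfg : ∀ j x, fderiv ℝ f x (e j) = g j x) (hgh : ∀ j x, fderiv ℝ (g j) x (e j) = h j x)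
    (hhc : ∀ j, Continuous (h j)) (hΔ : ∀ x, ∑ j, h j x = 0)
    (ha : ContDiff ℝ ∞ a) (hac : HasCompactSupport a) {κ : ℝ}
    (haκ : ∀ x, ‖fderiv ℝ a x‖ ≤ κ) (hf2 : Integrable (fun x => f x ^ 2) volume) :
    ∫ x, a x ^ 2 * ∑ j, g j x ^ 2 ≤ 12 * κ ^ 2 * ∫ x, f x ^ 2 := by
  have hfc := hfd.continuous
  have hgc := fun j => (hgd j).continuous
  have hadc : ∀ j, Continuous (fun x => fderiv ℝ a x (e j)) := fun j =>
    (ha.continuous_fderiv (by simp)).clm_apply continuous_const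
  have hads : ∀ j, HasCompactSupport (fun x => fderiv ℝ a x (e j)) := fun j =>
    hac.fderiv_apply ℝ (e j)
  have had : Differentiable ℝ a := ha.differentiable (by simp)
  have hd : ∀ j x, fderiv ℝ (fun x => a x ^ 2 * f x) x (e j)
      = 2 * a x * fderiv ℝ a x (e j) * f x + a x ^ 2 * g j x := by
    intro j x
    have h1 := ((had x).hasFDerivAt.pow 2).mul (hfd x).hasFDerivAt
    have h2 : (fun x => a x ^ 2 * f x) = (fun x => a x ^ 2) * f := rfl
    rw [h2, h1.fderiv]
    simp [hfg]; ring
  -- The equation `∑ⱼ h j = 0` is tested with `a² f`.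
  have parts : ∀ j, ∫ x, (a x ^ 2 * f x) * h j x
      = - ∫ x, (2 * a x * fderiv ℝ a x (e j) * f x + a x ^ 2 * g j x) * g j x := by
    intro j
    have := integral_mul_fderiv_eq_neg_fderiv_mul_of_integrable (μ := (volume : Measure E3))
      (f := fun x => a x ^ 2 * f x) (g := g j) (v := e j) ?_ ?_ ?_ ?_ ?_
    · simpa only [hd, hgh] using this
    · simp only [hd]
      refine Continuous.integrable_of_hasCompactSupport (by fun_prop) ?_
      refine hac.mono' ?_
      refine (Function.support_subset_iff'.2 fun x hx => ?_).trans subset_closure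
      simp only [Function.mem_support, not_not] at hx
      simp [hx]
    · simp only [hgh]
      refine Continuous.integrable_of_hasCompactSupport (by fun_prop) ?_
      refine hac.mono' ?_
      refine (Function.support_subset_iff'.2 fun x hx => ?_).trans subset_closure
      simp only [Function.mem_support, not_not] at hx
      simp [hx]
    · refine Continuous.integrable_of_hasCompactSupport (by fun_prop) ?_
      refine hac.mono' ?_
      refine (Function.support_subset_iff'.2 fun x hx => ?_).trans subset_closure
      simp only [Function.mem_support, not_not] at hx
      simp [hx]
    · exact fun x _ => ((had.pow 2).mul hfd) x
    · exact fun x _ => hgd j x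
  have ccI : ∀ F : E3 → ℝ, Continuous F → (∀ x, a x = 0 → F x = 0) → Integrable F volume := by
    intro F hF h0
    refine hF.integrable_of_hasCompactSupport (hac.mono' ?_)
    refine (Function.support_subset_iff'.2 fun x hx => ?_).trans subset_closure
    simp only [Function.mem_support, not_not] at hx
    exact h0 x hx
  have hsum : ∑ j, ∫ x, (2 * a x * fderiv ℝ a x (e j) * f x + a x ^ 2 * g j x) * g j x = 0 := by
    have h1 : ∑ j, ∫ x, (a x ^ 2 * f x) * h j x = 0 := by
      rw [← integral_finsetSum _ fun j _ => ccI _ (by fun_prop) (fun x hx => by simp [hx])]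
      simp only [← Finset.mul_sum, hΔ, mul_zero, integral_zero]
    simp only [parts, Finset.sum_neg_distrib, neg_eq_zero] at h1
    exact h1
  rw [← integral_finsetSum _ fun j _ => ccI _ (by fun_prop) (fun x hx => by simp [hx])] at hsum
  have i1 : Integrable (fun x => a x ^ 2 * ∑ j, g j x ^ 2) volume :=
    ccI _ (by fun_prop) (fun x hx => by simp [hx])
  have hpt : ∀ x, 1 / 2 * (a x ^ 2 * ∑ j, g j x ^ 2) - 6 * κ ^ 2 * f x ^ 2
      ≤ ∑ j, (2 * a x * fderiv ℝ a x (e j) * f x + a x ^ 2 * g j x) * g j x := by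
    intro x
    have hb : ∀ j, (fderiv ℝ a x (e j)) ^ 2 ≤ κ ^ 2 := fun j => by
      rw [← sq_abs]
      refine pow_le_pow_left₀ (abs_nonneg _) ?_ 2
      have := (fderiv ℝ a x).le_of_opNorm_le (haκ x) (e j)
      rwa [norm_e, mul_one] at this
    -- The cross term is absorbed through `(a gⱼ + 2 (∂ⱼa) f)² ≥ 0`, at the cost of half of `a²
    -- gⱼ²`.
    have hj : ∀ j, 1 / 2 * (a x ^ 2 * g j x ^ 2) - 2 * κ ^ 2 * f x ^ 2
        ≤ (2 * a x * fderiv ℝ a x (e j) * f x + a x ^ 2 * g j x) * g j x := by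
      intro j
      nlinarith [sq_nonneg (a x * g j x + 2 * fderiv ℝ a x (e j) * f x),
        mul_le_mul_of_nonneg_right (hb j) (sq_nonneg (f x))]
    calc _ = ∑ j : Fin 3, (1 / 2 * (a x ^ 2 * g j x ^ 2) - 2 * κ ^ 2 * f x ^ 2) := by
          simp only [Fin.sum_univ_three]; ring
      _ ≤ _ := Finset.sum_le_sum fun j _ => hj j
  have i3 : Integrable (fun x => ∑ j, (2 * a x * fderiv ℝ a x (e j) * f x + a x ^ 2 * g j x)
      * g j x) volume := ccI _ (by fun_prop) (fun x hx => by simp [hx])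
  have := integral_mono ((i1.const_mul (1 / 2)).sub (hf2.const_mul (6 * κ ^ 2))) i3 hpt
  rw [hsum] at this
  simp only [Pi.sub_apply] at this
  rw [integral_sub (i1.const_mul _) (hf2.const_mul _), integral_const_mul, integral_const_mul]
    at this
  linarith

/-- Liouville's theorem for square integrable harmonic functions on `ℝ³`. -/
lemma harmonic_eq_zero {f : E3 → ℝ} {g h : Fin 3 → E3 → ℝ}
    (hfd : Differentiable ℝ f) (hgd : ∀ j, Differentiable ℝ (g j))
    (hfg : ∀ j x, fderiv ℝ f x (e j) = g j x) (hgh : ∀ j x, fderiv ℝ (g j) x (e j) = h j x)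
    (hhc : ∀ j, Continuous (h j)) (hΔ : ∀ x, ∑ j, h j x = 0)
    (hf2 : Integrable (fun x => f x ^ 2) volume) (x : E3) : f x = 0 := by
  have hgc := fun j => (hgd j).continuous
  let χ : ContDiffBump (0 : E3) := ⟨1, 2, one_pos, one_lt_two⟩
  have hχ : ContDiff ℝ ∞ (χ : E3 → ℝ) := χ.contDiff
  obtain ⟨M, hM⟩ := (hχ.continuous_fderiv (by simp)).bounded_above_of_compact_support
    (χ.hasCompactSupport.fderiv ℝ)
  let a : ℝ → E3 → ℝ := fun R x => χ (R⁻¹ • x)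
  have has : ∀ R, ContDiff ℝ ∞ (a R) := fun R => hχ.comp (contDiff_const_smul _)
  have hac : ∀ R, 0 < R → HasCompactSupport (a R) := fun R hR =>
    χ.hasCompactSupport.comp_smul (inv_ne_zero hR.ne')
  have had : ∀ R, 0 < R → ∀ x, ‖fderiv ℝ (a R) x‖ ≤ R⁻¹ * M := by
    intro R hR x
    have h1 : HasFDerivAt (a R) ((fderiv ℝ χ (R⁻¹ • x)).comp
        (R⁻¹ • ContinuousLinearMap.id ℝ E3)) x :=
      ((hχ.differentiable (by simp)) _).hasFDerivAt.comp x ((hasFDerivAt_id x).const_smul R⁻¹)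
    rw [h1.fderiv, ContinuousLinearMap.comp_smul, norm_smul, ContinuousLinearMap.comp_id,
      Real.norm_of_nonneg (by positivity)]
    exact mul_le_mul_of_nonneg_left (hM _) (by positivity)
  have hgz : ∀ j y, g j y = 0 := by
    intro j y
    set R₀ : ℝ := ‖y‖ + 1
    have hR₀ : 0 < R₀ := by positivity
    have hle : ∫ x, a R₀ x ^ 2 * ∑ j, g j x ^ 2 ≤ 0 := by
      -- The cutoff at `R₀` vanishes beyond `2 R₀`, where the cutoff at `R ≥ 2 R₀` is still `1`. So
      -- the left side may stay fixed while the bound, of order `R⁻²`, tends to zero.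
      have hb : ∀ R, 2 * R₀ ≤ R → ∫ x, a R₀ x ^ 2 * ∑ j, g j x ^ 2
          ≤ 12 * (R⁻¹ * M) ^ 2 * ∫ x, f x ^ 2 := by
        intro R hR
        have hR' : 0 < R := by linarith
        refine le_trans ?_ (integral_cutoff_gradient_le hfd hgd hfg hgh hhc hΔ (has R)
          (hac R hR') (had R hR') hf2)
        have ccI : ∀ R, 0 < R → Integrable (fun x => a R x ^ 2 * ∑ j, g j x ^ 2) volume := by
          intro R hR
          have := (has R).continuous
          refine Continuous.integrable_of_hasCompactSupport (by fun_prop) ((hac R hR).mono' ?_)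
          refine (Function.support_subset_iff'.2 fun x hx => ?_).trans subset_closure
          simp only [Function.mem_support, not_not] at hx
          simp [hx]
        refine integral_mono (ccI _ hR₀) (ccI _ hR') fun x => ?_
        refine mul_le_mul_of_nonneg_right ?_ (Finset.sum_nonneg fun _ _ => sq_nonneg _)
        refine pow_le_pow_left₀ χ.nonneg ?_ 2
        by_cases hx : ‖x‖ ≤ 2 * R₀
        · have : a R x = 1 := χ.one_of_mem_closedBall (by
            rw [mem_closedBall_zero_iff, norm_smul, Real.norm_of_nonneg (by positivity),
              inv_mul_le_iff₀ hR', mul_one]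
            linarith)
          change a R₀ x ≤ a R x
          rw [this]; exact χ.le_one
        · have : a R₀ x = 0 := χ.zero_of_le_dist (by
            rw [dist_zero_right, norm_smul, Real.norm_of_nonneg (by positivity),
              le_inv_mul_iff₀ hR₀, mul_comm]
            exact (not_le.1 hx).le)
          change a R₀ x ≤ a R x
          rw [this]; exact χ.nonneg
      have hlim : Tendsto (fun R : ℝ => 12 * (R⁻¹ * M) ^ 2 * ∫ x, f x ^ 2) atTop (𝓝 0) := by
        have := (((tendsto_inv_atTop_zero (𝕜 := ℝ)).mul_const M).pow 2).const_mul 12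
          |>.mul_const (∫ x, f x ^ 2)
        simpa using this
      exact ge_of_tendsto hlim ((eventually_ge_atTop (2 * R₀)).mono hb)
    by_contra hne
    have hpos : 0 < ∫ x, a R₀ x ^ 2 * ∑ j, g j x ^ 2 := by
      have hc : Continuous (fun x => a R₀ x ^ 2 * ∑ j, g j x ^ 2) := by
        have := (has R₀).continuous
        fun_prop
      refine hc.integral_pos_of_hasCompactSupport_nonneg_nonzero ((hac R₀ hR₀).mono' ?_)
        (fun x => mul_nonneg (sq_nonneg _) (Finset.sum_nonneg fun _ _ => sq_nonneg _)) (x := y) ?_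
      · refine (Function.support_subset_iff'.2 fun x hx => ?_).trans subset_closure
        simp only [Function.mem_support, not_not] at hx
        simp [hx]
      · have h1 : a R₀ y = 1 := χ.one_of_mem_closedBall (by
          rw [mem_closedBall_zero_iff, norm_smul, Real.norm_of_nonneg (by positivity),
            inv_mul_le_iff₀ hR₀, mul_one]
          simp [R₀])
        rw [h1, one_pow, one_mul]
        refine (lt_of_lt_of_le (by positivity : 0 < g j y ^ 2) ?_).ne'
        exact Finset.single_le_sum (f := fun j => g j y ^ 2) (fun _ _ => sq_nonneg _)
          (Finset.mem_univ j)
    linarith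
  have hder : ∀ y, fderiv ℝ f y = 0 := by
    intro y
    ext k
    rw [E3.eq_sum k, map_sum]
    simp [map_smul, hfg, hgz]
  have hconst : ∀ y, f y = f x := fun y => is_const_of_fderiv_eq_zero hfd hder y x
  -- A constant that is square integrable on a space of infinite volume is zero.
  have : (fun y => f y ^ 2) = fun _ => f x ^ 2 := by ext y; rw [hconst]
  rw [this, integrable_const_iff] at hf2
  rcases hf2 with h0 | h0
  · simpa using h0
  · have := h0.measure_univ_lt_top
    simp at this

/-- Divergence free test fields. -/
structure IsSolenoidal (ψ : E3 → E3) : Prop extends IsTestField ψ where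
  divFree : ∀ x, div ψ x = 0

/-- The divergence is `∂ᵢ∂ⱼg - ∂ⱼ∂ᵢg`. Orthogonality to these fields alone already says that the
distributional curl vanishes. -/
lemma isSolenoidal_curl {g : E3 → ℝ} (hg : ContDiff ℝ ∞ g) (hc : HasCompactSupport g)
    (i j : Fin 3) :
    IsSolenoidal (fun x => fderiv ℝ g x (e j) • e i - fderiv ℝ g x (e i) • e j) := by
  have hs : ∀ k, ContDiff ℝ ∞ (fun x => fderiv ℝ g x (e k)) := fun k =>
    (hg.fderiv_right (by simp)).clm_apply contDiff_const
  refine ⟨⟨((hs j).smul contDiff_const).sub ((hs i).smul contDiff_const),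
    ((hc.fderiv_apply ℝ (e j)).smul_right).sub ((hc.fderiv_apply ℝ (e i)).smul_right)⟩,
    fun x => ?_⟩
  have hd : ∀ k, DifferentiableAt ℝ (fun x => fderiv ℝ g x (e k)) x := fun k =>
    (hs k).differentiable (by simp) x
  have h2 : ∀ k l, fderiv ℝ (fun x => fderiv ℝ g x (e k)) x (e l)
      = fderiv ℝ (fderiv ℝ g) x (e l) (e k) := by
    intro k l
    have hd' : DifferentiableAt ℝ (fderiv ℝ g) x :=
      (hg.fderiv_right (m := ∞) (by simp)).differentiable (by simp) x
    rw [fderiv_clm_apply hd' (differentiableAt_const _)]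
    simp
  have hsym : ∀ k l, fderiv ℝ (fderiv ℝ g) x (e l) (e k) = fderiv ℝ (fderiv ℝ g) x (e k) (e l) :=
    fun k l => (hg.contDiffAt.isSymmSndFDerivAt (by
      rw [minSmoothness_of_isRCLikeNormedField]
      exact WithTop.coe_le_coe.2 (le_top : (2 : ℕ∞) ≤ ⊤))) _ _
  unfold div
  rw [fderiv_fun_sub ((hd j).smul_const _) ((hd i).smul_const _), fderiv_smul_const (hd j),
    fderiv_smul_const (hd i)]
  simp only [sub_apply, ContinuousLinearMap.smulRight_apply, PiLp.sub_apply,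
    PiLp.smul_apply, smul_eq_mul, h2, Finset.sum_sub_distrib]
  simp [e]
  exact sub_eq_zero.2 (hsym _ _)

/-- Solenoidal test fields are dense in the divergence free fields of `L²`. -/
lemma eq_zero_of_orthogonal_solenoidal {w : L2} (hw : WeakDivFree w)
    (H : ∀ ψ (h : IsSolenoidal ψ), inner ℝ w h.toIsTestField.toL2 = 0) : w = 0 := by
  have hT : ∀ {a : E3 → ℝ}, ContDiff ℝ ∞ a → HasCompactSupport a → ∀ k c,
      IsTestField (fun x => fderiv ℝ a x k • c) := fun ha hc k c =>
    isTestField_smul_const ((ha.fderiv_right (by simp)).clm_apply contDiff_const)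
      (hc.fderiv_apply ℝ k) c
  have hI : ∀ (a : E3 → ℝ), Continuous a → HasCompactSupport a → ∀ c : E3,
      Integrable (fun x => a x * inner ℝ (w x) c) volume := by
    intro a ha hc c
    have := (integrable_smul ha hc w).inner_const c (𝕜 := ℝ)
    simpa only [inner_smul_left, RCLike.conj_to_real] using this
  have hDc : ∀ {a : E3 → ℝ}, ContDiff ℝ ∞ a → ∀ k, ContDiff ℝ ∞ (fun x => fderiv ℝ a x k) :=
    fun ha k => (ha.fderiv_right (by simp)).clm_apply contDiff_const
  -- `w` is weakly curl free
  have hcurl : ∀ {a : E3 → ℝ}, ContDiff ℝ ∞ a → HasCompactSupport a → ∀ i j,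
      ∫ x, fderiv ℝ a x (e j) * inner ℝ (w x) (e i)
        = ∫ x, fderiv ℝ a x (e i) * inner ℝ (w x) (e j) := by
    intro a ha hc i j
    have h1 := H _ (isSolenoidal_curl ha hc i j)
    rw [IsTestField.inner_toL2] at h1
    simp only [inner_sub_right, inner_smul_right] at h1
    rw [integral_sub (hI _ (hDc ha _).continuous (hc.fderiv_apply ℝ _) _)
      (hI _ (hDc ha _).continuous (hc.fderiv_apply ℝ _) _)] at h1
    linarith
  -- A curl free and divergence free field is harmonic: exchanging indices by `hcurl` turns `∑ⱼ ∫
  -- ∂ⱼ∂ⱼa wᵢ` into `∫ ∇(∂ᵢa) · w`, which vanishes.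
  have hlap : ∀ {a : E3 → ℝ}, ContDiff ℝ ∞ a → HasCompactSupport a → ∀ i,
      ∑ j, ∫ x, fderiv ℝ (fun x => fderiv ℝ a x (e j)) x (e j) * inner ℝ (w x) (e i) = 0 := by
    intro a ha hc i
    have h1 := hw _ (hDc ha (e i)) (hc.fderiv_apply ℝ (e i))
    have h2 : ∀ j, ∫ x, fderiv ℝ (fun x => fderiv ℝ a x (e j)) x (e j) * inner ℝ (w x) (e i)
        = ∫ x, fderiv ℝ (fun x => fderiv ℝ a x (e i)) x (e j) * inner ℝ (w x) (e j) := by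
      intro j
      rw [hcurl (hDc ha (e j)) (hc.fderiv_apply ℝ (e j))]
      refine integral_congr_ae (Eventually.of_forall fun x => ?_)
      have hd' : DifferentiableAt ℝ (fderiv ℝ a) x :=
        (ha.fderiv_right (m := ∞) (by simp)).differentiable (by simp) x
      simp only []
      congr 1
      rw [fderiv_clm_apply hd' (differentiableAt_const _),
        fderiv_clm_apply hd' (differentiableAt_const _)]
      simpa using (ha.contDiffAt.isSymmSndFDerivAt (by
      rw [minSmoothness_of_isRCLikeNormedField]
      exact WithTop.coe_le_coe.2 (le_top : (2 : ℕ∞) ≤ ⊤))) (e i) (e j)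
    simp only [h2]
    rw [← integral_finsetSum _ fun j _ => hI _ (hDc (hDc ha _) _).continuous
      ((hc.fderiv_apply ℝ _).fderiv_apply ℝ _) _, ← h1]
    refine integral_congr_ae (Eventually.of_forall fun x => ?_)
    simp only []
    conv_rhs => rw [E3.eq_sum (w x), map_sum]
    refine Finset.sum_congr rfl fun j _ => ?_
    rw [map_smul, smul_eq_mul, mul_comm]
    simp [e, EuclideanSpace.inner_single_right]
  refine eq_zero_of_mollify_eq_zero fun φ => ?_
  ext1 x
  refine PiLp.ext fun i => ?_
  have hcomp : ∀ y, mollify φ w y i = inner ℝ w (translate y (isTestField_normed φ (e i)).toL2) :=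
    fun y => by
      rw [← inner_mollify]
      simp [e, EuclideanSpace.inner_single_right]
  have hD : ∀ {ψ} (h : IsTestField ψ) (k : E3),
      Differentiable ℝ (fun y => inner ℝ w (translate y h.toL2)) ∧
      ∀ y, fderiv ℝ (fun y => inner ℝ w (translate y h.toL2)) y k
        = - inner ℝ w (translate y (h.partial' k).toL2) := by
    intro ψ h k
    refine ⟨fun y => ?_, fun y => ?_⟩
    · obtain ⟨A, hA, -⟩ := h.hasFDerivAt_inner_translate w y
      exact hA.differentiableAt
    · obtain ⟨A, hA, hk⟩ := h.hasFDerivAt_inner_translate w y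
      rw [hA.fderiv, hk]
  set T := isTestField_normed φ (e i)
  -- Each component of a mollification is a classical harmonic function in `L²`; its derivatives are
  -- pairings of `w` with derivatives of the kernel.
  have hz := harmonic_eq_zero (f := fun y => mollify φ w y i)
    (g := fun j y => - inner ℝ w (translate y (T.partial' (e j)).toL2))
    (h := fun j y => inner ℝ w (translate y ((T.partial' (e j)).partial' (e j)).toL2))
    ?_ ?_ ?_ ?_ ?_ ?_ ?_ x
  · simpa using hz
  · simp only [hcomp]; exact (hD T 0).1
  · exact fun j => (hD (T.partial' (e j)) 0).1.neg
  · intro j y; simp only [hcomp]; exact (hD T (e j)).2 y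
  · intro j y
    rw [fderiv_fun_neg, neg_apply, (hD (T.partial' (e j)) (e j)).2 y, neg_neg]
  · exact fun j => continuous_const.inner (continuous_translate _)
  · intro y
    have ha : ContDiff ℝ ∞ (fun x => φ.normed volume (x - y)) :=
      (contDiff_normed φ).comp (contDiff_id.sub contDiff_const)
    have hc : HasCompactSupport (fun x => φ.normed volume (x - y)) :=
      φ.hasCompactSupport_normed.comp_homeomorph (Homeomorph.subRight y)
    rw [← hlap ha hc i]
    refine Finset.sum_congr rfl fun j _ => ?_
    rw [IsTestField.inner_translate_toL2]
    refine integral_congr_ae (Eventually.of_forall fun x => ?_)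
    simp only []
    have e1 : ∀ z, fderiv ℝ (fun x => φ.normed volume x • e i) z (e j)
        = fderiv ℝ (φ.normed volume) z (e j) • e i := fun z => by
      rw [fderiv_smul_const ((contDiff_normed φ).differentiable (by simp) z)]; rfl
    simp only [e1]
    rw [fderiv_smul_const ((hDc (contDiff_normed φ) (e j)).differentiable (by simp) _),
      ContinuousLinearMap.smulRight_apply, inner_smul_right]
    congr 1
    simp only [fderiv_comp_sub]
    rw [fderiv_comp_sub (f := fun z => fderiv ℝ (φ.normed volume) z (e j))]
  · have h1 : ∫⁻ x, ‖mollify φ w x‖ₑ ^ 2 < ⊤ :=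
      (lintegral_mollify_sq_le φ w).trans_lt ENNReal.ofReal_lt_top
    refine ⟨?_, ?_⟩
    · exact (((coordL i).continuous.comp (continuous_mollify φ w)).pow 2).aestronglyMeasurable
    · refine lt_of_le_of_lt (lintegral_mono fun x => ?_) h1
      rw [enorm_pow]
      refine pow_le_pow_left' ?_ 2
      rw [← ofReal_norm, ← ofReal_norm]
      exact ENNReal.ofReal_le_ofReal (E3.abs_apply_le _ _)

/-! ### Smooth dependence on parameters; truncation by a radial potential. -/

lemma hasFDerivAt_integral_param {P F : Type} [NormedAddCommGroup P] [NormedSpace ℝ P]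
    [ProperSpace P] [NormedAddCommGroup F] [NormedSpace ℝ F] [CompleteSpace F]
    {f : ℝ → P → F} (hf : ContDiff ℝ ∞ (Function.uncurry f)) (p : P) :
    HasFDerivAt (fun p => ∫ s in (0 : ℝ)..1, f s p) (∫ s in (0 : ℝ)..1, fderiv ℝ (f s) p) p := by
  have hc := hf.continuous
  have hD : ContDiff ℝ ∞ (fun q : ℝ × P => fderiv ℝ (f q.1) q.2) := by
    refine ContDiff.fderiv (m := ∞) (n := ∞) (f := fun q : ℝ × P => f q.1) (g := fun q => q.2) ?_ contDiff_snd (by simp)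
    exact hf.comp ((contDiff_fst.comp contDiff_fst).prodMk contDiff_snd)
  have hDc := hD.continuous
  obtain ⟨C, hC⟩ := ((isCompact_Icc (a := (0 : ℝ)) (b := 1)).prod
    (isCompact_closedBall p 1)).exists_bound_of_continuousOn hDc.continuousOn
  refine intervalIntegral.hasFDerivAt_integral_of_dominated_of_fderiv_le
    (F := fun p s => f s p) (F' := fun p s => fderiv ℝ (f s) p) (bound := fun _ => C)
    (Metric.ball_mem_nhds p one_pos) ?_ ?_ ?_ ?_ ?_ ?_
  · exact Eventually.of_forall fun q => (hc.comp (by fun_prop : Continuous fun s : ℝ => (s, q))).aestronglyMeasurable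
  · exact (hc.comp (by fun_prop : Continuous fun s : ℝ => (s, p))).intervalIntegrable _ _
  · exact (hDc.comp (by fun_prop : Continuous fun s : ℝ => (s, p))).aestronglyMeasurable
  · refine Eventually.of_forall fun s hs q hq => hC (s, q) ⟨?_, Metric.ball_subset_closedBall hq⟩
    rw [uIoc_of_le zero_le_one] at hs
    exact Ioc_subset_Icc_self hs
  · exact intervalIntegrable_const
  · refine Eventually.of_forall fun s _ q _ => ?_
    have : ContDiff ℝ ∞ (f s) := hf.comp (contDiff_const.prodMk contDiff_id)
    exact (this.differentiable (by simp) q).hasFDerivAt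

/-- Induction on the order of differentiation: the derivative is again an integral of the same kind,
with values in `P →L[ℝ] F`. Hence the target is generalized and `P`, `F` live in the same universe.
-/
lemma contDiff_integral_param {P F : Type} [NormedAddCommGroup P] [NormedSpace ℝ P]
    [ProperSpace P] [NormedAddCommGroup F] [NormedSpace ℝ F] [CompleteSpace F]
    {f : ℝ → P → F} (hf : ContDiff ℝ ∞ (Function.uncurry f)) :
    ContDiff ℝ ∞ (fun p => ∫ s in (0 : ℝ)..1, f s p) := by
  rw [contDiff_infty]
  intro n
  induction n generalizing F with
  | zero =>
    rw [Nat.cast_zero, contDiff_zero, continuous_iff_continuousAt]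
    exact fun p => (hasFDerivAt_integral_param hf p).continuousAt
  | succ n ih =>
    have hD : ContDiff ℝ ∞ (fun q : ℝ × P => fderiv ℝ (f q.1) q.2) := by
      refine ContDiff.fderiv (m := ∞) (n := ∞) (f := fun q : ℝ × P => f q.1) (g := fun q => q.2) ?_ contDiff_snd (by simp)
      exact hf.comp ((contDiff_fst.comp contDiff_fst).prodMk contDiff_snd)
    have h1 := ih (f := fun s p => fderiv ℝ (f s) p) hD
    rw [Nat.cast_add, Nat.cast_one, contDiff_succ_iff_fderiv]
    refine ⟨fun p => (hasFDerivAt_integral_param hf p).differentiableAt, by simp, ?_⟩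
    have : fderiv ℝ (fun p => ∫ s in (0 : ℝ)..1, f s p)
        = fun p => ∫ s in (0 : ℝ)..1, fderiv ℝ (f s) p := by
      ext1 p; exact (hasFDerivAt_integral_param hf p).fderiv
    rw [this]; exact h1

lemma div_smul {a : E3 → ℝ} {F : E3 → E3} {x : E3} (ha : DifferentiableAt ℝ a x)
    (hF : DifferentiableAt ℝ F x) :
    div (fun x => a x • F x) x = fderiv ℝ a x (F x) + a x * div F x := by
  unfold div
  rw [fderiv_fun_smul ha hF]
  conv_rhs => rw [E3.eq_sum (F x), map_sum]
  rw [Finset.mul_sum, ← Finset.sum_add_distrib]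
  refine Finset.sum_congr rfl fun i _ => ?_
  simp
  ring

lemma div_add {F G : E3 → E3} {x : E3} (hF : DifferentiableAt ℝ F x)
    (hG : DifferentiableAt ℝ G x) : div (fun x => F x + G x) x = div F x + div G x := by
  unfold div
  rw [fderiv_fun_add hF hG]
  simp [Finset.sum_add_distrib]

lemma div_sub {F G : E3 → E3} {x : E3} (hF : DifferentiableAt ℝ F x)
    (hG : DifferentiableAt ℝ G x) : div (fun x => F x - G x) x = div F x - div G x := by
  unfold div
  rw [fderiv_fun_sub hF hG]
  simp [Finset.sum_sub_distrib]

lemma div_id (x : E3) : div (fun x => x) x = 3 := by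
  unfold div
  simp [e]

/-- The truncation of a divergence free field `f` by means of a radial potential `Φ` is divergence
free. -/
lemma div_truncation {b : E3 → ℝ} (hb : ContDiff ℝ ∞ b) {f Φ : E3 → E3} (hf : ContDiff ℝ ∞ f)
    (hΦ : ContDiff ℝ ∞ Φ) {y : E3} (hfdiv : div f y = 0) (hΦdiv : div Φ y = 0)
    (hrad : (2 : ℝ) • Φ y + fderiv ℝ Φ y y = f y) :
    div (fun y => f y - b y • f y - fderiv ℝ b y y • Φ y + fderiv ℝ b y (Φ y) • y) y = 0 := by
  have hdb : ContDiff ℝ ∞ (fderiv ℝ b) := hb.fderiv_right (by simp)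
  have hα : ContDiff ℝ ∞ (fun y => fderiv ℝ b y y) := hdb.clm_apply contDiff_id
  have hβ : ContDiff ℝ ∞ (fun y => fderiv ℝ b y (Φ y)) := hdb.clm_apply hΦ
  have d : ∀ {F : Type} [NormedAddCommGroup F] [NormedSpace ℝ F] {g : E3 → F},
      ContDiff ℝ ∞ g → DifferentiableAt ℝ g y := fun hg => hg.differentiable (by simp) y
  have hid : ContDiff ℝ ∞ (fun y : E3 => y) := contDiff_id
  have h1 : ContDiff ℝ ∞ (fun y => b y • f y) := hb.smul hf
  have h2 : ContDiff ℝ ∞ (fun y => fderiv ℝ b y y • Φ y) := hα.smul hΦ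
  have h3 : ContDiff ℝ ∞ (fun y => fderiv ℝ b y (Φ y) • y) := hβ.smul contDiff_id
  have h4 : ContDiff ℝ ∞ (fun y => f y - b y • f y) := hf.sub h1
  have h5 : ContDiff ℝ ∞ (fun y => f y - b y • f y - fderiv ℝ b y y • Φ y) := h4.sub h2
  -- The field is `curl((1 - b) Φ × y)` written without cross products. In its divergence the second
  -- derivatives of `b` cancel by symmetry, and what remains is `∇b · (2Φ + (y · ∇)Φ - f)`.
  rw [div_add (d h5) (d h3), div_sub (d h4) (d h2), div_sub (d hf) (d h1),
    div_smul (d hb) (d hf), div_smul (d hα) (d hΦ), div_smul (d hβ) (d hid), div_id,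
    hfdiv, hΦdiv, fderiv_clm_apply (d hdb) (d hid), fderiv_clm_apply (d hdb) (d hΦ)]
  have hsym : fderiv ℝ (fderiv ℝ b) y (Φ y) y = fderiv ℝ (fderiv ℝ b) y y (Φ y) :=
    (hb.contDiffAt.isSymmSndFDerivAt (by
      rw [minSmoothness_of_isRCLikeNormedField]
      exact WithTop.coe_le_coe.2 (le_top : (2 : ℕ∞) ≤ ⊤))) _ _
  simp only [fderiv_fun_id, add_apply, ContinuousLinearMap.comp_apply,
    ContinuousLinearMap.flip_apply, ContinuousLinearMap.id_apply]
  rw [hsym, ← hrad, map_add, map_smul, smul_eq_mul]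
  ring

/-- The radial potential `Φ(y) = ∫₀¹ s f(c + s y) ds`. -/
def radialPotential (f : E3 → E3) (c y : E3) : E3 := ∫ s in (0 : ℝ)..1, s • f (c + s • y)

section radialPotential
variable {f : E3 → E3}

lemma contDiff_radial_integrand (hf : ContDiff ℝ ∞ f) (c : E3) :
    ContDiff ℝ ∞ (Function.uncurry fun (s : ℝ) (y : E3) => s • f (c + s • y)) := by
  have : ContDiff ℝ ∞ (fun q : ℝ × E3 => q.1 • f (c + q.1 • q.2)) :=
    contDiff_fst.smul (hf.comp (contDiff_const.add (contDiff_fst.smul contDiff_snd)))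
  exact this

lemma contDiff_radialPotential (hf : ContDiff ℝ ∞ f) (c : E3) :
    ContDiff ℝ ∞ (radialPotential f c) :=
  contDiff_integral_param (contDiff_radial_integrand hf c)

lemma fderiv_radial_integrand (hf : ContDiff ℝ ∞ f) (c : E3) (s : ℝ) (y k : E3) :
    fderiv ℝ (fun y : E3 => s • f (c + s • y)) y k = s ^ 2 • fderiv ℝ f (c + s • y) k := by
  have h1 : HasFDerivAt (fun y : E3 => c + s • y) (s • ContinuousLinearMap.id ℝ E3) y :=
    ((hasFDerivAt_id y).const_smul s).const_add c
  have h2 := (((hf.differentiable (by simp) (c + s • y)).hasFDerivAt.comp y h1).const_smul s)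
  have h3 : (s • (f ∘ fun y : E3 => c + s • y)) = fun y : E3 => s • f (c + s • y) := rfl
  rw [h3] at h2
  rw [h2.fderiv]
  simp [smul_smul, sq]

lemma fderiv_radialPotential (hf : ContDiff ℝ ∞ f) (c y k : E3) :
    fderiv ℝ (radialPotential f c) y k = ∫ s in (0 : ℝ)..1, s ^ 2 • fderiv ℝ f (c + s • y) k := by
  have hs := contDiff_radial_integrand hf c
  have h1 := (hasFDerivAt_integral_param hs y).fderiv
  have h2 : radialPotential f c = fun y => ∫ s in (0 : ℝ)..1, s • f (c + s • y) := rfl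
  rw [h2, h1, ContinuousLinearMap.intervalIntegral_apply]
  · simp only [fderiv_radial_integrand hf]
  · refine Continuous.intervalIntegrable ?_ _ _
    have hD : ContDiff ℝ ∞ (fun s : ℝ => fderiv ℝ (fun y : E3 => s • f (c + s • y)) y) := by
      refine ContDiff.fderiv (m := ∞) (n := ∞) (f := fun (s : ℝ) (y : E3) => s • f (c + s • y))
        (g := fun _ => y) hs contDiff_const (by simp)
    exact hD.continuous

lemma continuous_fderiv_segment (hf : ContDiff ℝ ∞ f) (c y k : E3) :
    Continuous (fun s : ℝ => s ^ 2 • fderiv ℝ f (c + s • y) k) := by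
  have h1 : Continuous (fun s : ℝ => fderiv ℝ f (c + s • y)) :=
    (hf.continuous_fderiv (by simp)).comp (by fun_prop)
  fun_prop

/-- The left side is the integral over `[0, 1]` of the derivative of `s² f(c + s y)`. As `Φ` is
divergence free when `f` is, this says `f(c + ·) = curl(Φ × y)`. -/
lemma radialPotential_euler (hf : ContDiff ℝ ∞ f) (c y : E3) :
    (2 : ℝ) • radialPotential f c y + fderiv ℝ (radialPotential f c) y y = f (c + y) := by
  have hd : ∀ s ∈ uIcc (0 : ℝ) 1, HasDerivAt (fun s : ℝ => s ^ 2 • f (c + s • y))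
      ((2 : ℝ) • (s • f (c + s • y)) + s ^ 2 • fderiv ℝ f (c + s • y) y) s := by
    intro s _
    have h1 : HasDerivAt (fun s : ℝ => c + s • y) y s := by
      simpa using ((hasDerivAt_id s).smul_const y).const_add c
    have h2 := (hf.differentiable (by simp) (c + s • y)).hasFDerivAt.comp_hasDerivAt s h1
    have h3 := (hasDerivAt_pow 2 s).smul h2
    convert! h3 using 1
    simp [smul_smul, add_comm]
  have hc1 : Continuous (fun s : ℝ => s • f (c + s • y)) := by
    have := hf.continuous
    fun_prop
  have hc3 : Continuous (fun s : ℝ => (2 : ℝ) • s • f (c + s • y)) := by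
    have := hf.continuous
    fun_prop
  have hc2 := continuous_fderiv_segment hf c y y
  have := intervalIntegral.integral_eq_sub_of_hasDerivAt hd
    ((hc3.add hc2).intervalIntegrable _ _)
  rw [intervalIntegral.integral_add (hc3.intervalIntegrable _ _)
    (hc2.intervalIntegrable _ _), intervalIntegral.integral_smul] at this
  rw [fderiv_radialPotential hf]
  simpa [radialPotential] using this

lemma div_radialPotential (hf : ContDiff ℝ ∞ f) (hdiv : ∀ x, div f x = 0) (c y : E3) :
    div (radialPotential f c) y = 0 := by
  unfold div
  simp only [fderiv_radialPotential hf]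
  have h1 : ∀ i, (∫ s in (0 : ℝ)..1, s ^ 2 • fderiv ℝ f (c + s • y) (e i)) i
      = ∫ s in (0 : ℝ)..1, s ^ 2 * (fderiv ℝ f (c + s • y) (e i)) i := by
    intro i
    exact ((coordL i).intervalIntegral_comp_comm
      ((continuous_fderiv_segment hf c y (e i)).intervalIntegrable _ _)).symm
  simp only [h1]
  have hI : ∀ i ∈ (Finset.univ : Finset (Fin 3)), IntervalIntegrable
      (fun s : ℝ => s ^ 2 * (fderiv ℝ f (c + s • y) (e i)) i) volume 0 1 := fun i _ =>
    ((coordL i).continuous.comp (continuous_fderiv_segment hf c y (e i))).intervalIntegrable _ _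
  rw [← intervalIntegral.integral_finsetSum hI]
  have h2 : ∀ s : ℝ, ∑ i, s ^ 2 * (fderiv ℝ f (c + s • y) (e i)) i = 0 := fun s => by
    rw [← Finset.mul_sum]
    have := hdiv (c + s • y)
    unfold div at this
    rw [this, mul_zero]
  simp only [h2, intervalIntegral.integral_zero]

end radialPotential

/-! ### Corrected test fields. -/

/-- `G` corrects the test field `φ` near the moving center: `φ + G` is divergence free and vanishes
on the ball of radius `2ε` around the center, and `G` lives in the ball of radius `3ε`. The variable
of `G` is `((t, c), x)`, with `c` the center. -/
structure IsCorrection (φ : ℝ → E3 → E3) (ε M : ℝ) (G : (ℝ × E3) × E3 → E3) : Prop where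
  smooth : ContDiff ℝ ∞ G
  compact : HasCompactSupport G
  bound : ∀ q, ‖G q‖ ≤ M
  bound_space : ∀ q k, ‖fderiv ℝ G q (0, k)‖ ≤ M / ε * ‖k‖
  bound_time : ∀ q k, ‖fderiv ℝ G q ((1, k), 0)‖ ≤ M * (1 + ‖k‖ / ε)
  outside : ∀ t c x, 3 * ε < ‖x - c‖ → G ((t, c), x) = 0
  inside : ∀ t c x, ‖x - c‖ < 2 * ε → φ t x + G ((t, c), x) = 0
  divFree : ∀ t ≥ 0, ∀ c x, div (fun x => φ t x + G ((t, c), x)) x = 0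

lemma div_comp_sub (f : E3 → E3) (c x : E3) : div (fun x => f (x - c)) x = div f (x - c) := by
  unfold div
  simp only [fderiv_comp_sub]

lemma IsTest.contDiff {φ : ℝ → E3 → E3} (hφ : IsTest φ) (t : ℝ) : ContDiff ℝ ∞ (φ t) :=
  hφ.smooth.comp (contDiff_const.prodMk contDiff_id)

/-- The bump function used for truncation. -/
def truncBump : ContDiffBump (0 : E3) := ⟨2, 3, two_pos, by norm_num⟩

lemma contDiff_truncBump : ContDiff ℝ ∞ (truncBump : E3 → ℝ) := truncBump.contDiff

lemma truncBump_fderiv_inside {z : E3} (hz : ‖z‖ < 2) : fderiv ℝ truncBump z = 0 := by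
  have : (truncBump : E3 → ℝ) =ᶠ[𝓝 z] fun _ => 1 := by
    filter_upwards [isOpen_lt continuous_norm continuous_const |>.mem_nhds hz] with y hy
    exact truncBump.one_of_mem_closedBall (by rw [mem_closedBall_zero_iff]; exact le_of_lt hy)
  rw [this.fderiv_eq]; simp

lemma truncBump_outside {z : E3} (hz : 3 < ‖z‖) :
    truncBump z = 0 ∧ fderiv ℝ truncBump z = 0 := by
  have : (truncBump : E3 → ℝ) =ᶠ[𝓝 z] fun _ => 0 := by
    filter_upwards [isOpen_lt continuous_const continuous_norm |>.mem_nhds hz] with y hy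
    exact truncBump.zero_of_le_dist (by rw [dist_zero_right]; exact le_of_lt hy)
  refine ⟨this.eq_of_nhds, ?_⟩
  rw [this.fderiv_eq]; simp

/-- The correction in the rescaled variable `z = (x - c) / ε`. -/
def rescaledCorrection (φ : ℝ → E3 → E3) (q : ℝ × (ℝ × E3) × E3) : E3 :=
  - truncBump q.2.2 • φ q.2.1.1 (q.2.1.2 + q.1 • q.2.2)
    - fderiv ℝ truncBump q.2.2 q.2.2 • radialPotential (φ q.2.1.1) q.2.1.2 (q.1 • q.2.2)
    + fderiv ℝ truncBump q.2.2 (radialPotential (φ q.2.1.1) q.2.1.2 (q.1 • q.2.2)) • q.2.2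

lemma contDiff_rescaledCorrection {φ : ℝ → E3 → E3} (hφ : IsTest φ) :
    ContDiff ℝ ∞ (rescaledCorrection φ) := by
  have hΦ : ContDiff ℝ ∞ (fun q : (ℝ × E3) × E3 => radialPotential (φ q.1.1) q.1.2 q.2) := by
    refine contDiff_integral_param (f := fun (s : ℝ) (q : (ℝ × E3) × E3) =>
      s • φ q.1.1 (q.1.2 + s • q.2)) ?_
    have h1 : ContDiff ℝ ∞ (fun p : ℝ × (ℝ × E3) × E3 => (p.2.1.1, p.2.1.2 + p.1 • p.2.2)) := by
      fun_prop
    exact contDiff_fst.smul (hφ.smooth.comp h1)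
  have hz : ContDiff ℝ ∞ (fun q : ℝ × (ℝ × E3) × E3 => q.2.2) := by fun_prop
  have h1 : ContDiff ℝ ∞ (fun q : ℝ × (ℝ × E3) × E3 =>
      radialPotential (φ q.2.1.1) q.2.1.2 (q.1 • q.2.2)) := by
    have h2 : ContDiff ℝ ∞ (fun q : ℝ × (ℝ × E3) × E3 =>
      ((q.2.1, q.1 • q.2.2) : (ℝ × E3) × E3)) := by fun_prop
    exact hΦ.comp h2
  have h3 : ContDiff ℝ ∞ (fun q : ℝ × (ℝ × E3) × E3 =>
      φ q.2.1.1 (q.2.1.2 + q.1 • q.2.2)) := by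
    have h2 : ContDiff ℝ ∞ (fun q : ℝ × (ℝ × E3) × E3 =>
      (q.2.1.1, q.2.1.2 + q.1 • q.2.2)) := by fun_prop
    exact hφ.smooth.comp h2
  have hD : ContDiff ℝ ∞ (fun q : ℝ × (ℝ × E3) × E3 => fderiv ℝ truncBump q.2.2) :=
    (contDiff_truncBump.fderiv_right (m := ∞) (by simp)).comp hz
  exact ((((contDiff_truncBump.comp hz).neg.smul h3).sub ((hD.clm_apply hz).smul h1))).add
    ((hD.clm_apply h1).smul hz)

lemma rescaledCorrection_outside (φ : ℝ → E3 → E3) {r : ℝ} {p : ℝ × E3} {z : E3} (hz : 3 < ‖z‖) :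
    rescaledCorrection φ (r, p, z) = 0 := by
  simp [rescaledCorrection, truncBump_outside hz]

/-- The scale `r` is bounded by the cutoff `κ`, the variable `z` by the bump. If the centre or the
time is too large, the whole segment from `c` to `c + r z` avoids the support of `φ t`, so that both
`φ` and its potential vanish there. -/
lemma hasCompactSupport_cutoff_rescaledCorrection {φ : ℝ → E3 → E3} (hφ : IsTest φ)
    (κ : ContDiffBump (0 : ℝ)) :
    HasCompactSupport (fun q => κ q.1 • rescaledCorrection φ q) := by
  obtain ⟨R, hR0, hR⟩ := hφ.hasCompactSupport.isCompact.isBounded.subset_closedBall_lt 0 0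
  have hz : ∀ t x, R < |t| ∨ R < ‖x‖ → φ t x = 0 := by
    intro t x h
    by_contra hne
    have := hR (subset_tsupport _ (show (t, x) ∈ Function.support _ from hne))
    rw [mem_closedBall_zero_iff, Prod.norm_def, max_le_iff] at this
    rcases h with h | h
    · exact absurd this.1 (not_le.2 h)
    · exact absurd this.2 (not_le.2 h)
  refine HasCompactSupport.intro (((isCompact_closedBall (0 : ℝ) κ.rOut).prod
    (((isCompact_closedBall (0 : ℝ) R).prod (isCompact_closedBall (0 : E3) (R + 3 * κ.rOut))).prod
      (isCompact_closedBall (0 : E3) 3)))) ?_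
  rintro ⟨r, ⟨t, c⟩, z⟩ hq
  simp only []
  by_cases h1 : r ∈ Metric.closedBall (0 : ℝ) κ.rOut
  swap
  · rw [κ.zero_of_le_dist (not_le.1 h1).le, zero_smul]
  by_cases h2 : z ∈ Metric.closedBall (0 : E3) 3
  swap
  · rw [rescaledCorrection_outside φ, smul_zero]
    simpa using h2
  have h3 : ∀ s ∈ Icc (0 : ℝ) 1, φ t (c + s • (r • z)) = 0 := by
    intro s hs
    apply hz
    by_contra! hcon
    apply hq
    refine ⟨h1, ⟨?_, ?_⟩, h2⟩
    · simpa using hcon.1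
    · rw [mem_closedBall_zero_iff] at h1 h2 ⊢
      have e1 : c = (c + s • (r • z)) - s • (r • z) := by abel
      rw [e1]
      refine (norm_sub_le _ _).trans (add_le_add hcon.2 ?_)
      rw [norm_smul, norm_smul, Real.norm_of_nonneg hs.1]
      have : ‖r‖ * ‖z‖ ≤ κ.rOut * 3 := mul_le_mul h1 h2 (norm_nonneg _) κ.rOut_pos.le
      calc s * (‖r‖ * ‖z‖) ≤ 1 * (‖r‖ * ‖z‖) :=
            mul_le_mul_of_nonneg_right hs.2 (by positivity)
        _ ≤ _ := by linarith
  have h4 : radialPotential (φ t) c (r • z) = 0 := by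
    unfold radialPotential
    rw [intervalIntegral.integral_congr (g := fun _ => (0 : E3)), intervalIntegral.integral_zero]
    intro s hs
    rw [uIcc_of_le zero_le_one] at hs
    simp only [h3 s hs, smul_zero]
  have h5 := h3 1 (by simp)
  rw [one_smul] at h5
  simp [rescaledCorrection, h4, h5]

/-- In the variable `z = (x - c) / ε` the correction contains no negative power of `ε`: the factor
`1 / ε` from the derivative of the cutoff is compensated by `y = ε z`. It is thus the restriction to
fixed `ε` of one smooth compactly supported function of `(ε, t, c, z)`, whose bounds provide `M`
independent of `ε`; powers of `1 / ε` come only from the change of variable. -/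
lemma IsTest.exists_correction {φ : ℝ → E3 → E3} (hφ : IsTest φ) :
    ∃ M, 0 ≤ M ∧ ∀ ε ∈ Ioc (0 : ℝ) 1, ∃ G, IsCorrection φ ε M G := by
  -- Equal to `1` on `[-1, 1]`, so invisible for `ε ≤ 1`, while making the scale a compactly
  -- supported variable.
  let κ : ContDiffBump (0 : ℝ) := ⟨1, 2, one_pos, one_lt_two⟩
  have hκs : ContDiff ℝ ∞ (κ : ℝ → ℝ) := κ.contDiff
  set H : ℝ × (ℝ × E3) × E3 → E3 := fun q => κ q.1 • rescaledCorrection φ q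
  have hHs : ContDiff ℝ ∞ H :=
    (hκs.comp contDiff_fst).smul (contDiff_rescaledCorrection hφ)
  have hHc : HasCompactSupport H := hasCompactSupport_cutoff_rescaledCorrection hφ κ
  obtain ⟨M₀, hM₀⟩ := hHs.continuous.bounded_above_of_compact_support hHc
  obtain ⟨M₁, hM₁⟩ := (hHs.continuous_fderiv (by simp)).bounded_above_of_compact_support
    (hHc.fderiv ℝ)
  have hM : 0 ≤ max M₀ M₁ := ((norm_nonneg _).trans (hM₀ 0)).trans (le_max_left _ _)
  refine ⟨max M₀ M₁, hM, fun ε hε => ?_⟩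
  have hε0 := hε.1
  let A : (ℝ × E3) × E3 → ℝ × (ℝ × E3) × E3 := fun q => (ε, q.1, ε⁻¹ • (q.2 - q.1.2))
  have hA : ContDiff ℝ ∞ A := by fun_prop
  have hAd : ∀ q k, fderiv ℝ A q k = (0, k.1, ε⁻¹ • (k.2 - k.1.2)) := by
    intro q k
    let A' : (ℝ × E3) × E3 →L[ℝ] ℝ × (ℝ × E3) × E3 :=
      (0 : (ℝ × E3) × E3 →L[ℝ] ℝ).prod ((ContinuousLinearMap.fst ℝ (ℝ × E3) E3).prod
        (ε⁻¹ • (ContinuousLinearMap.snd ℝ (ℝ × E3) E3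
          - (ContinuousLinearMap.snd ℝ ℝ E3).comp (ContinuousLinearMap.fst ℝ (ℝ × E3) E3))))
    have h1 : HasFDerivAt A A' q := by
      have : A = fun q => ((ε, 0) : ℝ × (ℝ × E3) × E3) + A' q := by
        ext1 q; simp [A, A']
      rw [this]
      exact A'.hasFDerivAt.const_add _
    rw [h1.fderiv]; rfl
  have hGd : ∀ q k, fderiv ℝ (H ∘ A) q k = fderiv ℝ H (A q) (0, k.1, ε⁻¹ • (k.2 - k.1.2)) := by
    intro q k
    rw [fderiv_comp q (hHs.differentiable (by simp) _) (hA.differentiable (by simp) _),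
      ContinuousLinearMap.comp_apply, hAd]
  have hGb : ∀ q k, ‖fderiv ℝ (H ∘ A) q k‖ ≤ max M₀ M₁ * ‖((0, k.1, ε⁻¹ • (k.2 - k.1.2)) : ℝ × (ℝ × E3) × E3)‖ := by
    intro q k
    rw [hGd]
    exact (fderiv ℝ H (A q)).le_of_opNorm_le ((hM₁ _).trans (le_max_right _ _)) _
  have hκ : κ ε = 1 := κ.one_of_mem_closedBall (by
    rw [mem_closedBall_zero_iff, Real.norm_of_nonneg hε0.le]; exact hε.2)
  have hG : ∀ t c x, (H ∘ A) ((t, c), x)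
      = rescaledCorrection φ (ε, (t, c), ε⁻¹ • (x - c)) := fun t c x => by
    simp [H, A, hκ]
  refine ⟨H ∘ A, hHs.comp hA, ?_, fun q => (hM₀ _).trans (le_max_left _ _), fun q k => ?_,
    fun q k => ?_, fun t c x hx => ?_, fun t c x hx => ?_, fun t ht c x => ?_⟩
  · obtain ⟨S, hS⟩ := hHc.isCompact.isBounded.subset_closedBall 0
    refine HasCompactSupport.intro ((isCompact_closedBall (0 : ℝ × E3) S).prod
      (isCompact_closedBall (0 : E3) (S + ε * S))) ?_
    rintro ⟨p, x⟩ hq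
    by_contra hne
    have h1 := hS (subset_tsupport _ (show A (p, x) ∈ Function.support H from hne))
    simp only [A, mem_closedBall_zero_iff, Prod.norm_def, max_le_iff] at h1
    apply hq
    refine ⟨?_, ?_⟩
    · simp only [mem_closedBall_zero_iff, Prod.norm_def, max_le_iff]
      exact h1.2.1
    · rw [mem_closedBall_zero_iff]
      have h2 := h1.2.2
      rw [norm_smul, norm_inv, Real.norm_of_nonneg hε0.le, inv_mul_le_iff₀ hε0] at h2
      calc ‖x‖ = ‖p.2 + (x - p.2)‖ := by congr 1; abel
        _ ≤ ‖p.2‖ + ‖x - p.2‖ := norm_add_le _ _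
        _ ≤ S + ε * S := add_le_add h1.2.1.2 h2
  · refine (hGb q _).trans_eq ?_
    rw [div_mul_eq_mul_div, mul_div_assoc]
    congr 1
    have : 0 ≤ ε⁻¹ * ‖k‖ := by positivity
    simp [Prod.norm_def, norm_smul, abs_of_pos hε0, this]
    ring
  · refine (hGb q _).trans (mul_le_mul_of_nonneg_left ?_ hM)
    have h1 : 0 ≤ ‖k‖ / ε := by positivity
    -- The motion of `c` acts both directly, at size `‖k‖`, and through `z`, at size `‖k‖ / ε`; the
    -- latter dominates as `ε ≤ 1`.
    have h2 : ‖k‖ ≤ ‖k‖ / ε := by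
      rw [le_div_iff₀ hε0]; exact mul_le_of_le_one_right (norm_nonneg _) hε.2
    have h3 : ε⁻¹ * ‖k‖ = ‖k‖ / ε := by rw [inv_mul_eq_div]
    simp only [Prod.norm_def, norm_smul, norm_inv, Real.norm_of_nonneg hε0.le, zero_sub, norm_neg,
      h3, norm_zero, norm_one]
    refine max_le (by positivity) (max_le (max_le (by linarith) (by linarith)) (by linarith))
  · rw [hG]
    refine rescaledCorrection_outside φ ?_
    rw [norm_smul, norm_inv, Real.norm_of_nonneg hε0.le, lt_inv_mul_iff₀ hε0, mul_comm]
    exact hx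
  · rw [hG]
    have h1 : ‖ε⁻¹ • (x - c)‖ < 2 := by
      rw [norm_smul, norm_inv, Real.norm_of_nonneg hε0.le, inv_mul_lt_iff₀ hε0, mul_comm]
      exact hx
    have h2 : truncBump (ε⁻¹ • (x - c)) = 1 := truncBump.one_of_mem_closedBall (by
      rw [mem_closedBall_zero_iff]; exact h1.le)
    simp [rescaledCorrection, truncBump_fderiv_inside h1, h2, smul_smul, mul_inv_cancel₀ hε0.ne']
  · have hf := hφ.contDiff t
    set b : E3 → ℝ := fun y => truncBump (ε⁻¹ • y)
    have hb : ContDiff ℝ ∞ b := contDiff_truncBump.comp (contDiff_const_smul _)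
    have hbd : ∀ y k, fderiv ℝ b y k = ε⁻¹ * fderiv ℝ truncBump (ε⁻¹ • y) k := by
      intro y k
      have h1 : HasFDerivAt b ((fderiv ℝ truncBump (ε⁻¹ • y)).comp
          (ε⁻¹ • ContinuousLinearMap.id ℝ E3)) y :=
        ((contDiff_truncBump.differentiable (by simp)) _).hasFDerivAt.comp y
          ((hasFDerivAt_id y).const_smul ε⁻¹)
      rw [h1.fderiv]; simp
    have hft : ContDiff ℝ ∞ (fun y => φ t (c + y)) := hf.comp (contDiff_const.add contDiff_id)
    have hdt : ∀ y, div (fun y => φ t (c + y)) y = div (φ t) (c + y) := by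
      intro y
      unfold div
      simp only [fderiv_comp_add_left]
    have key := div_truncation hb hft (contDiff_radialPotential hf c) (y := x - c)
      (by rw [hdt]; exact hφ.divFree t ht _) (div_radialPotential hf (hφ.divFree t ht) c _)
      (radialPotential_euler hf c _)
    have heq : (fun x => φ t x + (H ∘ A) ((t, c), x)) = fun x =>
        (fun y => φ t (c + y) - b y • φ t (c + y) - fderiv ℝ b y y • radialPotential (φ t) c y
          + fderiv ℝ b y (radialPotential (φ t) c y) • y) (x - c) := by
      ext1 x
      rw [hG]
      simp only [rescaledCorrection, hbd, smul_smul, mul_inv_cancel₀ hε0.ne', one_smul,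
        add_sub_cancel, map_smul, smul_eq_mul, b]
      rw [neg_smul, mul_comm _ ε⁻¹]
      abel
    rw [heq]
    exact (div_comp_sub _ c x).trans key

/-- Only Lipschitz regularity in time is required of exterior test fields, so the centre may follow
the Lipschitz path `h` and a Lipschitz factor `θ` is allowed, later a cutoff in time. Vanishing on
the ball of radius `2ε` leaves a margin that keeps the closed support outside the ball of radius
`ε`. -/
lemma IsCorrection.isExteriorTest {φ : ℝ → E3 → E3} (hφ : IsTest φ) {ε M : ℝ} (hε : 0 < ε)
    {G : (ℝ × E3) × E3 → E3} (hG : IsCorrection φ ε M G) {h : ℝ → E3} (hh : W1InfOn h (Ici 0))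
    {θ : ℝ → ℝ} (hθ : W1InfOn θ (Ici 0)) :
    IsExteriorTest ε h (fun t x => θ t • (φ t x + G ((t, h t), x))) := by
  have hsm : ∀ t, ContDiff ℝ ∞ (fun x => φ t x + G ((t, h t), x)) := fun t =>
    (hφ.contDiff t).add (hG.smooth.comp (contDiff_const.prodMk contDiff_id))
  have hcs : ∀ t, HasCompactSupport (fun x => φ t x + G ((t, h t), x)) := fun t =>
    (HasCompactSupport.slice hφ.hasCompactSupport t).add
      (HasCompactSupport.slice hG.compact (t, h t))
  refine ⟨?_, ?_, fun t ht x => ?_, fun t _ => (hsm t).const_smul (θ t),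
    fun t _ => (hcs t).smul_left (f := fun _ => θ t), fun t _ => ?_⟩
  · obtain ⟨⟨Cθ, hCθ⟩, Kθ, hKθ⟩ := hθ
    obtain ⟨-, Kh, hKh⟩ := hh
    obtain ⟨Cφ, hCφ⟩ := hφ.smooth.continuous.bounded_above_of_compact_support hφ.hasCompactSupport
    obtain ⟨CG, hCG⟩ := hG.smooth.continuous.bounded_above_of_compact_support hG.compact
    obtain ⟨Lφ, hLφ⟩ := hφ.smooth.lipschitzWith_of_hasCompactSupport hφ.hasCompactSupport (by simp)
    obtain ⟨LG, hLG⟩ := hG.smooth.lipschitzWith_of_hasCompactSupport hG.compact (by simp)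
    have hb : ∀ t x, ‖φ t x + G ((t, h t), x)‖ ≤ Cφ + CG := fun t x =>
      (norm_add_le _ _).trans (add_le_add (hCφ (t, x)) (hCG _))
    have hC0 : 0 ≤ Cφ + CG := (norm_nonneg _).trans (hb 0 0)
    have hCθ0 : 0 ≤ Cθ := (norm_nonneg _).trans (hCθ 0 (by simp))
    refine ⟨⟨Cθ * (Cφ + CG), ?_⟩,
      Real.toNNReal (Cθ * (Lφ + LG * max 1 Kh) + Kθ * (Cφ + CG)), ?_⟩
    · rintro ⟨t, x⟩ ⟨ht, -⟩
      rw [norm_smul]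
      exact mul_le_mul (hCθ t ht) (hb t x) (norm_nonneg _) hCθ0
    · refine LipschitzOnWith.of_dist_le_mul ?_
      rintro ⟨t, x⟩ ⟨ht, -⟩ ⟨s, y⟩ ⟨hs, -⟩
      rw [Real.coe_toNNReal _ (by positivity)]
      set d := dist ((t, x) : ℝ × E3) (s, y)
      have hd1 : dist t s ≤ d := le_max_left _ _
      have hd2 : dist x y ≤ d := le_max_right _ _
      have h1 : dist (φ t x) (φ s y) ≤ Lφ * d := hLφ.dist_le_mul (t, x) (s, y)
      have h2 : dist (G ((t, h t), x)) (G ((s, h s), y)) ≤ LG * (max 1 Kh * d) := by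
        refine (hLG.dist_le_mul _ _).trans (mul_le_mul_of_nonneg_left ?_ LG.2)
        have h3 : dist (h t) (h s) ≤ Kh * d :=
          (hKh.dist_le_mul t ht s hs).trans (mul_le_mul_of_nonneg_left hd1 Kh.2)
        have hd0 : 0 ≤ d := dist_nonneg
        have h4 : d ≤ max 1 (Kh : ℝ) * d := le_mul_of_one_le_left hd0 (le_max_left _ _)
        have h5 : (Kh : ℝ) * d ≤ max 1 (Kh : ℝ) * d :=
          mul_le_mul_of_nonneg_right (le_max_right _ _) hd0
        rw [Prod.dist_eq, Prod.dist_eq]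
        exact max_le (max_le (hd1.trans h4) (h3.trans h5)) (hd2.trans h4)
      have h3 : dist (φ t x + G ((t, h t), x)) (φ s y + G ((s, h s), y))
          ≤ (Lφ + LG * max 1 Kh) * d := by
        refine (dist_add_add_le _ _ _ _).trans ?_
        linarith
      have h4 : dist (θ t) (θ s) ≤ Kθ * d :=
        (hKθ.dist_le_mul t ht s hs).trans (mul_le_mul_of_nonneg_left hd1 Kθ.2)
      calc dist (θ t • (φ t x + G ((t, h t), x))) (θ s • (φ s y + G ((s, h s), y)))
          ≤ dist (θ t • (φ t x + G ((t, h t), x))) (θ t • (φ s y + G ((s, h s), y)))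
            + dist (θ t • (φ s y + G ((s, h s), y))) (θ s • (φ s y + G ((s, h s), y))) :=
            dist_triangle _ _ _
        _ ≤ Cθ * ((Lφ + LG * max 1 Kh) * d) + (Kθ * d) * (Cφ + CG) := by
            refine add_le_add ?_ ?_
            · rw [dist_smul₀]
              exact mul_le_mul (hCθ t ht) h3 dist_nonneg hCθ0
            · rw [dist_eq_norm, ← sub_smul, norm_smul, ← dist_eq_norm]
              exact mul_le_mul h4 (hb s y) (norm_nonneg _) (by positivity)
        _ = _ := by ring
  · refine ⟨tsupport (fun p : ℝ × E3 => φ p.1 p.2) ∪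
      (fun q : (ℝ × E3) × E3 => (q.1.1, q.2)) '' tsupport G,
      hφ.hasCompactSupport.isCompact.union (hG.compact.isCompact.image (by fun_prop)), ?_⟩
    intro t _ x hx
    simp only [mem_union, not_or] at hx
    have h1 : φ t x = 0 := image_eq_zero_of_notMem_tsupport
      (f := fun p : ℝ × E3 => φ p.1 p.2) (x := (t, x)) hx.1
    have h2 : G ((t, h t), x) = 0 := by
      by_contra hne
      exact hx.2 ⟨_, subset_tsupport _ hne, rfl⟩
    simp [h1, h2]
  · have : (fun x => θ t • (φ t x + G ((t, h t), x)))
        = fun x => (fun _ => θ t) x • (fun x => φ t x + G ((t, h t), x)) x := rfl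
    rw [this, div_smul (differentiableAt_const _) ((hsm t).differentiable (by simp) x),
      hG.divFree t ht]
    simp
  · have hsub : tsupport (fun x => θ t • (φ t x + G ((t, h t), x)))
        ⊆ {x | 2 * ε ≤ ‖x - h t‖} := by
      refine closure_minimal (fun x hx => ?_) (isClosed_le continuous_const (by fun_prop))
      by_contra hlt
      rw [mem_ofPred_eq, not_le] at hlt
      exact hx (by simp only [hG.inside t (h t) x hlt, smul_zero])
    refine hsub.trans fun x hx => ?_
    rw [mem_ofPred_eq] at hx ⊢
    linarith

/-! ### The terms of the weak formulation as functionals of the field. -/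

/-- The pairing of an `L²` field with a continuous field. -/
def pairing (u : L2) (f : E3 → E3) : ℝ := ∫ x, inner ℝ (u x) (f x)

/-- The viscous term `∫ ∇u : ∇f`. -/
def viscous (u : L2) (f : E3 → E3) : ℝ :=
  ∫ x, ∑ i, inner ℝ (weakPartial i u x) (fderiv ℝ f x (e i))

/-- The convective term `∫ (u · ∇u) · f`. -/
def convective (u : L2) (f : E3 → E3) : ℝ :=
  ∫ x, ∑ i, (u x) i * inner ℝ (weakPartial i u x) (f x)

/-- The size of the gradient, `∑ᵢ ‖∂ᵢu‖`. -/
def gradNorm (u : L2) : ℝ := ∑ i, ‖weakPartial i u‖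

lemma gradNorm_nonneg (u : L2) : 0 ≤ gradNorm u := by unfold gradNorm; positivity

lemma norm_weakPartial_le_gradNorm (i : Fin 3) (u : L2) : ‖weakPartial i u‖ ≤ gradNorm u :=
  Finset.single_le_sum (f := fun i => ‖weakPartial i u‖) (fun _ _ => norm_nonneg _)
    (Finset.mem_univ i)

lemma sum_sq_le_gradNorm_sq (u : L2) : ∑ i, ‖weakPartial i u‖ ^ 2 ≤ gradNorm u ^ 2 := by
  unfold gradNorm
  simp only [Fin.sum_univ_three]
  nlinarith [mul_nonneg (norm_nonneg (weakPartial 0 u)) (norm_nonneg (weakPartial 1 u)),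
    mul_nonneg (norm_nonneg (weakPartial 0 u)) (norm_nonneg (weakPartial 2 u)),
    mul_nonneg (norm_nonneg (weakPartial 1 u)) (norm_nonneg (weakPartial 2 u))]

lemma integrable_inner_cc (u : L2) {f : E3 → E3} (hf : Continuous f) (hc : HasCompactSupport f) :
    Integrable (fun x => inner ℝ (u x) (f x)) volume := by
  refine (integrable_inner u (ccLp f hf hc)).congr ?_
  filter_upwards [coeFn_ccLp hf hc] with x hx
  rw [hx]

lemma pairing_eq_inner (u : L2) {f : E3 → E3} (hf : Continuous f) (hc : HasCompactSupport f) :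
    pairing u f = inner ℝ u (ccLp f hf hc) := (inner_ccLp u hf hc).symm

lemma pairing_add (u : L2) {f g : E3 → E3} (hf : Continuous f) (hfc : HasCompactSupport f)
    (hg : Continuous g) (hgc : HasCompactSupport g) :
    pairing u (fun x => f x + g x) = pairing u f + pairing u g := by
  unfold pairing
  simp only [inner_add_right]
  exact integral_add (integrable_inner_cc u hf hfc) (integrable_inner_cc u hg hgc)

lemma pairing_smul (u : L2) (c : ℝ) (f : E3 → E3) :
    pairing u (fun x => c • f x) = c * pairing u f := by
  unfold pairing
  simp only [inner_smul_right]
  exact integral_const_mul _ _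

lemma continuous_partial {f : E3 → E3} (hf : ContDiff ℝ ∞ f) (k : E3) :
    Continuous (fun x => fderiv ℝ f x k) :=
  (hf.continuous_fderiv (by simp)).clm_apply continuous_const

lemma viscous_eq_sum (u : L2) {f : E3 → E3} (hf : IsTestField f) :
    viscous u f = ∑ i, pairing (weakPartial i u) (fun x => fderiv ℝ f x (e i)) :=
  integral_finsetSum _ fun _ _ => integrable_inner_cc _ (continuous_partial hf.smooth _)
    (hf.compact.fderiv_apply ℝ _)

lemma viscous_add (u : L2) {f g : E3 → E3} (hf : IsTestField f) (hg : IsTestField g) :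
    viscous u (fun x => f x + g x) = viscous u f + viscous u g := by
  have hfg : IsTestField (fun x => f x + g x) :=
    ⟨hf.smooth.add hg.smooth, hf.compact.add hg.compact⟩
  rw [viscous_eq_sum u hf, viscous_eq_sum u hg, viscous_eq_sum u hfg, ← Finset.sum_add_distrib]
  refine Finset.sum_congr rfl fun i _ => ?_
  rw [← pairing_add _ (continuous_partial hf.smooth _) (hf.compact.fderiv_apply ℝ _)
    (continuous_partial hg.smooth _) (hg.compact.fderiv_apply ℝ _)]
  congr 1
  ext1 x
  rw [fderiv_fun_add (hf.smooth.differentiable (by simp) x) (hg.smooth.differentiable (by simp) x)]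
  rfl

lemma viscous_smul (u : L2) (c : ℝ) {f : E3 → E3} (hf : IsTestField f) :
    viscous u (fun x => c • f x) = c * viscous u f := by
  unfold viscous
  rw [← integral_const_mul]
  refine integral_congr_ae (Eventually.of_forall fun x => ?_)
  simp only []
  rw [fderiv_fun_const_smul (hf.smooth.differentiable (by simp) x), Finset.mul_sum]
  simp [inner_smul_right]

/-- The matrix field `u ↦ uᵢ f(x)`. -/
lemma exists_transport_bcf (i : Fin 3) {f : E3 → E3} (hf : Continuous f)
    (hc : HasCompactSupport f) :
    ∃ A : E3 →ᵇ (E3 →L[ℝ] E3), ∀ x, A x = (coordL i).smulRight (f x) := by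
  have h1 : Continuous (fun x => (coordL i).smulRight (f x)) :=
    (ContinuousLinearMap.smulRightL ℝ E3 E3 (coordL i)).continuous.comp hf
  have h2 : HasCompactSupport (fun x => (coordL i).smulRight (f x)) :=
    hc.comp_left (g := fun y => (coordL i).smulRight y) (by ext; simp)
  obtain ⟨C, hC⟩ := h1.bounded_above_of_compact_support h2
  exact ⟨BoundedContinuousFunction.ofNormedAddCommGroup _ h1 C hC, fun x => rfl⟩

lemma inner_mulLp_transport (i : Fin 3) {f : E3 → E3} {A : E3 →ᵇ (E3 →L[ℝ] E3)}
    (hA : ∀ x, A x = (coordL i).smulRight (f x)) (u w : L2) :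
    inner ℝ w (mulLp A u) = ∫ x, u x i * inner ℝ (w x) (f x) := by
  rw [inner_mulLp]
  refine integral_congr_ae (Eventually.of_forall fun x => ?_)
  simp [hA, inner_smul_right]

lemma integrable_transport (i : Fin 3) {f : E3 → E3} (hf : Continuous f)
    (hc : HasCompactSupport f) (u w : L2) :
    Integrable (fun x => u x i * inner ℝ (w x) (f x)) volume := by
  obtain ⟨A, hA⟩ := exists_transport_bcf i hf hc
  refine (integrable_inner w (mulLp A u)).congr ?_
  filter_upwards [coeFn_mulLp A u] with x hx
  rw [hx, hA]
  simp [inner_smul_right]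

lemma convective_eq_sum (u : L2) {f : E3 → E3} (hf : Continuous f) (hc : HasCompactSupport f) :
    convective u f = ∑ i, ∫ x, u x i * inner ℝ (weakPartial i u x) (f x) :=
  integral_finsetSum _ fun i _ => integrable_transport i hf hc _ _

lemma convective_add (u : L2) {f g : E3 → E3} (hf : Continuous f) (hfc : HasCompactSupport f)
    (hg : Continuous g) (hgc : HasCompactSupport g) :
    convective u (fun x => f x + g x) = convective u f + convective u g := by
  have hfg : Continuous (fun x => f x + g x) := hf.add hg
  rw [convective_eq_sum u hf hfc, convective_eq_sum u hg hgc,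
    convective_eq_sum u hfg (hfc.add hgc), ← Finset.sum_add_distrib]
  refine Finset.sum_congr rfl fun i _ => ?_
  rw [← integral_add (integrable_transport i hf hfc _ _) (integrable_transport i hg hgc _ _)]
  refine integral_congr_ae (Eventually.of_forall fun x => ?_)
  simp [inner_add_right, mul_add]

lemma convective_smul (u : L2) (c : ℝ) (f : E3 → E3) :
    convective u (fun x => c • f x) = c * convective u f := by
  unfold convective
  rw [← integral_const_mul]
  refine integral_congr_ae (Eventually.of_forall fun x => ?_)
  simp only [inner_smul_right, Finset.mul_sum]
  exact Finset.sum_congr rfl fun i _ => by ring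

/-! ### Bounds -/

/-- The Cauchy-Schwarz inequality on a set, for the norms of two fields. -/
lemma setIntegral_norm_mul_norm_le (s : Set E3) {F G : E3 → ℝ} (hF : 0 ≤ F) (hG : 0 ≤ G)
    (hF2 : MemLp F 2 (volume.restrict s)) (hG2 : MemLp G 2 (volume.restrict s)) :
    ∫ x in s, F x * G x ≤ √(∫ x in s, F x ^ 2) * √(∫ x in s, G x ^ 2) := by
  have h22 : ENNReal.ofReal 2 = 2 := by norm_num
  have := integral_mul_le_Lp_mul_Lq_of_nonneg (μ := volume.restrict s) (p := 2) (q := 2)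
    (Real.HolderConjugate.two_two) (Eventually.of_forall hF) (Eventually.of_forall hG)
    (by rwa [h22]) (by rwa [h22])
  simpa [Real.sqrt_eq_rpow] using this

lemma memLp_norm (u : L2) (s : Set E3) : MemLp (fun x => ‖u x‖) 2 (volume.restrict s) :=
  ((Lp.memLp u).norm).restrict s

lemma abs_integral_le_of_ball {F : E3 → ℝ} {g : E3 → ℝ} {B : Set E3} (hB : MeasurableSet B)
    (hg : IntegrableOn g B volume) (h0 : ∀ x ∉ B, F x = 0) (hb : ∀ x ∈ B, |F x| ≤ g x) :
    |∫ x, F x| ≤ ∫ x in B, g x := by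
  rw [← setIntegral_eq_integral_of_forall_compl_eq_zero h0, ← Real.norm_eq_abs]
  refine norm_integral_le_of_norm_le hg ?_
  filter_upwards [ae_restrict_mem hB] with x hx
  exact hb x hx

lemma setIntegral_norm_sq_le (u : L2) (s : Set E3) : ∫ x in s, ‖u x‖ ^ 2 ≤ ‖u‖ ^ 2 := by
  rw [norm_sq_eq_integral]
  exact setIntegral_le_integral (integrable_norm_sq u) (Eventually.of_forall fun x => sq_nonneg _)

/-- The volume of the unit ball of `ℝ³`. -/
def ballVol : ℝ := volume.real (Metric.ball (0 : E3) 1)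

lemma ballVol_nonneg : 0 ≤ ballVol := measureReal_nonneg

lemma volume_real_ball (c : E3) {r : ℝ} (hr : 0 < r) :
    volume.real (Metric.ball c r) = r ^ 3 * ballVol := by
  have := Measure.addHaar_ball (volume : Measure E3) c hr.le
  rw [Measure.real, this, ENNReal.toReal_mul, ENNReal.toReal_ofReal (by positivity)]
  simp [ballVol, Measure.real]

/-- A field of size `B` supported in a ball of radius `3ε` pairs with `u` at size
`B ε^{3/2} ‖u‖_{L²(ball)}`. -/
lemma abs_pairing_le_ball (u : L2) {f : E3 → E3} {c : E3} {ε B : ℝ} (hε : 0 < ε) (hB : 0 ≤ B)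
    (hfB : ∀ x, ‖f x‖ ≤ B) (hf0 : ∀ x, 3 * ε < ‖x - c‖ → f x = 0) :
    |pairing u f| ≤ B * (√(∫ x in Metric.ball c (4 * ε), ‖u x‖ ^ 2) * √((4 * ε) ^ 3 * ballVol)) := by
  have hball : volume (Metric.ball c (4 * ε)) < ⊤ := measure_ball_lt_top
  have : IsFiniteMeasure (volume.restrict (Metric.ball c (4 * ε))) :=
    ⟨by rw [Measure.restrict_apply_univ]; exact hball⟩
  have hcs := setIntegral_norm_mul_norm_le (Metric.ball c (4 * ε)) (F := fun x => ‖u x‖)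
    (G := fun _ => 1) (fun x => norm_nonneg _) (fun _ => zero_le_one) (memLp_norm u _)
    (memLp_const _)
  simp only [mul_one, one_pow] at hcs
  have h1 : ∫ x in Metric.ball c (4 * ε), (1 : ℝ) = (4 * ε) ^ 3 * ballVol := by
    rw [setIntegral_const, smul_eq_mul, mul_one, volume_real_ball c (by positivity)]
  rw [h1] at hcs
  have hi : IntegrableOn (fun x => ‖u x‖) (Metric.ball c (4 * ε)) volume :=
    (memLp_norm u _).integrable (by norm_num)
  calc |pairing u f| ≤ ∫ x in Metric.ball c (4 * ε), B * ‖u x‖ := by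
        refine abs_integral_le_of_ball Metric.isOpen_ball.measurableSet (hi.const_mul B)
          (fun x hx => ?_) (fun x _ => ?_)
        · rw [hf0 x, inner_zero_right]
          rw [mem_ball_iff_norm, not_lt] at hx
          linarith
        · refine (abs_real_inner_le_norm _ _).trans ?_
          rw [mul_comm]
          exact mul_le_mul_of_nonneg_right (hfB x) (norm_nonneg _)
    _ = B * ∫ x in Metric.ball c (4 * ε), ‖u x‖ := integral_const_mul _ _
    _ ≤ _ := mul_le_mul_of_nonneg_left hcs hB

lemma sqrt_ball_volume (ε : ℝ) : √((4 * ε) ^ 3 * ballVol) = 8 * √ballVol * √(ε ^ 3) := by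
  have : (4 * ε) ^ 3 * ballVol = 8 ^ 2 * (ballVol * ε ^ 3) := by ring
  rw [this, Real.sqrt_mul (by norm_num), Real.sqrt_sq (by norm_num), Real.sqrt_mul ballVol_nonneg]
  ring

lemma abs_pairing_le (u : L2) {f : E3 → E3} {c : E3} {ε B : ℝ} (hε : 0 < ε) (hB : 0 ≤ B)
    (hfB : ∀ x, ‖f x‖ ≤ B) (hf0 : ∀ x, 3 * ε < ‖x - c‖ → f x = 0) :
    |pairing u f| ≤ 8 * √ballVol * B * √(ε ^ 3) * ‖u‖ := by
  refine (abs_pairing_le_ball u hε hB hfB hf0).trans ?_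
  have h1 : √(∫ x in Metric.ball c (4 * ε), ‖u x‖ ^ 2) ≤ ‖u‖ :=
    Real.sqrt_le_iff.2 ⟨norm_nonneg _, setIntegral_norm_sq_le u _⟩
  rw [sqrt_ball_volume]
  calc _ ≤ B * (‖u‖ * (8 * √ballVol * √(ε ^ 3))) := by gcongr
    _ = _ := by ring

/-- Hardy's inequality with `ρ = 4ε`: the constant `8 · 4² = 128` is rounded up to `12²`. -/
lemma sqrt_ball_mass_le {u : L2} (hu : InH1 u) (c : E3) {ε : ℝ} (hε : 0 < ε) :
    √(∫ x in Metric.ball c (4 * ε), ‖u x‖ ^ 2) ≤ 12 * ε * gradNorm u := by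
  refine Real.sqrt_le_iff.2 ⟨by have := gradNorm_nonneg u; positivity, ?_⟩
  have h1 := integral_ball_norm_sq_le (fun i => hu.hasWeakPartial i) c (ρ := 4 * ε) (by positivity)
  refine h1.trans ?_
  have h2 := mul_le_mul_of_nonneg_left (sum_sq_le_gradNorm_sq u)
    (by positivity : 0 ≤ 8 * (4 * ε) ^ 2)
  nlinarith [sq_nonneg (ε * gradNorm u)]

/-- Compared with `abs_pairing_le`, trading `‖u‖` for the gradient gains one power of `ε`. This
compensates the factor `1 / ε` that the moving centre puts in the time derivative of the correction.
-/
lemma abs_pairing_le_gradNorm {u : L2} (hu : InH1 u) {f : E3 → E3} {c : E3} {ε B : ℝ}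
    (hε : 0 < ε) (hB : 0 ≤ B) (hfB : ∀ x, ‖f x‖ ≤ B) (hf0 : ∀ x, 3 * ε < ‖x - c‖ → f x = 0) :
    |pairing u f| ≤ 96 * √ballVol * B * (ε * √(ε ^ 3)) * gradNorm u := by
  refine (abs_pairing_le_ball u hε hB hfB hf0).trans ?_
  have h1 := sqrt_ball_mass_le hu c hε
  rw [sqrt_ball_volume]
  calc _ ≤ B * (12 * ε * gradNorm u * (8 * √ballVol * √(ε ^ 3))) := by gcongr
    _ = _ := by ring

/-- Cauchy–Schwarz on the ball that contains the support; Hardy's inequality for the factor `u`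
gives the power of `ε`, and no Sobolev embedding is needed. -/
lemma abs_convective_le_gradNorm {u : L2} (hu : InH1 u) {f : E3 → E3} (hf : Continuous f)
    (hfc : HasCompactSupport f) {c : E3} {ε B : ℝ}
    (hε : 0 < ε) (hB : 0 ≤ B) (hfB : ∀ x, ‖f x‖ ≤ B) (hf0 : ∀ x, 3 * ε < ‖x - c‖ → f x = 0) :
    |convective u f| ≤ 12 * B * ε * gradNorm u ^ 2 := by
  rw [convective_eq_sum u hf hfc]
  have hj : ∀ i, |∫ x, u x i * inner ℝ (weakPartial i u x) (f x)|
      ≤ 12 * B * ε * gradNorm u * ‖weakPartial i u‖ := by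
    intro i
    set w := weakPartial i u
    have hi : IntegrableOn (fun x => ‖u x‖ * ‖w x‖) (Metric.ball c (4 * ε)) volume :=
      (memLp_norm u _).integrable_mul (memLp_norm w _)
    have hcs := setIntegral_norm_mul_norm_le (Metric.ball c (4 * ε)) (F := fun x => ‖u x‖)
      (G := fun x => ‖w x‖) (fun x => norm_nonneg _) (fun x => norm_nonneg _) (memLp_norm u _)
      (memLp_norm w _)
    have h1 := sqrt_ball_mass_le hu c hε
    have h2 : √(∫ x in Metric.ball c (4 * ε), ‖w x‖ ^ 2) ≤ ‖w‖ :=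
      Real.sqrt_le_iff.2 ⟨norm_nonneg _, setIntegral_norm_sq_le w _⟩
    calc |∫ x, u x i * inner ℝ (w x) (f x)|
        ≤ ∫ x in Metric.ball c (4 * ε), B * (‖u x‖ * ‖w x‖) := by
          refine abs_integral_le_of_ball Metric.isOpen_ball.measurableSet (hi.const_mul B)
            (fun x hx => ?_) (fun x _ => ?_)
          · rw [hf0 x, inner_zero_right, mul_zero]
            rw [mem_ball_iff_norm, not_lt] at hx
            linarith
          · rw [abs_mul]
            calc _ ≤ ‖u x‖ * (‖w x‖ * B) := by
                  refine mul_le_mul (E3.abs_apply_le _ _) ?_ (abs_nonneg _) (norm_nonneg _)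
                  exact (abs_real_inner_le_norm _ _).trans
                    (mul_le_mul_of_nonneg_left (hfB x) (norm_nonneg _))
              _ = _ := by ring
      _ = B * ∫ x in Metric.ball c (4 * ε), ‖u x‖ * ‖w x‖ := integral_const_mul _ _
      _ ≤ B * ((12 * ε * gradNorm u) * ‖w‖) := by
          refine mul_le_mul_of_nonneg_left (hcs.trans ?_) hB
          have := gradNorm_nonneg u
          gcongr
      _ = _ := by ring
  refine (Finset.abs_sum_le_sum_abs _ _).trans ((Finset.sum_le_sum fun i _ => hj i).trans_eq ?_)
  rw [← Finset.mul_sum]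
  change _ * gradNorm u = _
  ring

/-- Used with `B = M / ε`: the volume factor `ε^{3/2}` then leaves `ε^{1/2}`. -/
lemma abs_viscous_le {u : L2} {f : E3 → E3} (hf : IsTestField f) {c : E3} {ε B : ℝ}
    (hε : 0 < ε) (hB : 0 ≤ B) (hfB : ∀ i x, ‖fderiv ℝ f x (e i)‖ ≤ B)
    (hf0 : ∀ x, 3 * ε < ‖x - c‖ → f x = 0) :
    |viscous u f| ≤ 8 * √ballVol * B * √(ε ^ 3) * gradNorm u := by
  rw [viscous_eq_sum u hf, gradNorm, Finset.mul_sum]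
  refine (Finset.abs_sum_le_sum_abs _ _).trans (Finset.sum_le_sum fun i _ => ?_)
  refine abs_pairing_le _ hε hB (hfB i) (c := c) fun x hx => ?_
  have : f =ᶠ[𝓝 x] fun _ => 0 := by
    have ho : IsOpen {x : E3 | 3 * ε < ‖x - c‖} := isOpen_lt continuous_const (by fun_prop)
    filter_upwards [ho.mem_nhds hx] with y hy
    exact hf0 y hy
  rw [this.fderiv_eq]; simp

lemma abs_pairing_le_norm (u : L2) {f : E3 → E3} (hf : Continuous f) (hc : HasCompactSupport f) :
    |pairing u f| ≤ ‖ccLp f hf hc‖ * ‖u‖ := by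
  rw [pairing_eq_inner u hf hc, mul_comm]
  exact abs_real_inner_le_norm _ _

lemma abs_transport_le (i : Fin 3) {f : E3 → E3} (hf : Continuous f) (hc : HasCompactSupport f)
    {B : ℝ} (hB : 0 ≤ B) (hfB : ∀ x, ‖f x‖ ≤ B) (u w : L2) :
    |∫ x, u x i * inner ℝ (w x) (f x)| ≤ B * ‖u‖ * ‖w‖ := by
  obtain ⟨A, hA⟩ := exists_transport_bcf i hf hc
  rw [← inner_mulLp_transport i hA]
  have hAB : ‖A‖ ≤ B := by
    refine (BoundedContinuousFunction.norm_le hB).2 fun x => ?_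
    rw [hA]
    refine ContinuousLinearMap.opNorm_le_bound _ hB fun y => ?_
    rw [ContinuousLinearMap.smulRight_apply, norm_smul, mul_comm]
    exact mul_le_mul (hfB x) (E3.abs_apply_le y i) (norm_nonneg _) hB
  calc _ ≤ ‖w‖ * ‖mulLp A u‖ := abs_real_inner_le_norm _ _
    _ ≤ ‖w‖ * (B * ‖u‖) := by
        refine mul_le_mul_of_nonneg_left ((norm_mulLp_le A u).trans ?_) (norm_nonneg _)
        exact mul_le_mul_of_nonneg_right hAB (norm_nonneg _)
    _ = _ := by ring

lemma abs_convective_le {f : E3 → E3} (hf : Continuous f) (hc : HasCompactSupport f)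
    {B : ℝ} (hB : 0 ≤ B) (hfB : ∀ x, ‖f x‖ ≤ B) (u : L2) :
    |convective u f| ≤ B * ‖u‖ * gradNorm u := by
  rw [convective_eq_sum u hf hc, gradNorm, Finset.mul_sum]
  exact (Finset.abs_sum_le_sum_abs _ _).trans
    (Finset.sum_le_sum fun i _ => abs_transport_le i hf hc hB hfB _ _)

/-! ### Dependence on time of the terms of the weak formulation -/

section Curves

variable {P : Type*} [NormedAddCommGroup P] {K : P × E3 → E3} {μ : Measure ℝ}

/-- Measurability in time is that of an inner product of two curves in `L²`: the kernel gives a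
continuous curve, composed with a measurable parameter. The parameter will be `t` or `(t, h t)`. -/
lemma aestronglyMeasurable_pairing (hK : Continuous K) (hc : HasCompactSupport K)
    {u : ℝ → L2} {p : ℝ → P} (hu : AEStronglyMeasurable u μ) (hp : AEStronglyMeasurable p μ) :
    AEStronglyMeasurable (fun t => pairing (u t) (fun x => K (p t, x))) μ := by
  have h1 := hu.inner (𝕜 := ℝ) ((continuous_ccLp_curve K hK hc).comp_aestronglyMeasurable hp)
  refine h1.congr (Eventually.of_forall fun t => ?_)
  exact (pairing_eq_inner _ _ _).symm

lemma aestronglyMeasurable_transport (i : Fin 3) (hK : Continuous K) (hc : HasCompactSupport K)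
    {u w : ℝ → L2} {p : ℝ → P} (hu : AEStronglyMeasurable u μ) (hw : AEStronglyMeasurable w μ)
    (hp : AEStronglyMeasurable p μ) :
    AEStronglyMeasurable (fun t => ∫ x, u t x i * inner ℝ (w t x) (K (p t, x))) μ := by
  obtain ⟨k, hk, hkK⟩ := exists_bcf_curve (fun q => (coordL i).smulRight (K q))
    ((ContinuousLinearMap.smulRightL ℝ E3 E3 (coordL i)).continuous.comp hK)
    (hc.comp_left (g := fun y => (coordL i).smulRight y) (by ext; simp))
  have h1 := hw.inner (𝕜 := ℝ) (continuous_mulLp.comp_aestronglyMeasurable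
    ((hk.comp_aestronglyMeasurable hp).prodMk hu))
  refine h1.congr (Eventually.of_forall fun t => ?_)
  exact inner_mulLp_transport i (fun x => hkK (p t) x) _ _

lemma aestronglyMeasurable_convective (hK : Continuous K) (hc : HasCompactSupport K)
    {u : ℝ → L2} {p : ℝ → P} (hu : AEStronglyMeasurable u μ)
    (hw : ∀ i, AEStronglyMeasurable (fun t => weakPartial i (u t)) μ)
    (hp : AEStronglyMeasurable p μ) :
    AEStronglyMeasurable (fun t => convective (u t) (fun x => K (p t, x))) μ := by
  have h1 := Finset.aestronglyMeasurable_fun_sum Finset.univ fun i _ =>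
    aestronglyMeasurable_transport i hK hc hu (hw i) hp
  refine h1.congr (Eventually.of_forall fun t => ?_)
  exact (convective_eq_sum _ (hK.comp (by fun_prop)) (HasCompactSupport.slice hc _)).symm

lemma ccLp_zero_of_forall {f : E3 → E3} (hf : Continuous f) (hc : HasCompactSupport f)
    (h : ∀ x, f x = 0) : ccLp f hf hc = 0 := by
  refine Lp.ext ?_
  filter_upwards [coeFn_ccLp hf hc, Lp.coeFn_zero E3 2 (volume : Measure E3)] with x h1 h2
  rw [h1, h2, h x]; rfl

lemma exists_pairing_bound (hK : Continuous K) (hc : HasCompactSupport K) :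
    ∃ B, 0 ≤ B ∧ ∀ p u, |pairing u (fun x => K (p, x))| ≤ B * ‖u‖ := by
  have h1 : HasCompactSupport (fun p => ccLp (fun x => K (p, x)) (hK.comp (by fun_prop))
      (HasCompactSupport.slice hc p)) := by
    refine HasCompactSupport.of_support_subset_isCompact (hc.isCompact.image continuous_fst) ?_
    intro p hp
    by_contra hn
    refine hp (ccLp_zero_of_forall _ _ fun x => ?_)
    by_contra hx
    exact hn ⟨(p, x), subset_tsupport _ hx, rfl⟩
  obtain ⟨B, hB⟩ := (continuous_ccLp_curve K hK hc).bounded_above_of_compact_support h1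
  refine ⟨B, (norm_nonneg _).trans (hB 0), fun p u => ?_⟩
  refine (abs_pairing_le_norm u (hK.comp (by fun_prop)) (HasCompactSupport.slice hc p)).trans ?_
  exact mul_le_mul_of_nonneg_right (hB p) (norm_nonneg _)

lemma exists_convective_bound (hK : Continuous K) (hc : HasCompactSupport K) :
    ∃ B, 0 ≤ B ∧ ∀ p u, |convective u (fun x => K (p, x))| ≤ B * ‖u‖ * gradNorm u := by
  obtain ⟨B, hB⟩ := hK.bounded_above_of_compact_support hc
  exact ⟨B, (norm_nonneg _).trans (hB 0), fun p u => abs_convective_le (hK.comp (by fun_prop))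
    (HasCompactSupport.slice hc p) ((norm_nonneg _).trans (hB 0)) (fun x => hB _) u⟩

variable [NormedSpace ℝ P]

lemma isTestField_slice (hK : ContDiff ℝ ∞ K) (hc : HasCompactSupport K) (p : P) :
    IsTestField (fun x => K (p, x)) :=
  ⟨hK.comp (contDiff_const.prodMk contDiff_id), HasCompactSupport.slice hc p⟩

lemma fderiv_slice (hK : ContDiff ℝ ∞ K) (p : P) (x k : E3) :
    fderiv ℝ (fun x => K (p, x)) x k = fderiv ℝ K (p, x) (0, k) := by
  have h1 := (hK.differentiable (by simp) (p, x)).hasFDerivAt.comp x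
    (hasFDerivAt_prodMk_right p x)
  have h2 : (K ∘ fun x => (p, x)) = fun x => K (p, x) := rfl
  rw [h2] at h1
  rw [h1.fderiv]
  simp

lemma continuous_partial_space (hK : ContDiff ℝ ∞ K) (k : P × E3) :
    Continuous (fun q => fderiv ℝ K q k) :=
  (hK.continuous_fderiv (by simp)).clm_apply continuous_const

lemma viscous_slice (hK : ContDiff ℝ ∞ K) (hc : HasCompactSupport K) (p : P) (u : L2) :
    viscous u (fun x => K (p, x))
      = ∑ i, pairing (weakPartial i u) (fun x => fderiv ℝ K (p, x) (0, e i)) := by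
  rw [viscous_eq_sum u (isTestField_slice hK hc p)]
  simp only [fderiv_slice hK]

lemma aestronglyMeasurable_viscous (hK : ContDiff ℝ ∞ K) (hc : HasCompactSupport K)
    {u : ℝ → L2} {p : ℝ → P}
    (hw : ∀ i, AEStronglyMeasurable (fun t => weakPartial i (u t)) μ)
    (hp : AEStronglyMeasurable p μ) :
    AEStronglyMeasurable (fun t => viscous (u t) (fun x => K (p t, x))) μ := by
  have h1 := Finset.aestronglyMeasurable_fun_sum Finset.univ fun i _ =>
    aestronglyMeasurable_pairing (continuous_partial_space hK (0, e i)) (hc.fderiv_apply ℝ _)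
      (hw i) hp
  refine h1.congr (Eventually.of_forall fun t => ?_)
  exact (viscous_slice hK hc _ _).symm

lemma exists_viscous_bound (hK : ContDiff ℝ ∞ K) (hc : HasCompactSupport K) :
    ∃ B, 0 ≤ B ∧ ∀ p u, |viscous u (fun x => K (p, x))| ≤ B * gradNorm u := by
  choose B hB0 hB using fun i => exists_pairing_bound (continuous_partial_space hK (0, e i))
    (hc.fderiv_apply ℝ _)
  refine ⟨∑ i, B i, Finset.sum_nonneg fun i _ => hB0 i, fun p u => ?_⟩
  rw [viscous_slice hK hc, Finset.sum_mul]
  refine (Finset.abs_sum_le_sum_abs _ _).trans (Finset.sum_le_sum fun i _ => (hB i p _).trans ?_)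
  exact mul_le_mul_of_nonneg_left (norm_weakPartial_le_gradNorm i u) (hB0 i)

end Curves

/-! ### Fields with uniform energy bounds on a time interval. -/

/-- Regularity and bounds of a field on the time interval `(0, T)`. -/
structure IsRegular (u : ℝ → L2) (T C : ℝ) : Prop where
  meas : AEStronglyMeasurable u (volume.restrict (Ioo 0 T))
  memLp : ∀ i, MemLp (fun t => weakPartial i (u t)) 2 (volume.restrict (Ioo 0 T))
  inH1 : ∀ᵐ t ∂(volume.restrict (Ioo 0 T)), InH1 (u t)
  bound : ∀ t ∈ Icc 0 T, ‖u t‖ ≤ C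
  bound_partial : ∀ i, ∫ t in Ioo 0 T, ‖weakPartial i (u t)‖ ^ 2 ≤ C ^ 2

lemma integral_norm_sq_le_of_eLpNorm_le {X F : Type*} [MeasurableSpace X] [NormedAddCommGroup F]
    {μ : Measure X} {f : X → F} (hf : MemLp f 2 μ) {C : ℝ≥0} (h : eLpNorm f 2 μ ≤ C) :
    ∫ x, ‖f x‖ ^ 2 ∂μ ≤ (C : ℝ) ^ 2 := by
  have h1 := hf.eLpNorm_eq_integral_rpow_norm (by norm_num) (by norm_num)
  rw [h1] at h
  have h2 := ENNReal.toReal_mono ENNReal.coe_ne_top h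
  have h0 : 0 ≤ ∫ x, ‖f x‖ ^ 2 ∂μ := integral_nonneg fun x => by positivity
  simp only [ENNReal.toReal_ofNat, Real.rpow_ofNat, ENNReal.coe_toReal] at h2
  rw [ENNReal.toReal_ofReal (by positivity)] at h2
  rw [show (2 : ℝ)⁻¹ = 1 / 2 by norm_num, ← Real.sqrt_eq_rpow] at h2
  exact (Real.sqrt_le_left C.coe_nonneg).1 h2

lemma UniformlyBounded.exists_isRegular {ε₀ : ℝ} {v : ℝ → ℝ → L2}
    (hspace : ∀ ε ∈ Ioo 0 ε₀, InEnergySpace (v ε)) (hbound : UniformlyBounded ε₀ v) {T : ℝ}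
    (hT : 0 < T) : ∃ C, 0 ≤ C ∧ ∀ ε ∈ Ioo 0 ε₀, IsRegular (v ε) T C := by
  obtain ⟨C, hC⟩ := hbound T hT
  refine ⟨C, C.coe_nonneg, fun ε hε => ?_⟩
  have h1 := hspace ε hε
  obtain ⟨h2, -, -, h3⟩ := hC ε hε
  refine ⟨(h1.memLp_top T hT).1, fun i => h1.memLp_partial i T hT, ?_, h2, fun i => ?_⟩
  · exact ae_mono (Measure.restrict_mono (fun t ht => ht.1) le_rfl) h1.ae_inH1
  · exact integral_norm_sq_le_of_eLpNorm_le (h1.memLp_partial i T hT) (h3 i)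

namespace IsRegular

variable {u : ℝ → L2} {T C : ℝ}

lemma mono (h : IsRegular u T C) {S : ℝ} (hS : S ≤ T) : IsRegular u S C := by
  have hsub : Ioo 0 S ⊆ Ioo 0 T := Ioo_subset_Ioo_right hS
  have hle := Measure.restrict_mono hsub (le_refl (volume : Measure ℝ))
  refine ⟨h.meas.mono_measure hle, fun i => (h.memLp i).mono_measure hle, ae_mono hle h.inH1,
    fun t ht => h.bound t ⟨ht.1, ht.2.trans hS⟩, fun i => le_trans ?_ (h.bound_partial i)⟩
  exact setIntegral_mono_set ((h.memLp i).integrable_norm_pow (by norm_num))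
    (Eventually.of_forall fun t => by positivity) hsub.eventuallyLE

lemma ae_bound (h : IsRegular u T C) : ∀ᵐ t ∂(volume.restrict (Ioo 0 T)), ‖u t‖ ≤ C := by
  filter_upwards [ae_restrict_mem measurableSet_Ioo] with t ht
  exact h.bound t ⟨ht.1.le, ht.2.le⟩

lemma memLp_gradNorm (h : IsRegular u T C) :
    MemLp (fun t => gradNorm (u t)) 2 (volume.restrict (Ioo 0 T)) :=
  memLp_finsetSum _ fun i _ => (h.memLp i).norm

lemma integrable_gradNorm (h : IsRegular u T C) :
    Integrable (fun t => gradNorm (u t)) (volume.restrict (Ioo 0 T)) :=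
  h.memLp_gradNorm.integrable (by norm_num)

lemma integrable_gradNorm_sq (h : IsRegular u T C) :
    Integrable (fun t => gradNorm (u t) ^ 2) (volume.restrict (Ioo 0 T)) :=
  h.memLp_gradNorm.integrable_sq

lemma integral_gradNorm_sq_le (h : IsRegular u T C) :
    ∫ t in Ioo 0 T, gradNorm (u t) ^ 2 ≤ 9 * C ^ 2 := by
  have hi : ∀ i, Integrable (fun t => ‖weakPartial i (u t)‖ ^ 2) (volume.restrict (Ioo 0 T)) :=
    fun i => (h.memLp i).integrable_norm_pow (by norm_num)
  calc ∫ t in Ioo 0 T, gradNorm (u t) ^ 2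
      ≤ ∫ t in Ioo 0 T, ∑ i, 3 * ‖weakPartial i (u t)‖ ^ 2 := by
        refine integral_mono h.integrable_gradNorm_sq
          (integrable_finsetSum _ fun i _ => (hi i).const_mul 3) fun t => ?_
        simp only [gradNorm, Fin.sum_univ_three]
        nlinarith [sq_nonneg (‖weakPartial 0 (u t)‖ - ‖weakPartial 1 (u t)‖),
          sq_nonneg (‖weakPartial 0 (u t)‖ - ‖weakPartial 2 (u t)‖),
          sq_nonneg (‖weakPartial 1 (u t)‖ - ‖weakPartial 2 (u t)‖)]
    _ = ∑ i, 3 * ∫ t in Ioo 0 T, ‖weakPartial i (u t)‖ ^ 2 := by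
        rw [integral_finsetSum _ fun i _ => (hi i).const_mul 3]
        simp only [integral_const_mul]
    _ ≤ ∑ i : Fin 3, 3 * C ^ 2 := by
        gcongr with i
        exact h.bound_partial i
    _ = 9 * C ^ 2 := by simp; ring

end IsRegular

/-- Weak convergence of a bounded family against strong convergence: moving `g n` to its limit costs
`C ‖g n - g₀‖`. -/
lemma tendsto_inner_of_weak {H ι : Type*} [NormedAddCommGroup H] [InnerProductSpace ℝ H]
    {l : Filter ι} {z g : ι → H} {w g₀ : H} {C : ℝ}
    (hz : ∀ a, Tendsto (fun n => inner ℝ (z n) a) l (𝓝 (inner ℝ w a)))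
    (hC : ∀ᶠ n in l, ‖z n‖ ≤ C) (hg : Tendsto g l (𝓝 g₀)) :
    Tendsto (fun n => inner ℝ (z n) (g n)) l (𝓝 (inner ℝ w g₀)) := by
  have h1 : Tendsto (fun n => C * ‖g n - g₀‖) l (𝓝 0) := by
    simpa using (tendsto_iff_norm_sub_tendsto_zero.1 hg).const_mul C
  have h2 : Tendsto (fun n => inner ℝ (z n) (g n - g₀)) l (𝓝 0) := by
    refine squeeze_zero_norm' ?_ h1
    filter_upwards [hC] with n hn
    exact (norm_inner_le_norm _ _).trans (mul_le_mul_of_nonneg_right hn (norm_nonneg _))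
  have h3 := h2.add (hz g₀)
  simp only [inner_sub_right, sub_add_cancel, zero_add] at h3
  exact h3

lemma WeaklyContinuous.continuousOn_inner {u : ℝ → L2} (hu : WeaklyContinuous u) {S C : ℝ}
    (hC : ∀ t ∈ Icc 0 S, ‖u t‖ ≤ C) {g : ℝ → L2} (hg : ContinuousOn g (Icc 0 S)) :
    ContinuousOn (fun t => inner ℝ (u t) (g t)) (Icc 0 S) := by
  intro t ht
  refine tendsto_inner_of_weak (C := C) (fun a => ?_) ?_ (hg t ht)
  · exact ((hu a).mono Icc_subset_Ici_self) t ht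
  · filter_upwards [self_mem_nhdsWithin] with s hs using hC s hs

/-! ### Piecewise affine cutoffs in time -/

/-- The function equal to `1` before `s`, to `0` after `s + δ`, and affine in between. -/
def trapezoid (s δ τ : ℝ) : ℝ := max 0 (min 1 (1 - (τ - s) / δ))

lemma trapezoid_nonneg (s δ τ : ℝ) : 0 ≤ trapezoid s δ τ := le_max_left _ _

lemma trapezoid_le_one (s δ τ : ℝ) : trapezoid s δ τ ≤ 1 := max_le zero_le_one (min_le_left _ _)

lemma trapezoid_of_le {s δ τ : ℝ} (hδ : 0 < δ) (h : τ ≤ s) : trapezoid s δ τ = 1 := by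
  have : (τ - s) / δ ≤ 0 := div_nonpos_of_nonpos_of_nonneg (by linarith) hδ.le
  rw [trapezoid, min_eq_left (by linarith), max_eq_right zero_le_one]

lemma trapezoid_of_ge {s δ τ : ℝ} (hδ : 0 < δ) (h : s + δ ≤ τ) : trapezoid s δ τ = 0 := by
  have : 1 ≤ (τ - s) / δ := by rw [le_div_iff₀ hδ]; linarith
  rw [trapezoid, min_eq_right (by linarith), max_eq_left (by linarith)]

lemma trapezoid_of_mem {s δ τ : ℝ} (hδ : 0 < δ) (h : τ ∈ Ioo s (s + δ)) :
    trapezoid s δ τ = 1 - (τ - s) / δ := by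
  have h1 : (τ - s) / δ ≤ 1 := by rw [div_le_iff₀ hδ]; linarith [h.2]
  have h2 : 0 ≤ (τ - s) / δ := div_nonneg (by linarith [h.1]) hδ.le
  rw [trapezoid, min_eq_right (by linarith), max_eq_right (by linarith)]

lemma continuous_trapezoid (s δ : ℝ) : Continuous (trapezoid s δ) := by
  unfold trapezoid; fun_prop

lemma hasDerivAt_trapezoid {s δ τ : ℝ} (hδ : 0 < δ) (h1 : τ ≠ s) (h2 : τ ≠ s + δ) :
    HasDerivAt (trapezoid s δ) ((Ioo s (s + δ)).indicator (fun _ => -(1 / δ)) τ) τ := by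
  rcases lt_or_gt_of_ne h1 with h | h
  · rw [indicator_of_notMem (fun hm => not_lt.2 h.le hm.1)]
    refine (hasDerivAt_const τ (1 : ℝ)).congr_of_eventuallyEq ?_
    filter_upwards [Iio_mem_nhds h] with t ht using trapezoid_of_le hδ (le_of_lt ht)
  rcases lt_or_gt_of_ne h2 with h' | h'
  · rw [indicator_of_mem (show τ ∈ Ioo s (s + δ) from ⟨h, h'⟩)]
    have := (((hasDerivAt_id τ).sub_const s).div_const δ).const_sub 1
    refine this.congr_of_eventuallyEq ?_
    filter_upwards [Ioo_mem_nhds h h'] with t ht using trapezoid_of_mem hδ ht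
  · rw [indicator_of_notMem (fun hm => not_lt.2 h'.le hm.2)]
    refine (hasDerivAt_const τ (0 : ℝ)).congr_of_eventuallyEq ?_
    filter_upwards [Ioi_mem_nhds h'] with t ht using trapezoid_of_ge hδ (le_of_lt ht)

lemma w1InfOn_trapezoid (s : ℝ) {δ : ℝ} (hδ : 0 < δ) : W1InfOn (trapezoid s δ) (Ici 0) := by
  refine ⟨⟨1, fun τ _ => ?_⟩, Real.toNNReal (1 / δ), LipschitzWith.lipschitzOnWith ?_⟩
  · rw [Real.norm_of_nonneg (trapezoid_nonneg _ _ _)]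
    exact trapezoid_le_one _ _ _
  · refine LipschitzWith.of_dist_le_mul fun a b => ?_
    rw [Real.coe_toNNReal _ (by positivity), Real.dist_eq, Real.dist_eq]
    have h1 : |trapezoid s δ a - trapezoid s δ b| ≤
        |min 1 (1 - (a - s) / δ) - min 1 (1 - (b - s) / δ)| := by
      have := abs_max_sub_max_le_max (0 : ℝ) (min 1 (1 - (a - s) / δ)) 0 (min 1 (1 - (b - s) / δ))
      simpa [trapezoid] using this
    have h2 := abs_min_sub_min_le_max (1 : ℝ) (1 - (a - s) / δ) 1 (1 - (b - s) / δ)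
    have h3 : |(1 - (a - s) / δ) - (1 - (b - s) / δ)| = 1 / δ * |a - b| := by
      rw [show (1 - (a - s) / δ) - (1 - (b - s) / δ) = -(1 / δ * (a - b)) by ring, abs_neg, abs_mul,
        abs_of_pos (by positivity)]
    rw [sub_self, abs_zero, h3, max_eq_right (by positivity)] at h2
    exact h1.trans h2

lemma tendsto_average_right {F : ℝ → ℝ} {s S : ℝ} (hsS : s < S)
    (hF : ContinuousOn F (Icc s S)) {δ : ℕ → ℝ} (hδ0 : ∀ n, 0 < δ n)
    (hδ : Tendsto δ atTop (𝓝 0)) :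
    Tendsto (fun n => 1 / δ n * ∫ τ in Ioo s (s + δ n), F τ) atTop (𝓝 (F s)) := by
  rw [Metric.tendsto_atTop]
  intro η hη
  obtain ⟨r, hr, H⟩ := Metric.continuousOn_iff.1 hF s ⟨le_rfl, hsS.le⟩ (η / 2) (by positivity)
  obtain ⟨N, hN⟩ := Metric.tendsto_atTop.1 hδ (min r (S - s)) (lt_min hr (by linarith))
  refine ⟨N, fun n hn => ?_⟩
  have h1 := hN n hn
  rw [Real.dist_eq, sub_zero, abs_of_pos (hδ0 n), lt_min_iff] at h1
  have hd := hδ0 n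
  have hint : IntegrableOn F (Ioo s (s + δ n)) :=
    ((hF.mono (Icc_subset_Icc_right (by linarith))).integrableOn_Icc).mono_set Ioo_subset_Icc_self
  have h2 : ∫ τ in Ioo s (s + δ n), (F τ - F s) = (∫ τ in Ioo s (s + δ n), F τ) - δ n * F s := by
    rw [integral_sub hint (integrable_const _), setIntegral_const]
    simp [hd.le]
  have h3 : ‖∫ τ in Ioo s (s + δ n), (F τ - F s)‖ ≤ η / 2 * volume.real (Ioo s (s + δ n)) := by
    refine norm_setIntegral_le_of_norm_le_const measure_Ioo_lt_top fun τ hτ => ?_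
    rw [← dist_eq_norm]
    refine (H τ ⟨hτ.1.le, by linarith [hτ.2]⟩ ?_).le
    rw [Real.dist_eq, abs_of_pos (by linarith [hτ.1])]
    linarith [hτ.2]
  rw [h2, Real.norm_eq_abs, Real.volume_real_Ioo_of_le (by linarith), add_sub_cancel_left] at h3
  rw [Real.dist_eq]
  have h4 : 1 / δ n * (∫ τ in Ioo s (s + δ n), F τ) - F s
      = 1 / δ n * ((∫ τ in Ioo s (s + δ n), F τ) - δ n * F s) := by
    field_simp
  rw [h4, abs_mul, abs_of_pos (by positivity)]
  calc 1 / δ n * |(∫ τ in Ioo s (s + δ n), F τ) - δ n * F s| ≤ 1 / δ n * (η / 2 * δ n) := by gcongr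
    _ = η / 2 := by field_simp
    _ < η := half_lt_self hη

/-- The slope of the cutoff produces the average of `F` over `(s, s + δ)`, which tends to `F s` as
`F` is continuous. This yields an identity at every time `s`, not only almost every one; dominated
convergence handles the remaining term. -/
lemma add_integral_eq_of_trapezoid {F g : ℝ → ℝ} {s S c : ℝ} (hs : 0 ≤ s) (hS : s + 1 < S)
    (hF : ContinuousOn F (Icc 0 S)) (hg : IntegrableOn g (Ioo 0 S))
    (H : ∀ δ ∈ Ioc (0 : ℝ) 1, 1 / δ * (∫ τ in Ioo s (s + δ), F τ)
      + ∫ τ in Ioo 0 S, trapezoid s δ τ * g τ = c) :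
    F s + ∫ τ in Ioo 0 s, g τ = c := by
  set δ : ℕ → ℝ := fun n => 1 / ((n : ℝ) + 1)
  have hδ0 : ∀ n, 0 < δ n := fun n => by positivity
  have hδ1 : ∀ n, δ n ≤ 1 := fun n => by
    rw [div_le_one (by positivity)]; linarith [(Nat.cast_nonneg n : (0 : ℝ) ≤ n)]
  have hδ : Tendsto δ atTop (𝓝 0) := tendsto_one_div_add_atTop_nhds_zero_nat
  have h1 := tendsto_average_right (F := F) (s := s) (S := S) (by linarith)
    (hF.mono (Icc_subset_Icc_left hs)) hδ0 hδ
  have h2 : Tendsto (fun n => ∫ τ in Ioo 0 S, trapezoid s (δ n) τ * g τ) atTop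
      (𝓝 (∫ τ in Ioo 0 S, (Iic s).indicator g τ)) := by
    refine tendsto_integral_of_dominated_convergence (fun τ => ‖g τ‖)
      (fun n => (continuous_trapezoid _ _).aestronglyMeasurable.mul hg.1) hg.norm
      (fun n => Eventually.of_forall fun τ => ?_) (Eventually.of_forall fun τ => ?_)
    · rw [norm_mul, Real.norm_of_nonneg (trapezoid_nonneg _ _ _)]
      exact mul_le_of_le_one_left (norm_nonneg _) (trapezoid_le_one _ _ _)
    · rcases le_or_gt τ s with h | h
      · rw [indicator_of_mem (show τ ∈ Iic s from h)]
        simp only [trapezoid_of_le (hδ0 _) h, one_mul]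
        exact tendsto_const_nhds
      · rw [indicator_of_notMem (show τ ∉ Iic s from not_le.2 h)]
        refine tendsto_const_nhds.congr' ?_
        filter_upwards [hδ.eventually_lt_const (show 0 < τ - s by linarith)] with n hn
        rw [trapezoid_of_ge (hδ0 n) (by linarith), zero_mul]
  have h3 : ∫ τ in Ioo 0 S, (Iic s).indicator g τ = ∫ τ in Ioo 0 s, g τ := by
    rw [setIntegral_indicator measurableSet_Iic]
    have : Ioo 0 S ∩ Iic s = Ioc 0 s := by
      ext τ; simp only [mem_inter_iff, mem_Ioo, mem_Iic, mem_Ioc]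
      constructor
      · rintro ⟨⟨h1, -⟩, h2⟩; exact ⟨h1, h2⟩
      · rintro ⟨h1, h2⟩; exact ⟨⟨h1, by linarith⟩, h2⟩
    rw [this, setIntegral_congr_set Ioo_ae_eq_Ioc]
  rw [h3] at h2
  refine tendsto_nhds_unique (h1.add h2) ?_
  refine tendsto_const_nhds.congr fun n => ?_
  exact (H (δ n) ⟨hδ0 n, hδ1 n⟩).symm

/-! ### The weak formulation at a given time -/

lemma IsTest.deriv_eq {φ : ℝ → E3 → E3} (hφ : IsTest φ) (t : ℝ) (x : E3) :
    deriv (fun s => φ s x) t = fderiv ℝ (fun p : ℝ × E3 => φ p.1 p.2) (t, x) (1, 0) := by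
  have h1 := (hφ.smooth.differentiable (by simp) (t, x)).hasFDerivAt.comp_hasDerivAt t
    ((hasDerivAt_id t).prodMk (hasDerivAt_const t x))
  exact h1.deriv

/-- The terms of the weak formulation at time `t`. -/
def nsForm (ν : ℝ) (φ : ℝ → E3 → E3) (u : L2) (t : ℝ) : ℝ :=
  - pairing u (fun x => deriv (fun s => φ s x) t) + ν * viscous u (φ t) + convective u (φ t)

/-- The additional terms due to the correction of the test field. -/
def correctionForm (ν : ℝ) (G : (ℝ × E3) × E3 → E3) (h : ℝ → E3) (u : L2) (t : ℝ) : ℝ :=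
  - pairing u (fun x => fderiv ℝ G ((t, h t), x) ((1, deriv h t), 0))
    + ν * viscous u (fun x => G ((t, h t), x)) + convective u (fun x => G ((t, h t), x))

lemma IsTest.continuous_deriv {φ : ℝ → E3 → E3} (hφ : IsTest φ) :
    Continuous (fun p : ℝ × E3 => deriv (fun s => φ s p.2) p.1) := by
  simp only [hφ.deriv_eq]
  exact continuous_partial_space hφ.smooth (1, 0)

lemma IsTest.hasCompactSupport_deriv {φ : ℝ → E3 → E3} (hφ : IsTest φ) :
    HasCompactSupport (fun p : ℝ × E3 => deriv (fun s => φ s p.2) p.1) := by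
  simp only [hφ.deriv_eq]
  exact hφ.hasCompactSupport.fderiv_apply ℝ _

lemma IsTest.exists_nsForm_bound (ν : ℝ) {φ : ℝ → E3 → E3} (hφ : IsTest φ) :
    ∃ B, 0 ≤ B ∧ ∀ t v, |nsForm ν φ v t| ≤ B * (‖v‖ + gradNorm v + ‖v‖ * gradNorm v) := by
  obtain ⟨B₁, h10, h1⟩ := exists_pairing_bound hφ.continuous_deriv hφ.hasCompactSupport_deriv
  obtain ⟨B₂, h20, h2⟩ := exists_viscous_bound hφ.smooth hφ.hasCompactSupport
  obtain ⟨B₃, h30, h3⟩ := exists_convective_bound hφ.smooth.continuous hφ.hasCompactSupport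
  refine ⟨B₁ + |ν| * B₂ + B₃, by positivity, fun t v => ?_⟩
  have hg := gradNorm_nonneg v
  have hn := norm_nonneg v
  have h4 := h1 t v
  have h5 := h2 t v
  have h6 := h3 t v
  have h7 : |ν * viscous v (φ t)| ≤ |ν| * (B₂ * gradNorm v) := by
    rw [abs_mul]; exact mul_le_mul_of_nonneg_left h5 (abs_nonneg _)
  have h8 : |nsForm ν φ v t| ≤ |pairing v (fun x => deriv (fun s => φ s x) t)|
      + |ν * viscous v (φ t)| + |convective v (φ t)| := by
    refine (abs_add_le _ _).trans (add_le_add ((abs_add_le _ _).trans_eq ?_) le_rfl)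
    rw [abs_neg]
  have hν := abs_nonneg ν
  calc _ ≤ B₁ * ‖v‖ + |ν| * (B₂ * gradNorm v) + B₃ * ‖v‖ * gradNorm v :=
        h8.trans (add_le_add (add_le_add h4 h7) h6)
    _ = B₁ * ‖v‖ + (|ν| * B₂) * gradNorm v + B₃ * (‖v‖ * gradNorm v) := by ring
    _ ≤ (B₁ + |ν| * B₂ + B₃) * ‖v‖ + (B₁ + |ν| * B₂ + B₃) * gradNorm v
        + (B₁ + |ν| * B₂ + B₃) * (‖v‖ * gradNorm v) := by
        have : 0 ≤ |ν| * B₂ := by positivity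
        gcongr <;> linarith
    _ = _ := by ring

lemma IsTest.integrable_nsForm (ν : ℝ) {φ : ℝ → E3 → E3} (hφ : IsTest φ) {u : ℝ → L2} {T C : ℝ}
    (hu : IsRegular u T C) :
    Integrable (fun t => nsForm ν φ (u t) t) (volume.restrict (Ioo 0 T)) := by
  obtain ⟨B, hB0, hB⟩ := hφ.exists_nsForm_bound ν
  have hid : AEStronglyMeasurable (fun t : ℝ => t) (volume.restrict (Ioo 0 T)) :=
    aestronglyMeasurable_id
  have hw := fun i => (hu.memLp i).1
  have hm : AEStronglyMeasurable (fun t => nsForm ν φ (u t) t) (volume.restrict (Ioo 0 T)) :=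
    ((aestronglyMeasurable_pairing hφ.continuous_deriv hφ.hasCompactSupport_deriv hu.meas
      hid).neg.add ((aestronglyMeasurable_viscous hφ.smooth hφ.hasCompactSupport hw
      hid).const_mul ν)).add (aestronglyMeasurable_convective hφ.smooth.continuous
      hφ.hasCompactSupport hu.meas hw hid)
  refine Integrable.mono' (g := fun t => B * (C + gradNorm (u t) + C * gradNorm (u t))) ?_ hm ?_
  · exact (((integrable_const C).add hu.integrable_gradNorm).add
      (hu.integrable_gradNorm.const_mul C)).const_mul _
  · filter_upwards [hu.ae_bound] with t ht
    refine (hB t (u t)).trans (mul_le_mul_of_nonneg_left ?_ hB0)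
    have hg := gradNorm_nonneg (u t)
    gcongr

lemma ae_differentiableAt_of_lipschitzOn {h : ℝ → E3} {K : ℝ≥0} (hh : LipschitzOnWith K h (Ici 0)) :
    ∀ᵐ t ∂(volume.restrict (Ioi (0 : ℝ))), DifferentiableAt ℝ h t := by
  filter_upwards [ae_restrict_of_ae (hh.ae_differentiableWithinAt_of_mem (μ := volume)),
    ae_restrict_mem measurableSet_Ioi] with t ht ht0
  exact (ht (mem_Ici.2 (mem_Ioi.1 ht0).le)).differentiableAt (Ici_mem_nhds ht0)

section Correction

variable {φ : ℝ → E3 → E3} {ε M : ℝ} {G : (ℝ × E3) × E3 → E3}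

lemma IsCorrection.fderiv_outside (hG : IsCorrection φ ε M G) {t : ℝ} {c x : E3}
    (hx : 3 * ε < ‖x - c‖) : fderiv ℝ G ((t, c), x) = 0 := by
  have ho : IsOpen {q : (ℝ × E3) × E3 | 3 * ε < ‖q.2 - q.1.2‖} :=
    isOpen_lt continuous_const (by fun_prop)
  have : G =ᶠ[𝓝 ((t, c), x)] fun _ => 0 := by
    filter_upwards [ho.mem_nhds hx] with q hq
    exact hG.outside q.1.1 q.1.2 q.2 hq
  rw [this.fderiv_eq]; simp

lemma IsCorrection.isTestField (hG : IsCorrection φ ε M G) (p : ℝ × E3) :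
    IsTestField (fun x => G (p, x)) := isTestField_slice hG.smooth hG.compact p

lemma IsCorrection.continuous_time (hG : IsCorrection φ ε M G) (p k : ℝ × E3) :
    Continuous (fun x => fderiv ℝ G (p, x) (k, 0)) :=
  (continuous_partial_space hG.smooth (k, 0)).comp (by fun_prop)

lemma IsCorrection.hasCompactSupport_time (hG : IsCorrection φ ε M G) (p k : ℝ × E3) :
    HasCompactSupport (fun x => fderiv ℝ G (p, x) (k, 0)) :=
  HasCompactSupport.slice (hG.compact.fderiv_apply ℝ (k, 0)) p

/-- The rate at which the contributions of the correction vanish. -/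
def correctionRate (ν M ε m : ℝ) : ℝ :=
  96 * √ballVol * M * (ε * √(ε ^ 3) + m) + |ν| * (8 * √ballVol * (M / ε) * √(ε ^ 3))
    + 12 * M * ε

/-- The three contributions are of order `ε^{5/2} + ε^{3/2} |h'|`, `ε^{1/2}` and `ε`. The first uses
Hardy's inequality against a field of size `1 + |h'| / ε` on a ball of volume of order `ε³`; `m`
stands for a bound on `ε^{3/2} |h'|`. -/
lemma IsCorrection.abs_correctionForm_le (ν : ℝ) (hM : 0 ≤ M) (hε : 0 < ε)
    (hG : IsCorrection φ ε M G)
    {h : ℝ → E3} {t m : ℝ} (hm : √(ε ^ 3) * ‖deriv h t‖ ≤ m) {u : L2} (hu : InH1 u) :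
    |correctionForm ν G h u t| ≤ correctionRate ν M ε m * (gradNorm u + gradNorm u ^ 2) := by
  have hN := gradNorm_nonneg u
  have hm0 : 0 ≤ m := le_trans (by positivity) hm
  have h1 : |pairing u (fun x => fderiv ℝ G ((t, h t), x) ((1, deriv h t), 0))| ≤
      96 * √ballVol * M * (ε * √(ε ^ 3) + m) * gradNorm u := by
    refine (abs_pairing_le_gradNorm hu (c := h t) (B := M * (1 + ‖deriv h t‖ / ε)) hε
      (by positivity) (fun x => hG.bound_time _ _)
      (fun x hx => by rw [hG.fderiv_outside hx]; rfl)).trans ?_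
    refine mul_le_mul_of_nonneg_right ?_ hN
    -- The power of `ε` gained from Hardy's inequality cancels the one under `‖h'‖`.
    calc _ = 96 * √ballVol * M * (ε * √(ε ^ 3) + √(ε ^ 3) * ‖deriv h t‖) := by
          field_simp
      _ ≤ _ := by gcongr
  have h2 : |viscous u (fun x => G ((t, h t), x))| ≤
      8 * √ballVol * (M / ε) * √(ε ^ 3) * gradNorm u := by
    refine abs_viscous_le (hG.isTestField _) (c := h t) hε (by positivity) (fun i x => ?_)
      (fun x hx => hG.outside _ _ _ hx)
    rw [fderiv_slice hG.smooth]
    simpa [norm_e] using hG.bound_space ((t, h t), x) (e i)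
  have h3 : |convective u (fun x => G ((t, h t), x))| ≤ 12 * M * ε * gradNorm u ^ 2 :=
    abs_convective_le_gradNorm hu (hG.isTestField _).continuous (hG.isTestField _).compact
      (c := h t) hε hM (fun x => hG.bound _) (fun x hx => hG.outside _ _ _ hx)
  have h7 : |ν * viscous u (fun x => G ((t, h t), x))|
      ≤ |ν| * (8 * √ballVol * (M / ε) * √(ε ^ 3) * gradNorm u) := by
    rw [abs_mul]; exact mul_le_mul_of_nonneg_left h2 (abs_nonneg _)
  have h8 : |correctionForm ν G h u t|
      ≤ |pairing u (fun x => fderiv ℝ G ((t, h t), x) ((1, deriv h t), 0))|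
      + |ν * viscous u (fun x => G ((t, h t), x))| + |convective u (fun x => G ((t, h t), x))| := by
    refine (abs_add_le _ _).trans (add_le_add ((abs_add_le _ _).trans_eq ?_) le_rfl)
    rw [abs_neg]
  have e1 : 0 ≤ 96 * √ballVol * M * (ε * √(ε ^ 3) + m) := by positivity
  have e2 : 0 ≤ |ν| * (8 * √ballVol * (M / ε) * √(ε ^ 3)) := by positivity
  have e3 : 0 ≤ 12 * M * ε := by positivity
  unfold correctionRate
  set A := 96 * √ballVol * M * (ε * √(ε ^ 3) + m)
  set B := |ν| * (8 * √ballVol * (M / ε) * √(ε ^ 3))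
  set D := 12 * M * ε
  have e4 : |ν| * (8 * √ballVol * (M / ε) * √(ε ^ 3) * gradNorm u) = B * gradNorm u := by
    simp only [B]; ring
  rw [e4] at h7
  have e5 : 0 ≤ gradNorm u ^ 2 := sq_nonneg _
  nlinarith [mul_nonneg e1 e5, mul_nonneg e2 e5, mul_nonneg e3 hN]

lemma IsCorrection.aestronglyMeasurable_correctionForm (ν : ℝ) (hG : IsCorrection φ ε M G)
    {h : ℝ → E3} {K : ℝ≥0} (hh : LipschitzOnWith K h (Ici 0)) {u : ℝ → L2} {T C : ℝ}
    (hu : IsRegular u T C) :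
    AEStronglyMeasurable (fun t => correctionForm ν G h (u t) t) (volume.restrict (Ioo 0 T)) := by
  have hp : AEStronglyMeasurable (fun t => (t, h t)) (volume.restrict (Ioo 0 T)) := by
    refine (ContinuousOn.prodMk continuousOn_id (hh.continuousOn.mono ?_)).aestronglyMeasurable
      measurableSet_Ioo
    exact fun t ht => ht.1.le
  have hw := fun i => (hu.memLp i).1
  have hT : ∀ k : ℝ × E3, AEStronglyMeasurable
      (fun t => pairing (u t) (fun x => fderiv ℝ G ((t, h t), x) (k, 0)))
      (volume.restrict (Ioo 0 T)) := fun k =>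
    aestronglyMeasurable_pairing (continuous_partial_space hG.smooth (k, 0))
      (hG.compact.fderiv_apply ℝ _) hu.meas hp
  have hd : ∀ j, AEStronglyMeasurable (fun t => deriv h t j) (volume.restrict (Ioo 0 T)) :=
    fun j => (coordL j).continuous.comp_aestronglyMeasurable
      (stronglyMeasurable_deriv h).aestronglyMeasurable
  -- The velocity is merely measurable in time, so it cannot be part of a continuous kernel. By
  -- linearity of the differential its coordinates are taken out, and the remaining directions are
  -- constant.
  have hdec : ∀ t, pairing (u t) (fun x => fderiv ℝ G ((t, h t), x) ((1, deriv h t), 0))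
      = pairing (u t) (fun x => fderiv ℝ G ((t, h t), x) ((1, 0), 0))
        + ∑ j, deriv h t j * pairing (u t) (fun x => fderiv ℝ G ((t, h t), x) ((0, e j), 0)) := by
    intro t
    have hk : ((1, deriv h t), (0 : E3))
        = ((1, 0), 0) + ∑ j, deriv h t j • (((0 : ℝ), e j), (0 : E3)) := by
      conv_lhs => rw [E3.eq_sum (deriv h t)]
      simp [Fin.sum_univ_three]
    have hi : ∀ k, Integrable (fun x => inner ℝ (u t x) (fderiv ℝ G ((t, h t), x) (k, 0))) volume :=
      fun k => integrable_inner_cc _ (hG.continuous_time _ k) (hG.hasCompactSupport_time _ k)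
    rw [hk]
    simp only [pairing, map_add, map_sum, map_smul, inner_add_right, inner_sum, inner_smul_right]
    rw [integral_add (hi _) (integrable_finsetSum _ fun j _ => (hi _).const_mul _),
      integral_finsetSum _ fun j _ => (hi _).const_mul _]
    simp only [integral_const_mul]
  have h1 : AEStronglyMeasurable
      (fun t => pairing (u t) (fun x => fderiv ℝ G ((t, h t), x) ((1, deriv h t), 0)))
      (volume.restrict (Ioo 0 T)) := by
    simp only [hdec]
    exact (hT _).add (Finset.aestronglyMeasurable_fun_sum _ fun j _ => (hd j).mul (hT _))
  exact (h1.neg.add ((aestronglyMeasurable_viscous hG.smooth hG.compact hw hp).const_mul ν)).add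
    (aestronglyMeasurable_convective hG.smooth.continuous hG.compact hu.meas hw hp)

lemma IsCorrection.integrable_correctionForm (ν : ℝ) (hM : 0 ≤ M) (hε : 0 < ε)
    (hG : IsCorrection φ ε M G)
    {h : ℝ → E3} {K : ℝ≥0} (hh : LipschitzOnWith K h (Ici 0)) {u : ℝ → L2} {T C : ℝ}
    (hu : IsRegular u T C) {m : ℝ}
    (hm : ∀ᵐ t ∂(volume.restrict (Ioo 0 T)), √(ε ^ 3) * ‖deriv h t‖ ≤ m) :
    Integrable (fun t => correctionForm ν G h (u t) t) (volume.restrict (Ioo 0 T)) := by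
  refine Integrable.mono' (g := fun t => correctionRate ν M ε m
    * (gradNorm (u t) + gradNorm (u t) ^ 2))
    ((hu.integrable_gradNorm.add hu.integrable_gradNorm_sq).const_mul _)
    (hG.aestronglyMeasurable_correctionForm ν hh hu) ?_
  filter_upwards [hm, hu.inH1] with t ht h1
  exact hG.abs_correctionForm_le ν hM hε ht h1

lemma ae_norm_deriv_le_of_lipschitzOn {h : ℝ → E3} {K : ℝ≥0} (hh : LipschitzOnWith K h (Ici 0))
    (T : ℝ) : ∀ᵐ t ∂(volume.restrict (Ioo 0 T)), ‖deriv h t‖ ≤ K := by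
  filter_upwards [ae_restrict_mem measurableSet_Ioo] with t ht
  exact norm_deriv_le_of_lipschitzOn (Ici_mem_nhds ht.1) hh

/-- The weak formulation at time `s`, with a corrected test field. -/
lemma IsCorrection.identity {ν : ℝ} (hφ : IsTest φ) (hM : 0 ≤ M) (hε : 0 < ε)
    (hG : IsCorrection φ ε M G) {h : ℝ → E3} (hh : W1InfOn h (Ici 0)) {u : ℝ → L2} {S C : ℝ}
    (hu : IsRegular u S C) (hwc : WeaklyContinuous u) (hNS : SolvesNSOutsideBall ν ε h u)
    {s : ℝ} (hs : 0 ≤ s) (hS : s + 1 < S) :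
    pairing (u s) (fun x => φ s x + G ((s, h s), x))
      + ∫ t in Ioo 0 s, (nsForm ν φ (u t) t + correctionForm ν G h (u t) t)
    = pairing (u 0) (fun x => φ 0 x + G ((0, h 0), x)) := by
  obtain ⟨-, K, hK⟩ := id hh
  set ψ : ℝ → E3 → E3 := fun t x => φ t x + G ((t, h t), x)
  set F : ℝ → ℝ := fun t => pairing (u t) (ψ t)
  have hφt : ∀ t, IsTestField (φ t) := fun t => isTestField_slice hφ.smooth hφ.hasCompactSupport t
  have hGt : ∀ t, IsTestField (fun x => G ((t, h t), x)) := fun t => hG.isTestField _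
  have hψt : ∀ t, IsTestField (ψ t) := fun t =>
    ⟨(hφt t).smooth.add (hGt t).smooth, (hφt t).compact.add (hGt t).compact⟩
  set ψ' : ℝ → E3 → E3 := fun t x => deriv (fun τ => φ τ x) t
    + fderiv ℝ G ((t, h t), x) ((1, deriv h t), 0)
  have hφ'c : ∀ t, Continuous (fun x => deriv (fun τ => φ τ x) t) := fun t =>
    hφ.continuous_deriv.comp (by fun_prop : Continuous fun x : E3 => (t, x))
  have hφ's : ∀ t, HasCompactSupport (fun x => deriv (fun τ => φ τ x) t) := fun t =>
    HasCompactSupport.slice hφ.hasCompactSupport_deriv t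
  have hψ'c : ∀ t, Continuous (ψ' t) := fun t => (hφ'c t).add (hG.continuous_time _ _)
  have hψ's : ∀ t, HasCompactSupport (ψ' t) := fun t => (hφ's t).add (hG.hasCompactSupport_time _ _)
  set A : ℝ → ℝ := fun t => pairing (u t) (ψ' t)
  set V : ℝ → ℝ := fun t => viscous (u t) (ψ t)
  set Q : ℝ → ℝ := fun t => convective (u t) (ψ t)
  have hsplit : ∀ t, nsForm ν φ (u t) t + correctionForm ν G h (u t) t = - A t + ν * V t + Q t := by
    intro t
    have e1 : A t = _ := pairing_add (u t) (hφ'c t) (hφ's t) (hG.continuous_time (t, h t) (1, deriv h t))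
      (hG.hasCompactSupport_time (t, h t) (1, deriv h t))
    have e2 : V t = _ := viscous_add (u t) (hφt t) (hGt t)
    have e3 : Q t = _ := convective_add (u t) (hφt t).continuous (hφt t).compact
      (hGt t).continuous (hGt t).compact
    rw [e1, e2, e3, nsForm, correctionForm]
    ring
  have hp : AEStronglyMeasurable (fun t => (t, h t)) (volume.restrict (Ioo 0 S)) := by
    refine (ContinuousOn.prodMk continuousOn_id (hK.continuousOn.mono ?_)).aestronglyMeasurable
      measurableSet_Ioo
    exact fun t ht => ht.1.le
  have hid : AEStronglyMeasurable (fun t : ℝ => t) (volume.restrict (Ioo 0 S)) :=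
    aestronglyMeasurable_id
  have hN := hu.integrable_gradNorm
  have hV : IntegrableOn V (Ioo 0 S) := by
    have e2 : ∀ t, V t = viscous (u t) (φ t) + viscous (u t) (fun x => G ((t, h t), x)) :=
      fun t => viscous_add (u t) (hφt t) (hGt t)
    obtain ⟨B₁, -, h1⟩ := exists_viscous_bound hφ.smooth hφ.hasCompactSupport
    obtain ⟨B₂, -, h2⟩ := exists_viscous_bound hG.smooth hG.compact
    refine Integrable.congr (f := fun t => viscous (u t) (φ t)
      + viscous (u t) (fun x => G ((t, h t), x))) (Integrable.add ?_ ?_)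
      (Eventually.of_forall fun t => (e2 t).symm)
    · exact (hN.const_mul B₁).mono' (aestronglyMeasurable_viscous hφ.smooth hφ.hasCompactSupport
        (fun i => (hu.memLp i).1) hid) (Eventually.of_forall fun t => h1 t _)
    · exact (hN.const_mul B₂).mono' (aestronglyMeasurable_viscous hG.smooth hG.compact
        (fun i => (hu.memLp i).1) hp) (Eventually.of_forall fun t => h2 (t, h t) _)
  have hQ : IntegrableOn Q (Ioo 0 S) := by
    have e2 : ∀ t, Q t = convective (u t) (φ t) + convective (u t) (fun x => G ((t, h t), x)) :=
      fun t => convective_add (u t) (hφt t).continuous (hφt t).compact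
      (hGt t).continuous (hGt t).compact
    obtain ⟨B₁, h10, h1⟩ := exists_convective_bound hφ.smooth.continuous hφ.hasCompactSupport
    obtain ⟨B₂, h20, h2⟩ := exists_convective_bound hG.smooth.continuous hG.compact
    refine Integrable.congr (f := fun t => convective (u t) (φ t)
      + convective (u t) (fun x => G ((t, h t), x))) (Integrable.add ?_ ?_)
      (Eventually.of_forall fun t => (e2 t).symm)
    · refine (hN.const_mul (B₁ * C)).mono' (aestronglyMeasurable_convective hφ.smooth.continuous
        hφ.hasCompactSupport hu.meas (fun i => (hu.memLp i).1) hid) ?_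
      filter_upwards [hu.ae_bound] with t ht
      refine (h1 t _).trans ?_
      have := gradNorm_nonneg (u t)
      gcongr
    · refine (hN.const_mul (B₂ * C)).mono' (aestronglyMeasurable_convective hG.smooth.continuous
        hG.compact hu.meas (fun i => (hu.memLp i).1) hp) ?_
      filter_upwards [hu.ae_bound] with t ht
      refine (h2 (t, h t) _).trans ?_
      have := gradNorm_nonneg (u t)
      gcongr
  have hm : ∀ᵐ t ∂(volume.restrict (Ioo 0 S)), √(ε ^ 3) * ‖deriv h t‖ ≤ √(ε ^ 3) * K := by
    filter_upwards [ae_norm_deriv_le_of_lipschitzOn hK S] with t ht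
    gcongr
  have hg : IntegrableOn (fun t => nsForm ν φ (u t) t + correctionForm ν G h (u t) t) (Ioo 0 S) :=
    (hφ.integrable_nsForm ν hu).add (hG.integrable_correctionForm ν hM hε hK hu hm)
  -- This term contains `h'`; its integrability is read off from that of the full sum, already
  -- known, and of the two other terms.
  have hA : IntegrableOn A (Ioo 0 S) := by
    have e1 : A = fun t => ν * V t + Q t
        - (nsForm ν φ (u t) t + correctionForm ν G h (u t) t) := by
      ext t; rw [hsplit]; ring
    rw [e1]
    exact ((hV.const_mul ν).add hQ).sub hg
  -- Weak continuity and boundedness of `u`, paired with a strongly continuous curve in `L²`, the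
  -- centre `h` being continuous.
  have hF : ContinuousOn F (Icc 0 S) := by
    have e1 : ∀ t, F t = inner ℝ (u t) (ccLp (φ t) (hφt t).continuous (hφt t).compact
        + ccLp (fun x => G ((t, h t), x)) (hGt t).continuous (hGt t).compact) := by
      intro t
      rw [inner_add_right, ← pairing_eq_inner, ← pairing_eq_inner]
      exact pairing_add (u t) (hφt t).continuous (hφt t).compact (hGt t).continuous (hGt t).compact
    have e2 : ContinuousOn (fun t => inner ℝ (u t) (ccLp (φ t) (hφt t).continuous (hφt t).compact
        + ccLp (fun x => G ((t, h t), x)) (hGt t).continuous (hGt t).compact)) (Icc 0 S) := by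
      refine hwc.continuousOn_inner hu.bound (ContinuousOn.add ?_ ?_)
      · exact (continuous_ccLp_curve _ hφ.smooth.continuous hφ.hasCompactSupport).continuousOn
      · exact (continuous_ccLp_curve _ hG.smooth.continuous hG.compact).comp_continuousOn
          (f := fun t => (t, h t))
          (continuousOn_id.prodMk (hK.continuousOn.mono Icc_subset_Ici_self))
    exact e2.congr fun t _ => e1 t
  refine add_integral_eq_of_trapezoid (F := F) (c := pairing (u 0) (ψ 0)) hs hS hF hg
    fun δ hδ => ?_
  have hθ := w1InfOn_trapezoid s hδ.1
  set θ := trapezoid s δ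
  -- The equation is tested with the corrected field times the cutoff in time; `s + δ < S` confines
  -- all integrals to `(0, S)`.
  have hid := hNS _ (hG.isExteriorTest hφ hε hh hθ)
  have hid' : - (∫ t in Ioi (0 : ℝ), pairing (u t) (fun x => deriv (fun τ => θ τ • ψ τ x) t))
      + ν * (∫ t in Ioi (0 : ℝ), viscous (u t) (fun x => θ t • ψ t x))
      + (∫ t in Ioi (0 : ℝ), convective (u t) (fun x => θ t • ψ t x))
      = pairing (u 0) (fun x => θ 0 • ψ 0 x) := hid
  have hθ0 : θ 0 = 1 := trapezoid_of_le hδ.1 hs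
  have hsub : Ioo 0 S ⊆ Ioi (0 : ℝ) := fun t ht => ht.1
  have hθS : ∀ t ∈ Ioi (0 : ℝ) \ Ioo 0 S, s + δ < t := by
    rintro t ⟨ht0, ht⟩
    have : S ≤ t := by
      by_contra hc
      exact ht ⟨ht0, not_le.1 hc⟩
    linarith [hδ.2]
  simp only [pairing_smul, convective_smul, viscous_smul _ _ (hψt _), hθ0, one_mul] at hid'
  rw [setIntegral_eq_of_subset_of_forall_sdiff_eq_zero (f := fun t => θ t * viscous (u t) (ψ t))
      measurableSet_Ioi hsub (fun t ht => by
        simp only [θ]; rw [trapezoid_of_ge hδ.1 (hθS t ht).le, zero_mul]),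
    setIntegral_eq_of_subset_of_forall_sdiff_eq_zero (f := fun t => θ t * convective (u t) (ψ t))
      measurableSet_Ioi hsub (fun t ht => by
        simp only [θ]; rw [trapezoid_of_ge hδ.1 (hθS t ht).le, zero_mul]),
    setIntegral_eq_of_subset_of_forall_sdiff_eq_zero
      (f := fun t => pairing (u t) (fun x => deriv (fun τ => θ τ • ψ τ x) t))
      measurableSet_Ioi hsub (fun t ht => by
        have : ∀ x, deriv (fun τ => θ τ • ψ τ x) t = 0 := by
          intro x
          have h1 : (fun τ => θ τ • ψ τ x) =ᶠ[𝓝 t] fun _ => 0 := by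
            filter_upwards [Ioi_mem_nhds (hθS t ht)] with τ hτ
            simp only [θ]; rw [trapezoid_of_ge hδ.1 (le_of_lt hτ), zero_smul]
          rw [h1.deriv_eq]; simp
        simp only [this, pairing, inner_zero_right, integral_zero])] at hid'
  -- Product and chain rules, valid away from the two kinks of the cutoff and from the null set
  -- where the Lipschitz path is not differentiable.
  have hder : ∀ᵐ t ∂(volume.restrict (Ioo 0 S)),
      pairing (u t) (fun x => deriv (fun τ => θ τ • ψ τ x) t)
      = (Ioo s (s + δ)).indicator (fun t => -(1 / δ) * F t) t + θ t * A t := by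
    filter_upwards [ae_restrict_mem measurableSet_Ioo,
      ae_mono (Measure.restrict_mono hsub le_rfl) (ae_differentiableAt_of_lipschitzOn hK),
      ae_restrict_of_ae (Measure.ae_ne volume s),
      ae_restrict_of_ae (Measure.ae_ne volume (s + δ))] with t ht hd h1 h2
    have h3 : ∀ x, deriv (fun τ => θ τ • ψ τ x) t
        = (Ioo s (s + δ)).indicator (fun _ => -(1 / δ)) t • ψ t x + θ t • ψ' t x := by
      intro x
      have d1 : HasDerivAt (fun τ => φ τ x) (deriv (fun τ => φ τ x) t) t := by
        rw [hφ.deriv_eq]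
        exact (hφ.smooth.differentiable (by simp) (t, x)).hasFDerivAt.comp_hasDerivAt t
          ((hasDerivAt_id t).prodMk (hasDerivAt_const t x))
      have d2 : HasDerivAt (fun τ => G ((τ, h τ), x))
          (fderiv ℝ G ((t, h t), x) ((1, deriv h t), 0)) t :=
        (hG.smooth.differentiable (by simp) ((t, h t), x)).hasFDerivAt.comp_hasDerivAt t
          (((hasDerivAt_id t).prodMk hd.hasDerivAt).prodMk (hasDerivAt_const t x))
      have d3 := (hasDerivAt_trapezoid hδ.1 h1 h2).smul (d1.add d2)
      have d4 := d3.deriv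
      rw [add_comm]
      exact d4
    simp only [h3]
    set a := (Ioo s (s + δ)).indicator (fun _ => -(1 / δ)) t with ha
    have e0 : pairing (u t) (fun x => a • ψ t x + θ t • ψ' t x) = _ :=
      pairing_add (u t) (f := fun x => a • ψ t x) (g := fun x => θ t • ψ' t x)
        ((hψt t).continuous.const_smul a) ((hψt t).compact.smul_left (f := fun _ => a))
        ((hψ'c t).const_smul (θ t)) ((hψ's t).smul_left (f := fun _ => θ t))
    rw [e0, pairing_smul, pairing_smul, ha]
    by_cases hm : t ∈ Ioo s (s + δ)
    · simp only [indicator_of_mem hm]; rfl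
    · simp only [indicator_of_notMem hm, zero_mul]; rfl
  rw [integral_congr_ae hder] at hid'
  have hθm : ∀ {f : ℝ → ℝ}, IntegrableOn f (Ioo 0 S) → IntegrableOn (fun t => θ t * f t) (Ioo 0 S) := by
    intro f hf
    refine hf.bdd_mul (c := 1) (continuous_trapezoid _ _).aestronglyMeasurable
      (Eventually.of_forall fun t => ?_)
    rw [Real.norm_of_nonneg (trapezoid_nonneg _ _ _)]
    exact trapezoid_le_one _ _ _
  have hFi : IntegrableOn F (Ioo 0 S) := hF.integrableOn_Icc.mono_set Ioo_subset_Icc_self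
  have hind : IntegrableOn ((Ioo s (s + δ)).indicator (fun t => -(1 / δ) * F t)) (Ioo 0 S) :=
    (hFi.const_mul _).indicator measurableSet_Ioo
  have e1 : ∫ t in Ioo 0 S, ((Ioo s (s + δ)).indicator (fun t => -(1 / δ) * F t) t + θ t * A t)
      = -(1 / δ * ∫ t in Ioo s (s + δ), F t) + ∫ t in Ioo 0 S, θ t * A t := by
    rw [integral_add hind (hθm hA), setIntegral_indicator measurableSet_Ioo,
      inter_eq_self_of_subset_right (Ioo_subset_Ioo hs (by linarith [hδ.2])), integral_const_mul]
    ring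
  have e2 : ∫ t in Ioo 0 S, θ t * (nsForm ν φ (u t) t + correctionForm ν G h (u t) t)
      = - (∫ t in Ioo 0 S, θ t * A t) + ν * (∫ t in Ioo 0 S, θ t * V t)
        + ∫ t in Ioo 0 S, θ t * Q t := by
    have i1 : IntegrableOn (fun t => -(θ t * A t)) (Ioo 0 S) := (hθm hA).neg
    have i2 : IntegrableOn (fun t => ν * (θ t * V t)) (Ioo 0 S) := (hθm hV).const_mul ν
    have i12 : IntegrableOn (fun t => -(θ t * A t) + ν * (θ t * V t)) (Ioo 0 S) := i1.add i2
    rw [← integral_neg, ← integral_const_mul, ← integral_add i1 i2, ← integral_add i12 (hθm hQ)]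
    refine integral_congr_ae (Eventually.of_forall fun t => ?_)
    simp only [hsplit]
    ring
  rw [e1] at hid'
  rw [e2]
  linarith

end Correction

/-! ### Vanishing of the correction as the ball shrinks. -/

lemma sqrt_cube {ε : ℝ} (hε : 0 < ε) : √(ε ^ 3) = ε ^ (3 / 2 : ℝ) := by
  rw [Real.sqrt_eq_rpow, ← Real.rpow_natCast, ← Real.rpow_mul hε.le]
  norm_num

lemma tendsto_sqrt_cube : Tendsto (fun ε : ℝ => √(ε ^ 3)) (𝓝[>] 0) (𝓝 0) := by
  have h : Continuous (fun ε : ℝ => √(ε ^ 3)) := by fun_prop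
  simpa using (h.tendsto 0).mono_left (nhdsWithin_le_nhds (s := Ioi 0))

lemma tendsto_correctionRate (ν M : ℝ) {m : ℝ → ℝ} (hm : Tendsto m (𝓝[>] 0) (𝓝 0)) :
    Tendsto (fun ε => correctionRate ν M ε (m ε)) (𝓝[>] 0) (𝓝 0) := by
  have hid : Tendsto (fun ε : ℝ => ε) (𝓝[>] 0) (𝓝 0) := nhdsWithin_le_nhds
  have h1 := ((hid.mul tendsto_sqrt_cube).add hm).const_mul (96 * √ballVol * M)
  have h2 : Tendsto (fun ε : ℝ => |ν| * (8 * √ballVol * (M / ε) * √(ε ^ 3))) (𝓝[>] 0) (𝓝 0) := by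
    have h : Continuous (fun ε : ℝ => |ν| * (8 * √ballVol * M * √ε)) := by fun_prop
    have h' : Tendsto (fun ε : ℝ => |ν| * (8 * √ballVol * M * √ε)) (𝓝[>] 0) (𝓝 0) := by
      simpa using (h.tendsto 0).mono_left (nhdsWithin_le_nhds (s := Ioi 0))
    refine h'.congr' ?_
    filter_upwards [self_mem_nhdsWithin] with ε hε
    have hε : 0 < ε := hε
    -- The viscous contribution `(M / ε) ε^{3/2}` is `M √ε`.
    have : √(ε ^ 3) = ε * √ε := by
      rw [show ε ^ 3 = ε ^ 2 * ε by ring, Real.sqrt_mul (by positivity), Real.sqrt_sq hε.le]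
    rw [this]
    field_simp
  have h3 := hid.const_mul (12 * M)
  simpa [correctionRate] using (h1.add h2).add h3

/-- The weak formulation at time `t`, tested with `φ`, up to an error which vanishes with the
radius of the ball. -/
lemma exists_approximate_identity {ν ε₀ : ℝ} (hε₀ : 0 < ε₀) {v : ℝ → ℝ → L2} {h : ℝ → ℝ → E3}
    (hspace : ∀ ε ∈ Ioo 0 ε₀, InEnergySpace (v ε)) (hbound : UniformlyBounded ε₀ v)
    (hNS : ∀ ε ∈ Ioo 0 ε₀, SolvesNSOutsideBall ν ε (h ε) (v ε))
    (hh : ∀ ε ∈ Ioo 0 ε₀, W1InfOn (h ε) (Ici 0))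
    (hh' : ∀ T > 0, Tendsto (fun ε : ℝ => eLpNorm (fun t => ε ^ (3 / 2 : ℝ) • deriv (h ε) t) ⊤
      (volume.restrict (Ioo 0 T))) (𝓝[>] 0) (𝓝 0))
    {φ : ℝ → E3 → E3} (hφ : IsTest φ) {T : ℝ} (hT : 0 < T) :
    ∃ rate : ℝ → ℝ, Tendsto rate (𝓝[>] 0) (𝓝 0) ∧ ∀ᶠ ε in 𝓝[>] 0, ∀ t ∈ Icc 0 T,
      |pairing (v ε t) (φ t) - pairing (v ε 0) (φ 0)
        + ∫ τ in Ioo 0 t, nsForm ν φ (v ε τ) τ| ≤ rate ε := by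
  obtain ⟨M, hM, hG⟩ := hφ.exists_correction
  -- The cutoffs in time extend up to one unit beyond `t ≤ T`, strictly inside the interval of
  -- regularity.
  obtain ⟨C, hC0, hC⟩ := hbound.exists_isRegular hspace (T := T + 2) (by linarith)
  set m : ℝ → ℝ := fun ε => (eLpNorm (fun t => ε ^ (3 / 2 : ℝ) • deriv (h ε) t) ⊤
      (volume.restrict (Ioo 0 T))).toReal
  have hm : Tendsto m (𝓝[>] 0) (𝓝 0) := by
    have := (ENNReal.tendsto_toReal ENNReal.zero_ne_top).comp (hh' T hT)
    rwa [ENNReal.toReal_zero] at this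
  -- The first term bounds the time integral of the correction, by `N + N² ≤ 1 + 2 N²` for `N =
  -- gradNorm` and `∫ N² ≤ 9 C²`. The second bounds the pairings with the correction at the two end
  -- times, of order `ε^{3/2}` by the volume of its support.
  refine ⟨fun ε => correctionRate ν M ε (m ε) * (T + 18 * C ^ 2)
    + 2 * (8 * √ballVol * M * √(ε ^ 3) * C), ?_, ?_⟩
  · have h1 := (tendsto_correctionRate ν M hm).mul_const (T + 18 * C ^ 2)
    have h2 := ((tendsto_sqrt_cube.const_mul (8 * √ballVol * M)).mul_const C).const_mul 2
    simpa using h1.add h2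
  · filter_upwards [Ioo_mem_nhdsGT hε₀, Ioc_mem_nhdsGT zero_lt_one,
      (hh' T hT).eventually_lt_const ENNReal.zero_lt_top] with ε hε hε1 hfin t ht
    obtain ⟨G, hG⟩ := hG ε hε1
    have hreg := hC ε hε
    obtain ⟨-, K, hK⟩ := hh ε hε
    have hid := hG.identity hφ hM hε.1 (hh ε hε) hreg (hspace ε hε).weaklyContinuous (hNS ε hε)
      ht.1 (by linarith [ht.2])
    have hrt : IsRegular (v ε) t C := hreg.mono (by linarith [ht.2])
    have hmt : ∀ᵐ τ ∂(volume.restrict (Ioo 0 t)), √(ε ^ 3) * ‖deriv (h ε) τ‖ ≤ m ε := by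
      refine ae_mono (Measure.restrict_mono (Ioo_subset_Ioo_right ht.2) le_rfl) ?_
      have := ae_le_eLpNormEssSup (f := fun t => ε ^ (3 / 2 : ℝ) • deriv (h ε) t)
        (μ := volume.restrict (Ioo 0 T))
      filter_upwards [this] with τ hτ
      rw [← eLpNorm_exponent_top] at hτ
      have h1 := ENNReal.toReal_mono hfin.ne hτ
      rw [toReal_enorm, norm_smul, Real.norm_of_nonneg (Real.rpow_nonneg hε.1.le _)] at h1
      rw [sqrt_cube hε.1]
      exact h1
    have hφt : ∀ t, IsTestField (φ t) := fun t => isTestField_slice hφ.smooth hφ.hasCompactSupport t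
    have hGt : ∀ t, IsTestField (fun x => G ((t, h ε t), x)) := fun t => hG.isTestField _
    have hp : ∀ t, pairing (v ε t) (fun x => φ t x + G ((t, h ε t), x)) = _ := fun t =>
      pairing_add (v ε t) (hφt t).continuous (hφt t).compact (hGt t).continuous (hGt t).compact
    have hcorr : Integrable (fun τ => correctionForm ν G (h ε) (v ε τ) τ)
        (volume.restrict (Ioo 0 t)) := hG.integrable_correctionForm ν hM hε.1 hK hrt hmt
    rw [hp, hp, integral_add (hφ.integrable_nsForm ν hrt) hcorr] at hid
    have hb : ∀ s ∈ Icc 0 T, |pairing (v ε s) (fun x => G ((s, h ε s), x))|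
        ≤ 8 * √ballVol * M * √(ε ^ 3) * C := by
      intro s hs
      refine (abs_pairing_le (v ε s) (c := h ε s) hε.1 hM (fun x => hG.bound _)
        (fun x hx => hG.outside _ _ _ hx)).trans ?_
      exact mul_le_mul_of_nonneg_left (hreg.bound s ⟨hs.1, by linarith [hs.2]⟩) (by positivity)
    have hm0 : 0 ≤ m ε := ENNReal.toReal_nonneg
    have hε0 := hε.1
    have hr0 : 0 ≤ correctionRate ν M ε (m ε) := by
      unfold correctionRate; positivity
    have hI : |∫ τ in Ioo 0 t, correctionForm ν G (h ε) (v ε τ) τ|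
        ≤ correctionRate ν M ε (m ε) * (T + 18 * C ^ 2) := by
      have h1 : |∫ τ in Ioo 0 t, correctionForm ν G (h ε) (v ε τ) τ|
          ≤ ∫ τ in Ioo 0 t, correctionRate ν M ε (m ε) * (1 + 2 * gradNorm (v ε τ) ^ 2) := by
        have i0 : Integrable (fun τ => correctionRate ν M ε (m ε)
            * (1 + 2 * gradNorm (v ε τ) ^ 2)) (volume.restrict (Ioo 0 t)) :=
          ((integrable_const (1 : ℝ)).add (hrt.integrable_gradNorm_sq.const_mul 2)).const_mul _
        rw [← Real.norm_eq_abs]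
        refine norm_integral_le_of_norm_le i0 ?_
        filter_upwards [hmt, hrt.inH1] with τ h2 h3
        refine (hG.abs_correctionForm_le ν hM hε.1 h2 h3).trans
          (mul_le_mul_of_nonneg_left ?_ hr0)
        nlinarith [sq_nonneg (gradNorm (v ε τ) - 1)]
      refine h1.trans ?_
      rw [integral_const_mul]
      refine mul_le_mul_of_nonneg_left ?_ hr0
      have h2 : ∫ τ in Ioo 0 t, (1 + 2 * gradNorm (v ε τ) ^ 2)
          = t + 2 * ∫ τ in Ioo 0 t, gradNorm (v ε τ) ^ 2 := by
        rw [integral_add (integrable_const _) (hrt.integrable_gradNorm_sq.const_mul 2),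
          integral_const_mul, setIntegral_const]
        simp [ht.1]
      rw [h2]
      linarith [hrt.integral_gradNorm_sq_le, ht.2]
    have h1 := abs_le.1 (hb t ht)
    have h2 := abs_le.1 (hb 0 ⟨le_rfl, hT.le⟩)
    have h3 := abs_le.1 hI
    rw [abs_le]
    change pairing (v ε t) (φ t) + pairing (v ε t) (fun x => G ((t, h ε t), x)) + _
      = pairing (v ε 0) (φ 0) + pairing (v ε 0) (fun x => G ((0, h ε 0), x)) at hid
    constructor <;> linarith [h1.1, h1.2, h2.1, h2.2, h3.1, h3.2]

/-! ### Approximate solutions and equicontinuity in time. -/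

/-- A sequence of divergence free fields, bounded in the energy space, which satisfy the weak
formulation of the Navier-Stokes equations up to a vanishing error. -/
structure IsApproximateSolution (ν : ℝ) (u : ℕ → ℝ → L2) (v₀ : L2) : Prop where
  regular : ∀ T > 0, ∃ C, 0 ≤ C ∧ ∀ n, IsRegular (u n) T C
  divFree : ∀ n, ∀ t ≥ 0, WeakDivFree (u n t)
  initial : ∀ g, Tendsto (fun n => inner ℝ (u n 0) g) atTop (𝓝 (inner ℝ v₀ g))
  identity : ∀ φ, IsTest φ → ∀ T > 0, ∃ r : ℕ → ℝ, Tendsto r atTop (𝓝 0) ∧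
    ∀ᶠ n in atTop, ∀ t ∈ Icc 0 T, |pairing (u n t) (φ t) - pairing (u n 0) (φ 0)
      + ∫ τ in Ioo 0 t, nsForm ν φ (u n τ) τ| ≤ r n

lemma IsApproximateSolution.comp {ν : ℝ} {u : ℕ → ℝ → L2} {v₀ : L2}
    (hu : IsApproximateSolution ν u v₀) {k : ℕ → ℕ} (hk : StrictMono k) :
    IsApproximateSolution ν (fun n => u (k n)) v₀ where
  regular T hT := by
    obtain ⟨C, hC, h⟩ := hu.regular T hT
    exact ⟨C, hC, fun n => h (k n)⟩
  divFree n := hu.divFree (k n)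
  initial g := (hu.initial g).comp hk.tendsto_atTop
  identity φ hφ T hT := by
    obtain ⟨r, hr, h⟩ := hu.identity φ hφ T hT
    exact ⟨fun n => r (k n), hr.comp hk.tendsto_atTop, hk.tendsto_atTop.eventually h⟩

lemma isTest_smul {κ : ℝ → ℝ} (hκ : ContDiff ℝ ∞ κ) (hκc : HasCompactSupport κ) {ψ : E3 → E3}
    (hψ : IsSolenoidal ψ) : IsTest (fun t x => κ t • ψ x) where
  smooth := (hκ.comp contDiff_fst).smul (hψ.smooth.comp contDiff_snd)
  hasCompactSupport := by
    refine HasCompactSupport.of_support_subset_isCompact (hκc.isCompact.prod hψ.compact.isCompact) ?_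
    intro p hp
    have h : κ p.1 • ψ p.2 ≠ 0 := hp
    exact ⟨subset_tsupport _ fun h0 => h (by rw [h0, zero_smul]),
      subset_tsupport _ fun h0 => h (by rw [h0, smul_zero])⟩
  divFree t _ x := by
    have h := hψ.divFree x
    unfold div at h ⊢
    rw [fderiv_fun_const_smul (hψ.smooth.differentiable (by simp) x)]
    simp only [_root_.smul_apply, PiLp.smul_apply, smul_eq_mul, ← Finset.mul_sum, h,
      mul_zero]

lemma exists_isTest_of_isSolenoidal {ψ : E3 → E3} (hψ : IsSolenoidal ψ) {T : ℝ} (hT : 0 < T) :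
    ∃ φ, IsTest φ ∧ ∀ t ∈ Icc 0 T, φ t = ψ := by
  let κ : ContDiffBump (0 : ℝ) := ⟨T, T + 1, hT, by linarith⟩
  refine ⟨_, isTest_smul (κ := κ) κ.contDiff κ.hasCompactSupport hψ, fun t ht => ?_⟩
  have h1 : κ t = 1 := κ.one_of_mem_closedBall (by
    rw [mem_closedBall_zero_iff, Real.norm_of_nonneg ht.1]; exact ht.2)
  ext1 x
  rw [h1, one_smul]

/-- Equicontinuity in time of the duality with a solenoidal field. -/
lemma IsApproximateSolution.equicontinuous {ν : ℝ} {u : ℕ → ℝ → L2} {v₀ : L2}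
    (hu : IsApproximateSolution ν u v₀) {ψ : E3 → E3} (hψ : IsSolenoidal ψ) {T : ℝ} (hT : 0 < T)
    {κ : ℝ} (hκ : 0 < κ) :
    ∃ d > 0, ∀ᶠ n in atTop, ∀ s ∈ Icc 0 T, ∀ t ∈ Icc 0 T, |t - s| ≤ d →
      |inner ℝ (u n t) hψ.toL2 - inner ℝ (u n s) hψ.toL2| ≤ κ := by
  -- A test field that is constant in time on `[0, T]` turns the approximate identity into a formula
  -- for the increments of the pairing with `ψ`.
  obtain ⟨φ, hφ, hφψ⟩ := exists_isTest_of_isSolenoidal hψ hT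
  obtain ⟨C, hC0, hC⟩ := hu.regular T hT
  obtain ⟨B, hB0, hB⟩ := hφ.exists_nsForm_bound ν
  obtain ⟨r, hr, hid⟩ := hu.identity φ hφ T hT
  -- The integrand is linear in `N = gradNorm`, and `N ≤ 1/η + η N²`. The choice of `η` makes the
  -- contribution of `η N²` at most `κ / 4`, whatever the interval; the rest is at most `L` times
  -- its length. The two errors of the approximate identity account for the other `κ / 2`.
  set η : ℝ := κ / (4 * (B * (1 + C) * (9 * C ^ 2) + 1))
  have hη : 0 < η := by positivity
  have hη1 : B * (1 + C) * η * (9 * C ^ 2) ≤ κ / 4 := by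
    have : B * (1 + C) * η * (9 * C ^ 2)
        = κ / 4 * (B * (1 + C) * (9 * C ^ 2) / (B * (1 + C) * (9 * C ^ 2) + 1)) := by
      simp only [η]; field_simp
    rw [this]
    refine mul_le_of_le_one_right (by positivity) ?_
    rw [div_le_one (by positivity)]
    linarith
  set L : ℝ := B * (C + (1 + C) * (1 / η))
  have hL : 0 ≤ L := by positivity
  refine ⟨κ / (4 * (L + 1)), by positivity, ?_⟩
  filter_upwards [hid, hr.eventually_lt_const (show 0 < κ / 4 by positivity)] with n hn hrn
  have key : ∀ s ∈ Icc 0 T, ∀ t ∈ Icc 0 T, s ≤ t → t - s ≤ κ / (4 * (L + 1)) →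
      |inner ℝ (u n t) hψ.toL2 - inner ℝ (u n s) hψ.toL2| ≤ κ := by
    intro s hs t ht hst hd
    have h1 := hn t ht
    have h2 := hn s hs
    rw [hφψ t ht] at h1
    rw [hφψ s hs] at h2
    rw [hψ.toIsTestField.inner_toL2, hψ.toIsTestField.inner_toL2]
    change |pairing (u n t) ψ - pairing (u n s) ψ| ≤ κ
    have hregT := hC n
    have hregt := hregT.mono ht.2
    have hint := hφ.integrable_nsForm ν hregt
    have hsub : Ioo 0 s ⊆ Ioo 0 t := Ioo_subset_Ioo_right hst
    set A := Ioo 0 t \ Ioo 0 s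
    have hAm : MeasurableSet A := measurableSet_Ioo.diff measurableSet_Ioo
    have hA : A ⊆ Ioo 0 t := sdiff_subset
    have hAT : A ⊆ Ioo 0 T := hA.trans (Ioo_subset_Ioo_right ht.2)
    have h3 : (∫ τ in A, nsForm ν φ (u n τ) τ) = (∫ τ in Ioo 0 t, nsForm ν φ (u n τ) τ)
        - ∫ τ in Ioo 0 s, nsForm ν φ (u n τ) τ :=
      setIntegral_sdiff measurableSet_Ioo hint hsub
    have hvol : volume.real A ≤ t - s := by
      rw [← Real.volume_real_Icc_of_le hst]
      refine measureReal_mono (fun τ hτ => ?_) measure_Icc_lt_top.ne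
      exact ⟨by by_contra hc; exact hτ.2 ⟨hτ.1.1, not_le.1 hc⟩, hτ.1.2.le⟩
    have hfin : volume A ≠ ⊤ := ((measure_mono hA).trans_lt measure_Ioo_lt_top).ne
    have hN2 : IntegrableOn (fun τ => gradNorm (u n τ) ^ 2) A :=
      IntegrableOn.mono_set hregT.integrable_gradNorm_sq hAT
    have i2 : IntegrableOn (fun τ => L + B * (1 + C) * η * gradNorm (u n τ) ^ 2) A :=
      (integrableOn_const (C := L) hfin).add (hN2.const_mul _)
    have h4 : |∫ τ in A, nsForm ν φ (u n τ) τ|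
        ≤ ∫ τ in A, (L + B * (1 + C) * η * gradNorm (u n τ) ^ 2) := by
      rw [← Real.norm_eq_abs]
      refine norm_integral_le_of_norm_le i2 ?_
      filter_upwards [ae_restrict_mem hAm] with τ hτ
      have hb := hregT.bound τ ⟨(hAT hτ).1.le, (hAT hτ).2.le⟩
      have hg := gradNorm_nonneg (u n τ)
      have hg2 : gradNorm (u n τ) ≤ 1 / η + η * gradNorm (u n τ) ^ 2 := by
        have : 0 ≤ (1 - η * gradNorm (u n τ)) ^ 2 + η * gradNorm (u n τ) := by positivity
        have h5 : gradNorm (u n τ) * η ≤ (1 / η + η * gradNorm (u n τ) ^ 2) * η := by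
          have : (1 / η + η * gradNorm (u n τ) ^ 2) * η = 1 + (η * gradNorm (u n τ)) ^ 2 := by
            field_simp
          rw [this]; linarith
        exact le_of_mul_le_mul_right h5 hη
      calc |nsForm ν φ (u n τ) τ|
          ≤ B * (‖u n τ‖ + gradNorm (u n τ) + ‖u n τ‖ * gradNorm (u n τ)) := hB _ _
        _ ≤ B * (C + (1 + C) * gradNorm (u n τ)) := by
            refine mul_le_mul_of_nonneg_left ?_ hB0
            nlinarith [mul_le_mul_of_nonneg_right hb hg]
        _ ≤ B * (C + (1 + C) * (1 / η + η * gradNorm (u n τ) ^ 2)) := by gcongr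
        _ = _ := by simp only [L]; ring
    have h4' : ∫ τ in A, B * (1 + C) * η * gradNorm (u n τ) ^ 2
        = B * (1 + C) * η * ∫ τ in A, gradNorm (u n τ) ^ 2 := integral_const_mul _ _
    rw [integral_add (integrableOn_const (C := L) hfin) (hN2.const_mul _), h4',
      setIntegral_const, smul_eq_mul] at h4
    have h5 : ∫ τ in A, gradNorm (u n τ) ^ 2 ≤ 9 * C ^ 2 :=
      (setIntegral_mono_set hregT.integrable_gradNorm_sq
        (Eventually.of_forall fun τ => sq_nonneg _) hAT.eventuallyLE).trans
        hregT.integral_gradNorm_sq_le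
    have h6 : B * (1 + C) * η * ∫ τ in A, gradNorm (u n τ) ^ 2 ≤ κ / 4 :=
      (mul_le_mul_of_nonneg_left h5 (by positivity)).trans hη1
    have h7 : volume.real A * L ≤ κ / 4 := by
      calc volume.real A * L ≤ κ / (4 * (L + 1)) * (L + 1) :=
            mul_le_mul (hvol.trans hd) (by linarith) hL (by positivity)
        _ = κ / 4 := by field_simp
    rw [h3] at h4
    have h8 := abs_le.1 (h4.trans (add_le_add h7 h6))
    rw [abs_le] at h1 h2 ⊢
    constructor <;> linarith [h1.1, h1.2, h2.1, h2.2, h8.1, h8.2]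
  intro s hs t ht hd
  rcases le_total s t with h | h
  · exact key s hs t ht h ((le_abs_self _).trans hd)
  · rw [abs_sub_comm]
    exact key t ht s hs h (((le_abs_self _).trans_eq (abs_sub_comm _ _)).trans hd)

/-! ### Weak compactness at every time. -/

/-- The gradients of test functions are test fields. -/
def IsGradient (g : L2) : Prop :=
  ∃ ψ : E3 → ℝ, ContDiff ℝ ∞ ψ ∧ HasCompactSupport ψ ∧
    ∃ h : IsTestField (fun x => ∑ i, fderiv ℝ ψ x (e i) • e i), g = h.toL2

lemma weakDivFree_iff_isGradient {u : L2} :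
    WeakDivFree u ↔ ∀ g, IsGradient g → inner ℝ u g = 0 := by
  rw [weakDivFree_iff]
  constructor
  · rintro H g ⟨ψ, h1, h2, h, rfl⟩
    exact H ψ h1 h2 h
  · intro H ψ h1 h2 h
    exact H _ ⟨ψ, h1, h2, h, rfl⟩

/-- A closed subspace which contains the solenoidal fields and the gradients is everything. -/
lemma eq_top_of_solenoidal_of_gradient {Y : Submodule ℝ L2} (hY : IsClosed (Y : Set L2))
    (hS : ∀ ψ (h : IsSolenoidal ψ), h.toL2 ∈ Y) (hG : ∀ g, IsGradient g → g ∈ Y) : Y = ⊤ := by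
  have : CompleteSpace Y := hY.completeSpace_coe
  rw [← Submodule.orthogonal_eq_bot_iff, Submodule.eq_bot_iff]
  intro y hy
  rw [Submodule.mem_orthogonal'] at hy
  exact eq_zero_of_orthogonal_solenoidal
    (weakDivFree_iff_isGradient.2 fun g hg => hy g (hG g hg)) fun ψ h => hy _ (hS ψ h)

/-- Separability of `L²` passes to the subset of solenoidal test fields, so the dense sequence
consists of test fields to which the equation applies. -/
lemma exists_dense_solenoidal :
    ∃ ψ : ℕ → E3 → E3, ∃ hψ : ∀ j, IsSolenoidal (ψ j),
      ∀ χ (hχ : IsSolenoidal χ), hχ.toL2 ∈ closure (range fun j => (hψ j).toL2) := by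
  have : Fact ((2 : ℝ≥0∞) ≠ ⊤) := ⟨by norm_num⟩
  set S : Set L2 := {g | ∃ ψ, ∃ h : IsSolenoidal ψ, g = h.toL2}
  have h0 : IsSolenoidal (fun _ : E3 => (0 : E3)) :=
    ⟨⟨contDiff_const, HasCompactSupport.zero⟩, fun x => by simp [div]⟩
  have : Nonempty S := ⟨⟨h0.toL2, _, h0, rfl⟩⟩
  choose ψ hψ hψe using fun j => (TopologicalSpace.denseSeq S j).2
  refine ⟨ψ, hψ, fun χ hχ => ?_⟩
  have h1 := TopologicalSpace.denseRange_denseSeq S ⟨hχ.toL2, χ, hχ, rfl⟩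
  have h2 := image_closure_subset_closure_image continuous_subtype_val (mem_image_of_mem _ h1)
  rw [← range_comp] at h2
  refine closure_mono ?_ h2
  rintro _ ⟨j, rfl⟩
  exact ⟨j, (hψe j).symm⟩

/-- Diagonal extraction, as sequential compactness of a countable product of compact intervals. -/
lemma exists_subseq_tendsto_real {I : Type*} [Countable I] (f : ℕ → I → ℝ)
    (hf : ∀ i, ∃ b, ∀ n, |f n i| ≤ b) :
    ∃ k : ℕ → ℕ, StrictMono k ∧ ∀ i, ∃ l, Tendsto (fun n => f (k n) i) atTop (𝓝 l) := by
  choose b hb using hf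
  obtain ⟨a, -, k, hk, ha⟩ := (isCompact_univ_pi fun i => isCompact_Icc (a := -b i)
    (b := b i)).tendsto_subseq (x := f) fun n i _ => abs_le.1 (hb i n)
  exact ⟨k, hk, fun i => ⟨a i, tendsto_pi_nhds.1 ha i⟩⟩

/-- The subsequence is extracted for rational times and a countable family of solenoidal fields.
Equicontinuity extends the convergence to all times, boundedness to all solenoidal fields; against
gradients the pairings vanish. At each time the vectors against which the sequence converges form a
closed subspace containing both families, hence everything. -/
lemma IsApproximateSolution.exists_subseq_weak {ν : ℝ} {u : ℕ → ℝ → L2} {v₀ : L2}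
    (hu : IsApproximateSolution ν u v₀) :
    ∃ k : ℕ → ℕ, StrictMono k ∧ ∀ t ≥ 0, ∃ w, ∀ g,
      Tendsto (fun n => inner ℝ (u (k n) t) g) atTop (𝓝 (inner ℝ w g)) := by
  obtain ⟨ψ, hψ, hdense⟩ := exists_dense_solenoidal
  obtain ⟨k, hk, hlim⟩ := exists_subseq_tendsto_real
    -- The absolute value makes every rational a legitimate time, so that `ℚ × ℕ` can serve as the
    -- index set.
    (fun n (p : ℚ × ℕ) => inner ℝ (u n |(p.1 : ℝ)|) (hψ p.2).toL2) (by
      rintro ⟨q, j⟩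
      obtain ⟨C, hC0, hC⟩ := hu.regular (|(q : ℝ)| + 1) (by positivity)
      refine ⟨C * ‖(hψ j).toL2‖, fun n => (abs_real_inner_le_norm _ _).trans ?_⟩
      exact mul_le_mul_of_nonneg_right ((hC n).bound _ ⟨abs_nonneg _, by linarith⟩)
        (norm_nonneg _))
  refine ⟨k, hk, fun t ht => ?_⟩
  have huk := hu.comp hk
  obtain ⟨C, hC0, hC⟩ := huk.regular (t + 1) (by linarith)
  have hb : ∀ n, ‖u (k n) t‖ ≤ C := fun n => (hC n).bound t ⟨ht, by linarith⟩
  have hcl := isClosed_convSubmodule (fun n => u (k n) t) C hb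
  have htop : convSubmodule (fun n => u (k n) t) = ⊤ := by
    refine eq_top_of_solenoidal_of_gradient hcl (fun χ hχ => ?_) fun g hg => ?_
    · refine closure_minimal ?_ hcl (hdense χ hχ)
      rintro _ ⟨j, rfl⟩
      refine cauchySeq_tendsto_of_complete ?_
      rw [Metric.cauchySeq_iff']
      intro η hη
      -- Three-term estimate: `t` is compared with a nearby rational `q` at both indices, `η / 6`
      -- each, and the pairings at `q` differ by less than `η / 2`.
      obtain ⟨d, hd, hev⟩ := huk.equicontinuous (hψ j) (T := t + 1) (by linarith)
        (show 0 < η / 6 by positivity)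
      obtain ⟨q, hq1, hq2⟩ := exists_rat_btwn (show t < t + min d 1 by
        have := lt_min hd one_pos; linarith)
      have hq0 : (0 : ℝ) ≤ q := ht.trans hq1.le
      obtain ⟨l, hl⟩ := hlim (q, j)
      simp only [abs_of_nonneg hq0] at hl
      obtain ⟨N₁, hN₁⟩ := Metric.cauchySeq_iff.1 hl.cauchySeq (η / 2) (by positivity)
      obtain ⟨N₂, hN₂⟩ := eventually_atTop.1 hev
      refine ⟨max N₁ N₂, fun n hn => ?_⟩
      have e1 : |(q : ℝ) - t| ≤ d := by
        rw [abs_of_pos (by linarith)]; linarith [min_le_left d 1]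
      have hqT : (q : ℝ) ∈ Icc 0 (t + 1) := ⟨hq0, by linarith [min_le_right d 1]⟩
      have a1 := hN₂ n ((le_max_right _ _).trans hn) t ⟨ht, by linarith⟩ q hqT e1
      have a2 := hN₂ (max N₁ N₂) (le_max_right _ _) t ⟨ht, by linarith⟩ q hqT e1
      have a3 := hN₁ n ((le_max_left _ _).trans hn) (max N₁ N₂) (le_max_left _ _)
      rw [Real.dist_eq] at a3 ⊢
      rw [abs_le] at a1 a2
      rw [abs_lt] at a3 ⊢
      constructor <;> linarith [a1.1, a1.2, a2.1, a2.2, a3.1, a3.2]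
    · refine ⟨0, tendsto_const_nhds.congr fun n => ?_⟩
      exact (weakDivFree_iff_isGradient.1 (huk.divFree n t ht) g hg).symm
  obtain ⟨w, -, hw⟩ := exists_weak_limit (fun n => u (k n) t) C hb fun g => by
    have : g ∈ convSubmodule (fun n => u (k n) t) := by rw [htop]; trivial
    exact this
  exact ⟨w, hw⟩

lemma norm_le_of_weak_limit {H : Type*} [NormedAddCommGroup H] [InnerProductSpace ℝ H]
    {z : ℕ → H} {w : H} {C : ℝ} (hC : ∀ᶠ n in atTop, ‖z n‖ ≤ C)
    (hz : Tendsto (fun n => inner ℝ (z n) w) atTop (𝓝 (inner ℝ w w))) : ‖w‖ ≤ C := by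
  have h1 : ‖w‖ * ‖w‖ ≤ C * ‖w‖ := by
    rw [← real_inner_self_eq_norm_mul_norm]
    refine le_of_tendsto hz ?_
    filter_upwards [hC] with n hn
    exact (real_inner_le_norm _ _).trans (mul_le_mul_of_nonneg_right hn (norm_nonneg _))
  rcases (norm_nonneg w).eq_or_lt with h | h
  · obtain ⟨n, hn⟩ := hC.exists
    rw [← h]; exact (norm_nonneg _).trans hn
  · exact le_of_mul_le_mul_right h1 h

/-- Weak convergence in `L²` at every time. -/
def WeakAtEveryTime (u : ℕ → ℝ → L2) (w : ℝ → L2) : Prop :=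
  ∀ t ≥ 0, ∀ g, Tendsto (fun n => inner ℝ (u n t) g) atTop (𝓝 (inner ℝ (w t) g))

section Limit

variable {ν : ℝ} {u : ℕ → ℝ → L2} {v₀ : L2} {w : ℝ → L2}

lemma IsApproximateSolution.exists_bound_limit (hu : IsApproximateSolution ν u v₀)
    (hw : WeakAtEveryTime u w) {T : ℝ} (hT : 0 < T) :
    ∃ C, 0 ≤ C ∧ (∀ n, IsRegular (u n) T C) ∧ ∀ t ∈ Icc 0 T, ‖w t‖ ≤ C := by
  obtain ⟨C, hC0, hC⟩ := hu.regular T hT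
  exact ⟨C, hC0, hC, fun t ht => norm_le_of_weak_limit
    (Eventually.of_forall fun n => (hC n).bound t ht) (hw t ht.1 _)⟩

lemma IsApproximateSolution.limit_divFree (hu : IsApproximateSolution ν u v₀)
    (hw : WeakAtEveryTime u w) {t : ℝ} (ht : 0 ≤ t) : WeakDivFree (w t) := by
  rw [weakDivFree_iff_isGradient]
  intro g hg
  refine tendsto_nhds_unique (hw t ht g) (tendsto_const_nhds.congr fun n => ?_)
  exact (weakDivFree_iff_isGradient.1 (hu.divFree n t ht) g hg).symm

lemma IsApproximateSolution.limit_zero (hu : IsApproximateSolution ν u v₀)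
    (hw : WeakAtEveryTime u w) : w 0 = v₀ :=
  ext_inner_right ℝ fun g => tendsto_nhds_unique (hw 0 le_rfl g) (hu.initial g)

/-- The modulus of continuity in `equicontinuous` does not depend on the index, so it survives in
the limit for solenoidal fields; against gradients the pairing is identically zero. The fields `g`
giving a continuous pairing form a subspace, closed because `w` is bounded, and hence are all of
`L²`. -/
lemma IsApproximateSolution.limit_weaklyContinuous (hu : IsApproximateSolution ν u v₀)
    (hw : WeakAtEveryTime u w) : WeaklyContinuous w := by
  have hT : ∀ T > 0, ∀ g, ContinuousOn (fun t => inner ℝ (w t) g) (Icc 0 T) := by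
    intro T hT
    obtain ⟨C, hC0, -, hC⟩ := hu.exists_bound_limit hw hT
    let Y : Submodule ℝ L2 :=
      { carrier := {g | ContinuousOn (fun t => inner ℝ (w t) g) (Icc 0 T)}
        add_mem' := fun {a b} ha hb => by
          have h : ContinuousOn (fun t => inner ℝ (w t) a + inner ℝ (w t) b) (Icc 0 T) :=
            ContinuousOn.add ha hb
          simpa only [Set.mem_ofPred_eq, inner_add_right] using h
        zero_mem' := by simpa using continuousOn_const
        smul_mem' := fun c a ha => by
          have h : ContinuousOn (fun t => c * inner ℝ (w t) a) (Icc 0 T) :=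
            ContinuousOn.const_smul ha c
          simpa only [Set.mem_ofPred_eq, inner_smul_right] using h }
    have hY : IsClosed (Y : Set L2) := by
      refine isClosed_of_closure_subset fun g hg => ?_
      refine continuousOn_of_uniform_approx_of_continuousOn fun U hU => ?_
      obtain ⟨η, hη, hηU⟩ := Metric.mem_uniformity_dist.1 hU
      obtain ⟨g', hg', hgg⟩ := Metric.mem_closure_iff.1 hg (η / (C + 1)) (by positivity)
      refine ⟨_, hg', fun t ht => hηU ?_⟩
      rw [Real.dist_eq, ← inner_sub_right]
      refine (abs_real_inner_le_norm _ _).trans_lt ?_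
      rw [← dist_eq_norm]
      calc ‖w t‖ * dist g g' ≤ C * dist g g' :=
            mul_le_mul_of_nonneg_right (hC t ht) dist_nonneg
        _ ≤ (C + 1) * dist g g' := by
            have : 0 ≤ dist g g' := dist_nonneg
            linarith
        _ < (C + 1) * (η / (C + 1)) := by gcongr
        _ = η := by field_simp
    have htop : Y = ⊤ := by
      refine eq_top_of_solenoidal_of_gradient hY (fun ψ hψ => ?_) fun g hg => ?_
      · refine Metric.continuousOn_iff.2 fun s hs η hη => ?_
        obtain ⟨d, hd, hev⟩ := hu.equicontinuous hψ hT (show 0 < η / 2 by positivity)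
        refine ⟨d, hd, fun t ht hts => lt_of_le_of_lt ?_ (half_lt_self hη)⟩
        rw [Real.dist_eq] at hts ⊢
        refine le_of_tendsto ((hw t ht.1 hψ.toL2).sub (hw s hs.1 hψ.toL2)).abs ?_
        filter_upwards [hev] with n hn
        exact hn s hs t ht hts.le
      · have : ContinuousOn (fun _ : ℝ => (0 : ℝ)) (Icc 0 T) := continuousOn_const
        refine this.congr fun t ht => ?_
        exact weakDivFree_iff_isGradient.1 (hu.limit_divFree hw ht.1) g hg
    intro g
    have : g ∈ Y := by rw [htop]; trivial
    exact this
  intro g t ht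
  have ht0 : 0 ≤ t := ht
  refine ((hT (t + 1) (by linarith) g) t ⟨ht0, by linarith⟩).mono_of_mem_nhdsWithin ?_
  rw [← Ici_inter_Iic]
  exact inter_mem_nhdsWithin _ (Iic_mem_nhds (by linarith))

end Limit

/-! ### Weak limits in Bochner spaces. -/

section Bochner

variable {H : Type*} [NormedAddCommGroup H] [InnerProductSpace ℝ H] {X : Type*} [MeasurableSpace X]
  {μ : Measure X}

lemma lp_norm_sq_eq_integral (x : Lp H 2 μ) : ‖x‖ ^ 2 = ∫ t, ‖x t‖ ^ 2 ∂μ := by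
  rw [← real_inner_self_eq_norm_sq, L2.inner_def]
  simp only [real_inner_self_eq_norm_sq]

lemma inner_toLp {f : X → H} (hf : MemLp f 2 μ) (g : Lp H 2 μ) :
    inner ℝ (hf.toLp f) g = ∫ t, inner ℝ (f t) (g t) ∂μ := by
  rw [L2.inner_def]
  refine integral_congr_ae ?_
  filter_upwards [hf.coeFn_toLp] with t ht
  rw [ht]

lemma norm_toLp_le {f : X → H} (hf : MemLp f 2 μ) {C : ℝ} (hC : 0 ≤ C)
    (h : ∫ t, ‖f t‖ ^ 2 ∂μ ≤ C ^ 2) : ‖hf.toLp f‖ ≤ C := by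
  refine le_of_sq_le_sq ?_ hC
  rw [lp_norm_sq_eq_integral]
  refine le_trans (le_of_eq (integral_congr_ae ?_)) h
  filter_upwards [hf.coeFn_toLp] with t ht
  rw [ht]

lemma setIntegral_inner_eq (x : Lp H 2 μ) {s : Set X} (hs : MeasurableSet s) (hμ : μ s ≠ ⊤)
    (a : H) : inner ℝ x (indicatorConstLp 2 hs hμ a) = ∫ t in s, inner ℝ (x t) a ∂μ := by
  rw [real_inner_comm, L2.inner_indicatorConstLp_eq_setIntegral_inner]
  simp only [real_inner_comm]

/-- A bounded sequence in `L²(μ; H)` whose components are pointwise dual to a weakly convergent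
sequence has a weak limit, with the same duality. -/
lemma exists_weak_limit_of_pairs [CompleteSpace H] [SecondCountableTopology H] [IsFiniteMeasure μ]
    {P : Set (H × H)} (hP : Dense (Prod.fst '' P)) {x : ℕ → Lp H 2 μ} {u : ℕ → X → H} {w : X → H}
    {C : ℝ} (hx : ∀ n, ‖x n‖ ≤ C) (hum : ∀ n, AEStronglyMeasurable (u n) μ)
    (hu : ∀ n, ∀ᵐ t ∂μ, ‖u n t‖ ≤ C)
    (hw : ∀ᵐ t ∂μ, ∀ a, Tendsto (fun n => inner ℝ (u n t) a) atTop (𝓝 (inner ℝ (w t) a)))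
    (hxu : ∀ p ∈ P, ∀ n, ∀ᵐ t ∂μ, inner ℝ (x n t) p.1 = - inner ℝ (u n t) p.2) :
    ∃ z : Lp H 2 μ, ‖z‖ ≤ C ∧ (∀ g, Tendsto (fun n => inner ℝ (x n) g) atTop (𝓝 (inner ℝ z g))) ∧
      ∀ᵐ t ∂μ, ∀ p ∈ P, inner ℝ (z t) p.1 = - inner ℝ (w t) p.2 := by
  have hC0 : 0 ≤ C := (norm_nonneg _).trans (hx 0)
  have huint : ∀ n b, Integrable (fun t => inner ℝ (u n t) b) μ := fun n b => by
    refine Integrable.of_bound ((hum n).inner aestronglyMeasurable_const) (C * ‖b‖) ?_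
    filter_upwards [hu n] with t ht
    exact (norm_inner_le_norm _ _).trans (mul_le_mul_of_nonneg_right ht (norm_nonneg _))
  have hwint : ∀ b, Integrable (fun t => inner ℝ (w t) b) μ := fun b => by
    refine Integrable.of_bound (aestronglyMeasurable_of_tendsto_ae atTop
      (fun n => (huint n b).1) (hw.mono fun t ht => ht b)) (C * ‖b‖) ?_
    filter_upwards [hw, ae_all_iff.2 hu] with t h1 h2
    exact (norm_inner_le_norm _ _).trans (mul_le_mul_of_nonneg_right
      (norm_le_of_weak_limit (Eventually.of_forall h2) (h1 _)) (norm_nonneg _))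
  have hlim : ∀ b s, Tendsto (fun n => ∫ t in s, inner ℝ (u n t) b ∂μ) atTop
      (𝓝 (∫ t in s, inner ℝ (w t) b ∂μ)) := by
    intro b s
    refine tendsto_integral_of_dominated_convergence (fun _ => C * ‖b‖)
      (fun n => (huint n b).1.restrict) (integrable_const _) (fun n => ?_) ?_
    · filter_upwards [ae_restrict_of_ae (hu n)] with t ht
      exact (norm_inner_le_norm _ _).trans (mul_le_mul_of_nonneg_right ht (norm_nonneg _))
    · exact ae_restrict_of_ae (hw.mono fun t ht => ht b)
  -- Against `1_s p.1` the duality moves the pairing onto `u n`, which converges weakly at almost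
  -- every point with a uniform bound.
  have hind : ∀ p ∈ P, ∀ (s : Set X) (hs : MeasurableSet s), Tendsto
      (fun n => inner ℝ (x n) (indicatorConstLp 2 hs (measure_ne_top μ s) p.1)) atTop
      (𝓝 (- ∫ t in s, inner ℝ (w t) p.2 ∂μ)) := by
    intro p hp s hs
    refine (hlim p.2 s).neg.congr fun n => ?_
    rw [setIntegral_inner_eq, ← integral_neg]
    refine integral_congr_ae ?_
    filter_upwards [ae_restrict_of_ae (hxu p hp n)] with t ht
    exact ht.symm
  have hcl := isClosed_convSubmodule x C hx
  -- Simple functions span a dense subspace, and their values may be taken in the dense set of first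
  -- components of `P`.
  have hY : ∀ g, g ∈ convSubmodule x := by
    intro g
    refine Lp.induction (p := 2) (by norm_num) (motive := fun g => g ∈ convSubmodule x) ?_ ?_ hcl g
    · intro a s hs hμs
      have hcont : Continuous fun a : H => indicatorConstLp 2 hs hμs.ne a := by
        refine (LipschitzWith.of_dist_le_mul (K := (μ.real s ^ (1 / (2 : ℝ≥0∞).toReal)).toNNReal)
          fun a b => ?_).continuous
        rw [dist_eq_norm, indicatorConstLp_sub, norm_indicatorConstLp (by norm_num) (by norm_num),
          dist_eq_norm, Real.coe_toNNReal _ (by positivity), mul_comm]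
      have h1 : IsClosed {a : H | indicatorConstLp 2 hs hμs.ne a ∈ convSubmodule x} :=
        hcl.preimage hcont
      have h2 : {a : H | indicatorConstLp 2 hs hμs.ne a ∈ convSubmodule x} = univ := by
        refine eq_univ_of_univ_subset ?_
        rw [← hP.closure_eq]
        refine closure_minimal ?_ h1
        rintro _ ⟨p, hp, rfl⟩
        exact ⟨_, hind p hp s hs⟩
      have h3 : a ∈ {a : H | indicatorConstLp 2 hs hμs.ne a ∈ convSubmodule x} := by
        rw [h2]; trivial
      exact h3
    · intro f g hf hg _ h1 h2
      exact Submodule.add_mem _ h1 h2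
  obtain ⟨z, hzC, hz⟩ := exists_weak_limit x C hx hY
  refine ⟨z, hzC, hz, ?_⟩
  have hp : ∀ p ∈ P, ∀ᵐ t ∂μ, inner ℝ (z t) p.1 = - inner ℝ (w t) p.2 := by
    intro p hp
    refine Integrable.ae_eq_of_forall_setIntegral_eq _ _ ?_ (hwint p.2).neg fun s hs _ => ?_
    · have h1 : MemLp (fun t => inner ℝ (z t) p.1) 2 μ := (Lp.memLp z).inner_const p.1
      exact h1.integrable (by norm_num)
    · have h1 := tendsto_nhds_unique (hz _) (hind p hp s hs)
      rw [setIntegral_inner_eq] at h1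
      rw [h1]
      exact (integral_neg _).symm
  -- The exceptional null set depends on the pair; a countable dense part of `P` gives a common one,
  -- and the relation is closed in the pair.
  obtain ⟨P₀, hP₀, hP₀c, hP₀d⟩ := TopologicalSpace.IsSeparable.exists_countable_dense_subset
    (TopologicalSpace.IsSeparable.of_separableSpace P)
  have h0 : ∀ᵐ t ∂μ, ∀ p ∈ P₀, inner ℝ (z t) p.1 = - inner ℝ (w t) p.2 :=
    (ae_ball_iff hP₀c).2 fun p hpp => hp p (hP₀ hpp)
  filter_upwards [h0] with t ht p hpp
  have h1 : IsClosed {p : H × H | inner ℝ (z t) p.1 = - inner ℝ (w t) p.2} :=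
    isClosed_eq (by fun_prop) (by fun_prop)
  exact closure_minimal (fun q hq => ht q hq) h1 (hP₀d hpp)

end Bochner

/-! ### Weak and strong convergence on bounded time intervals. -/

section Limit

variable {ν : ℝ} {u : ℕ → ℝ → L2} {v₀ : L2} {w : ℝ → L2}

/-- Convergence on `(0, T)`, and the regularity of the limit. -/
lemma IsApproximateSolution.limit_regular (hu : IsApproximateSolution ν u v₀)
    (hw : WeakAtEveryTime u w) {T : ℝ} (hT : 0 < T) :
    ∃ C, 0 ≤ C ∧ (∀ n, IsRegular (u n) T C) ∧ IsRegular w T C ∧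
      ∀ g : Lp L2 2 (volume.restrict (Ioo (0 : ℝ) T)),
      Tendsto (fun k => ∫ t in Ioo 0 T, inner ℝ (u k t) (g t)) atTop
        (𝓝 (∫ t in Ioo 0 T, inner ℝ (w t) (g t))) ∧
      ∀ i, Tendsto (fun k => ∫ t in Ioo 0 T, inner ℝ (weakPartial i (u k t)) (g t)) atTop
        (𝓝 (∫ t in Ioo 0 T, inner ℝ (weakPartial i (w t)) (g t))) := by
  obtain ⟨C, hC0, hreg, hwC⟩ := hu.exists_bound_limit hw hT
  have : Fact ((2 : ℝ≥0∞) ≠ ⊤) := ⟨by norm_num⟩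
  set μ := (volume : Measure ℝ).restrict (Ioo 0 T) with hμ
  have hwμ : ∀ᵐ t ∂μ, ∀ a, Tendsto (fun n => inner ℝ (u n t) a) atTop (𝓝 (inner ℝ (w t) a)) := by
    filter_upwards [ae_restrict_mem measurableSet_Ioo] with t ht using hw t ht.1.le
  have hm0 : ∀ n, MemLp (u n) 2 μ := fun n => MemLp.of_bound (hreg n).meas C (hreg n).ae_bound
  -- A single constant has to dominate both the norm in `L²(0, T; L²)`, at most `C √T`, and the norm
  -- at each time, at most `C`.
  have hC1 : 0 ≤ C * (1 + √T) := by positivity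
  have hub : ∀ n, ‖(hm0 n).toLp (u n)‖ ≤ C * (1 + √T) := by
    intro n
    refine norm_toLp_le (hm0 n) hC1 ?_
    have h1 : ∫ t, ‖u n t‖ ^ 2 ∂μ ≤ ∫ t, C ^ 2 ∂μ := by
      refine integral_mono_ae ((hm0 n).integrable_norm_pow (by norm_num)) (integrable_const _) ?_
      filter_upwards [(hreg n).ae_bound] with t ht
      gcongr
    refine h1.trans ?_
    rw [hμ, setIntegral_const]
    simp only [Real.volume_real_Ioo_of_le hT.le, sub_zero, smul_eq_mul]
    rw [mul_pow, mul_comm]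
    refine mul_le_mul_of_nonneg_left ?_ (sq_nonneg C)
    nlinarith [Real.sq_sqrt hT.le, Real.sqrt_nonneg T]
  have hCle : C ≤ C * (1 + √T) := le_mul_of_one_le_right hC0 (by linarith [Real.sqrt_nonneg T])
  -- With the trivial pairs `(a, -a)` the sequence is its own dual. The limit `z` then agrees with
  -- `w` almost everywhere, which in particular makes `w` strongly measurable.
  obtain ⟨z, -, hz, hzw⟩ := exists_weak_limit_of_pairs (P := {p : L2 × L2 | p.2 = -p.1})
    (u := u) (w := w) (x := fun n => (hm0 n).toLp (u n)) (C := C * (1 + √T)) (by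
      have : Prod.fst '' {p : L2 × L2 | p.2 = -p.1} = univ :=
        eq_univ_of_forall fun a => ⟨(a, -a), rfl, rfl⟩
      rw [this]; exact dense_univ) hub (fun n => (hreg n).meas)
    (fun n => (hreg n).ae_bound.mono fun t ht => ht.trans hCle) hwμ (by
      intro p hp n
      filter_upwards [(hm0 n).coeFn_toLp] with t ht
      rw [ht, show p.2 = -p.1 from hp, inner_neg_right, neg_neg])
  have hwz : w =ᵐ[μ] z := by
    filter_upwards [hzw] with t ht
    refine ext_inner_right ℝ fun a => ?_
    rw [ht (a, -a) rfl, inner_neg_right, neg_neg]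
  have hxi : ∀ i, ∃ y : Lp L2 2 μ, ‖y‖ ≤ C ∧ (∀ g : Lp L2 2 μ,
      Tendsto (fun k => ∫ t, inner ℝ (weakPartial i (u k t)) (g t) ∂μ) atTop (𝓝 (inner ℝ y g))) ∧
      ∀ᵐ t ∂μ, HasWeakPartial i (w t) (y t) := by
    intro i
    -- Here the pairs `(ψ, ∂ᵢψ)` encode the definition of the weak derivative, so the weak limit of
    -- the derivatives is the derivative of the limit at almost every time.
    obtain ⟨y, hyC, hy, hyw⟩ := exists_weak_limit_of_pairs
      (P := {p : L2 × L2 | ∃ ψ, ∃ h : IsTestField ψ, p = (h.toL2, (h.partial' (e i)).toL2)})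
      (u := u) (w := w) (x := fun n => ((hreg n).memLp i).toLp _) (C := C) (by
        refine dense_testFields.mono ?_
        rintro _ ⟨ψ, h, rfl⟩
        exact ⟨_, ⟨ψ, h, rfl⟩, rfl⟩)
      (fun n => norm_toLp_le _ hC0 ((hreg n).bound_partial i)) (fun n => (hreg n).meas)
      (fun n => (hreg n).ae_bound) hwμ (by
        rintro _ ⟨ψ, h, rfl⟩ n
        filter_upwards [((hreg n).memLp i).coeFn_toLp, (hreg n).inH1] with t h1 h2
        rw [h1, hasWeakPartial_iff.1 (h2.hasWeakPartial i) ψ h, neg_neg])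
    refine ⟨y, hyC, fun g => (hy g).congr fun n => inner_toLp _ _, ?_⟩
    filter_upwards [hyw] with t ht
    refine hasWeakPartial_iff.2 fun ψ h => ?_
    rw [ht _ ⟨ψ, h, rfl⟩, neg_neg]
  choose y hyC hy hyw using hxi
  have hyw' : ∀ i, (fun t => weakPartial i (w t)) =ᵐ[μ] y i := fun i =>
    (hyw i).mono fun t ht => ht.weakPartial_eq
  refine ⟨C, hC0, hreg, ⟨?_, fun i => ?_, ?_, hwC, fun i => ?_⟩, fun g => ⟨?_, fun i => ?_⟩⟩
  · exact (Lp.aestronglyMeasurable z).congr hwz.symm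
  · exact (Lp.memLp (y i)).ae_eq (hyw' i).symm
  · filter_upwards [ae_all_iff.2 hyw] with t ht i using ⟨_, ht i⟩
  · have h1 : ∫ t, ‖weakPartial i (w t)‖ ^ 2 ∂μ = ‖y i‖ ^ 2 := by
      rw [lp_norm_sq_eq_integral]
      refine integral_congr_ae ?_
      filter_upwards [hyw' i] with t ht
      rw [ht]
    rw [h1]
    exact pow_le_pow_left₀ (norm_nonneg _) (hyC i) 2
  · have h1 : ∫ t, inner ℝ (w t) (g t) ∂μ = inner ℝ z g := by
      rw [L2.inner_def]
      refine integral_congr_ae ?_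
      filter_upwards [hwz] with t ht
      rw [ht]
    rw [h1]
    exact (hz g).congr fun n => inner_toLp _ _
  · have h1 : ∫ t, inner ℝ (weakPartial i (w t)) (g t) ∂μ = inner ℝ (y i) g := by
      rw [L2.inner_def]
      refine integral_congr_ae ?_
      filter_upwards [hyw' i] with t ht
      rw [ht]
    rw [h1]
    exact hy i g

lemma IsApproximateSolution.limit_inEnergySpace (hu : IsApproximateSolution ν u v₀)
    (hw : WeakAtEveryTime u w) : InEnergySpace w where
  memLp_top T hT := by
    obtain ⟨C, -, -, h, -⟩ := hu.limit_regular hw hT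
    exact memLp_top_of_bound h.meas C h.ae_bound
  ae_inH1 := by
    have h1 : Ioi (0 : ℝ) = ⋃ n : ℕ, Ioo (0 : ℝ) (n + 1) := by
      ext t
      simp only [mem_Ioi, mem_iUnion, mem_Ioo]
      constructor
      · intro ht
        obtain ⟨n, hn⟩ := exists_nat_gt t
        exact ⟨n, ht, by linarith⟩
      · rintro ⟨n, h, -⟩; exact h
    rw [h1, ae_restrict_iUnion_iff]
    intro n
    obtain ⟨C, -, -, h, -⟩ := hu.limit_regular hw (T := n + 1) (by positivity)
    exact h.inH1
  memLp_partial i T hT := by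
    obtain ⟨C, -, -, h, -⟩ := hu.limit_regular hw hT
    exact h.memLp i
  weaklyContinuous := hu.limit_weaklyContinuous hw

lemma IsApproximateSolution.weakConvH1 (hu : IsApproximateSolution ν u v₀)
    (hw : WeakAtEveryTime u w) : WeakConvH1 u w := by
  intro T hT g
  obtain ⟨C, -, -, -, h⟩ := hu.limit_regular hw hT
  exact h g

lemma IsApproximateSolution.weakStarConv (hu : IsApproximateSolution ν u v₀)
    (hw : WeakAtEveryTime u w) : WeakStarConv u w := by
  intro T hT g
  obtain ⟨C, hC0, hreg, -⟩ := hu.exists_bound_limit hw hT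
  refine tendsto_integral_of_dominated_convergence (fun t => C * ‖g t‖)
    (fun n => (hreg n).meas.inner (Lp.aestronglyMeasurable g))
    ((L1.integrable_coeFn g).norm.const_mul C) (fun n => ?_) ?_
  · filter_upwards [(hreg n).ae_bound] with t ht
    exact (norm_inner_le_norm _ _).trans (mul_le_mul_of_nonneg_right ht (norm_nonneg _))
  · filter_upwards [ae_restrict_mem measurableSet_Ioo] with t ht using hw t ht.1.le _

lemma HasWeakPartial.sub {i : Fin 3} {a b a' b' : L2} (ha : HasWeakPartial i a a')
    (hb : HasWeakPartial i b b') : HasWeakPartial i (a - b) (a' - b') := by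
  rw [hasWeakPartial_iff] at *
  intro ψ h
  rw [inner_sub_left, inner_sub_left, ha ψ h, hb ψ h]
  ring

lemma continuous_lintegral_mollify (φ : ContDiffBump (0 : E3)) (R : ℝ) :
    Continuous (fun z : L2 => ∫⁻ x in Metric.ball 0 R, ‖mollify φ z x‖ₑ ^ 2) := by
  rw [continuous_iff_seqContinuous]
  intro z z₀ hz
  obtain ⟨C, hC⟩ := (Metric.isBounded_range_of_tendsto z hz).exists_norm_le
  exact tendsto_lintegral_mollify φ (fun n => hC _ (mem_range_self n))
    (fun g => hz.inner tendsto_const_nhds) R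

lemma enorm_sq_le_two_mul (a b : E3) : ‖a‖ₑ ^ 2 ≤ 2 * ‖b‖ₑ ^ 2 + 2 * ‖b - a‖ₑ ^ 2 := by
  have h1 : ‖a‖ ^ 2 ≤ 2 * ‖b‖ ^ 2 + 2 * ‖b - a‖ ^ 2 := by
    have h2 : ‖a‖ ≤ ‖b‖ + ‖b - a‖ := by
      have := norm_sub_le b (b - a)
      rwa [sub_sub_cancel] at this
    nlinarith [sq_nonneg (‖b‖ - ‖b - a‖), norm_nonneg a]
  have h3 := ENNReal.ofReal_le_ofReal h1
  rw [ENNReal.ofReal_add (by positivity) (by positivity), ENNReal.ofReal_mul (by norm_num),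
    ENNReal.ofReal_mul (by norm_num), ENNReal.ofReal_pow (norm_nonneg _),
    ENNReal.ofReal_pow (norm_nonneg _), ENNReal.ofReal_pow (norm_nonneg _)] at h3
  simpa [ofReal_norm] using h3

lemma two_mul_ofReal (a : ℝ) : 2 * ENNReal.ofReal a = ENNReal.ofReal (2 * a) := by
  rw [ENNReal.ofReal_mul zero_le_two, ENNReal.ofReal_ofNat]

/-- The difference `z` of the fields is split into its mollification and the remainder. At each time
weak convergence makes the first tend to zero on the ball, and dominated convergence integrates this
in time; the second is at most `δ` times the gradients, hence small in `L²` uniformly in the index.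
-/
lemma IsApproximateSolution.strongConv (hu : IsApproximateSolution ν u v₀)
    (hw : WeakAtEveryTime u w) : StrongConvL2Loc u w := by
  intro T hT R hR
  obtain ⟨C, hC0, hreg, hwreg, -⟩ := hu.limit_regular hw hT
  rw [ENNReal.tendsto_nhds_zero]
  intro η hη
  obtain ⟨η', hη'0, hη'⟩ : ∃ η' : ℝ, 0 < η' ∧ ENNReal.ofReal η' ≤ η := by
    rcases eq_or_ne η ⊤ with h | h
    · exact ⟨1, one_pos, by rw [h]; exact le_top⟩
    · exact ⟨η.toReal, ENNReal.toReal_pos hη.ne' h, ENNReal.ofReal_toReal_le⟩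
  -- `72 = 4 · (9 + 9)`: the remainder is bounded by `4 δ²` times the sum of the squared gradients
  -- of the two fields, each with time integral at most `9 C²`.
  obtain ⟨δ, hδ0, hδ⟩ : ∃ δ : ℝ, 0 < δ ∧ 72 * C ^ 2 * δ ^ 2 ≤ η' / 2 := by
    refine ⟨√(η' / (2 * (72 * C ^ 2 + 1))), Real.sqrt_pos.2 (by positivity), ?_⟩
    rw [Real.sq_sqrt (by positivity)]
    rw [show 72 * C ^ 2 * (η' / (2 * (72 * C ^ 2 + 1)))
      = η' / 2 * (72 * C ^ 2 / (72 * C ^ 2 + 1)) by field_simp]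
    refine mul_le_of_le_one_right (by positivity) ?_
    rw [div_le_one (by positivity)]; linarith
  let φ : ContDiffBump (0 : E3) := ⟨δ / 2, δ, by positivity, by linarith⟩
  set Φ : L2 → ℝ≥0∞ := fun z => ∫⁻ x in Metric.ball 0 R, ‖mollify φ z x‖ₑ ^ 2
  have hΦ : Tendsto (fun n => ∫⁻ t in Ioo 0 T, Φ (u n t - w t)) atTop (𝓝 0) := by
    have h0 : ∫⁻ t in Ioo 0 T, Φ 0 = 0 := by
      have : Φ 0 = 0 := by
        refine le_antisymm ?_ bot_le
        refine (setLIntegral_le_lintegral _ _).trans ((lintegral_mollify_sq_le φ 0).trans ?_)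
        simp
      simp [this]
    rw [← h0]
    refine tendsto_lintegral_of_dominated_convergence' (fun _ => ENNReal.ofReal ((2 * C) ^ 2))
      (fun n => ?_) (fun n => ?_) ?_ ?_
    · exact ((continuous_lintegral_mollify φ R).comp_aestronglyMeasurable
        ((hreg n).meas.sub hwreg.meas)).aemeasurable
    · filter_upwards [(hreg n).ae_bound, hwreg.ae_bound] with t h1 h2
      refine (setLIntegral_le_lintegral _ _).trans ((lintegral_mollify_sq_le φ _).trans ?_)
      refine ENNReal.ofReal_le_ofReal (pow_le_pow_left₀ (norm_nonneg _) ?_ 2)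
      exact (norm_sub_le _ _).trans (by linarith)
    · rw [lintegral_const, Measure.restrict_apply_univ]
      exact ENNReal.mul_ne_top ENNReal.ofReal_ne_top measure_Ioo_lt_top.ne
    · filter_upwards [ae_restrict_mem measurableSet_Ioo] with t ht
      refine tendsto_lintegral_mollify φ (C := 2 * C) (fun n => ?_) (fun g => ?_) R
      · have h1 := (hreg n).bound t ⟨ht.1.le, ht.2.le⟩
        have h2 := hwreg.bound t ⟨ht.1.le, ht.2.le⟩
        exact (norm_sub_le _ _).trans (by linarith)
      · have := (hw t ht.1.le g).sub_const (inner ℝ (w t) g)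
        simpa [inner_sub_left] using this
  have hev := ENNReal.tendsto_nhds_zero.1 hΦ (ENNReal.ofReal (η' / 4))
    (ENNReal.ofReal_pos.2 (by positivity))
  filter_upwards [hev] with n hn
  have hpt : ∀ᵐ t ∂(volume.restrict (Ioo 0 T)),
      ∫⁻ x in Metric.ball 0 R, ‖u n t x - w t x‖ₑ ^ 2 ≤ 2 * Φ (u n t - w t)
        + ENNReal.ofReal (4 * δ ^ 2 * (gradNorm (u n t) ^ 2 + gradNorm (w t) ^ 2)) := by
    filter_upwards [(hreg n).inH1, hwreg.inH1] with t h1 h2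
    set z := u n t - w t
    have e1 : ∫⁻ x in Metric.ball 0 R, ‖u n t x - w t x‖ₑ ^ 2
        = ∫⁻ x in Metric.ball 0 R, ‖z x‖ₑ ^ 2 := by
      refine lintegral_congr_ae ?_
      filter_upwards [ae_restrict_of_ae (Lp.coeFn_sub (u n t) (w t))] with x hx
      rw [hx, Pi.sub_apply]
    have e2 := lintegral_mollify_sub_sq_le φ
      (fun i => (h1.hasWeakPartial i).sub (h2.hasWeakPartial i))
    rw [e1]
    calc ∫⁻ x in Metric.ball 0 R, ‖z x‖ₑ ^ 2
        ≤ ∫⁻ x in Metric.ball 0 R, (2 * ‖mollify φ z x‖ₑ ^ 2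
            + 2 * ‖mollify φ z x - z x‖ₑ ^ 2) := lintegral_mono fun x => enorm_sq_le_two_mul _ _
      _ = 2 * Φ z + 2 * ∫⁻ x in Metric.ball 0 R, ‖mollify φ z x - z x‖ₑ ^ 2 := by
          have hm1 := (continuous_mollify φ z).measurable
          have hm2 : Measurable (fun x => mollify φ z x - z x) := hm1.sub (measurable_coe z)
          rw [lintegral_add_left ((hm1.enorm.pow_const 2).const_mul 2),
            lintegral_const_mul _ (hm1.enorm.pow_const 2),
            lintegral_const_mul _ (hm2.enorm.pow_const 2)]
      _ ≤ 2 * Φ z + ENNReal.ofReal (4 * δ ^ 2 * (gradNorm (u n t) ^ 2 + gradNorm (w t) ^ 2)) := by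
          gcongr
          refine (mul_le_mul_right ((setLIntegral_le_lintegral _ _).trans e2) 2).trans ?_
          rw [two_mul_ofReal]
          refine ENNReal.ofReal_le_ofReal ?_
          have h3 : ∑ i, ‖weakPartial i (u n t) - weakPartial i (w t)‖
              ≤ gradNorm (u n t) + gradNorm (w t) := by
            rw [gradNorm, gradNorm, ← Finset.sum_add_distrib]
            exact Finset.sum_le_sum fun i _ => norm_sub_le _ _
          have h4 : 0 ≤ ∑ i, ‖weakPartial i (u n t) - weakPartial i (w t)‖ := by positivity
          have h5 := pow_le_pow_left₀ h4 h3 2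
          rw [mul_pow]
          change 2 * (_ * δ ^ 2) ≤ _
          have h6 : (gradNorm (u n t) + gradNorm (w t)) ^ 2
              ≤ 2 * (gradNorm (u n t) ^ 2 + gradNorm (w t) ^ 2) := by
            nlinarith [sq_nonneg (gradNorm (u n t) - gradNorm (w t))]
          nlinarith [mul_le_mul_of_nonneg_right (h5.trans h6) (sq_nonneg δ)]
  have hgi : Integrable (fun t => 4 * δ ^ 2 * (gradNorm (u n t) ^ 2 + gradNorm (w t) ^ 2))
      (volume.restrict (Ioo 0 T)) :=
    ((hreg n).integrable_gradNorm_sq.add hwreg.integrable_gradNorm_sq).const_mul _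
  calc _ ≤ ∫⁻ t in Ioo 0 T, (2 * Φ (u n t - w t)
        + ENNReal.ofReal (4 * δ ^ 2 * (gradNorm (u n t) ^ 2 + gradNorm (w t) ^ 2))) :=
        lintegral_mono_ae hpt
    _ = 2 * (∫⁻ t in Ioo 0 T, Φ (u n t - w t)) + ENNReal.ofReal
        (∫ t in Ioo 0 T, 4 * δ ^ 2 * (gradNorm (u n t) ^ 2 + gradNorm (w t) ^ 2)) := by
        rw [lintegral_add_right' _ hgi.1.aemeasurable.ennreal_ofReal,
          lintegral_const_mul' _ _ (by norm_num),
          ofReal_integral_eq_lintegral_ofReal hgi (Eventually.of_forall fun t => by positivity)]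
    _ ≤ 2 * ENNReal.ofReal (η' / 4) + ENNReal.ofReal (η' / 2) := by
        gcongr
        rw [integral_const_mul, integral_add (hreg n).integrable_gradNorm_sq
          hwreg.integrable_gradNorm_sq]
        have h1 := (hreg n).integral_gradNorm_sq_le
        have h2 := hwreg.integral_gradNorm_sq_le
        nlinarith [mul_le_mul_of_nonneg_left (add_le_add h1 h2) (sq_nonneg δ)]
    _ = ENNReal.ofReal η' := by
        rw [two_mul_ofReal, ← ENNReal.ofReal_add (by positivity) (by positivity)]
        congr 1; ring
    _ ≤ η := hη'

end Limit

/-! ### Passage to the limit in the equation. -/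

/-- The convective term, as a trilinear form `∫ uᵢ ⟨w, f⟩`. -/
def transport (i : Fin 3) (u w : L2) (f : E3 → E3) : ℝ := ∫ x, u x i * inner ℝ (w x) (f x)

lemma transport_sub (i : Fin 3) {f : E3 → E3} (hf : Continuous f) (hc : HasCompactSupport f)
    (u u' w : L2) : transport i (u - u') w f = transport i u w f - transport i u' w f := by
  obtain ⟨A, hA⟩ := exists_transport_bcf i hf hc
  unfold transport
  simp only [← inner_mulLp_transport i hA]
  rw [eq_sub_iff_add_eq, ← inner_add_right, ← mulLp_add_right, sub_add_cancel]

lemma lintegral_ball_enorm_sq (z : L2) (R : ℝ) :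
    ∫⁻ x in Metric.ball 0 R, ‖z x‖ₑ ^ 2 = ENNReal.ofReal (∫ x in Metric.ball 0 R, ‖z x‖ ^ 2) := by
  rw [ofReal_integral_eq_lintegral_ofReal (integrable_norm_sq z).restrict
    (Eventually.of_forall fun x => sq_nonneg _)]
  refine lintegral_congr fun x => ?_
  rw [ENNReal.ofReal_pow (norm_nonneg _), ofReal_norm]

/-- Young's inequality with a free weight: `z` appears only through its local mass, which will tend
to zero, while the gradient `p`, merely bounded, gets the small factor `η`. -/
lemma enorm_transport_le (i : Fin 3) {f : E3 → E3} {B R η : ℝ}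
    (hB : 0 ≤ B) (hη : 0 < η) (hfB : ∀ x, ‖f x‖ ≤ B) (hf0 : ∀ x ∉ Metric.ball (0 : E3) R, f x = 0)
    (z p : L2) : ‖transport i z p f‖ₑ ≤
      ENNReal.ofReal (B / η) * (∫⁻ x in Metric.ball 0 R, ‖z x‖ₑ ^ 2)
        + ENNReal.ofReal (B * η * ‖p‖ ^ 2) := by
  have hz := (integrable_norm_sq z).integrableOn (s := Metric.ball 0 R)
  have hp := (integrable_norm_sq p).integrableOn (s := Metric.ball 0 R)
  have h1 : |transport i z p f| ≤ ∫ x in Metric.ball 0 R,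
      (B / η * ‖z x‖ ^ 2 + B * η * ‖p x‖ ^ 2) := by
    refine abs_integral_le_of_ball Metric.isOpen_ball.measurableSet
      ((hz.const_mul _).add (hp.const_mul _)) (fun x hx => by rw [hf0 x hx]; simp) fun x _ => ?_
    have h2 : |z x i * inner ℝ (p x) (f x)| ≤ B * (‖z x‖ * ‖p x‖) := by
      rw [abs_mul]
      calc _ ≤ ‖z x‖ * (‖p x‖ * B) := by
            refine mul_le_mul (E3.abs_apply_le _ _) ?_ (abs_nonneg _) (norm_nonneg _)
            exact (abs_real_inner_le_norm _ _).trans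
              (mul_le_mul_of_nonneg_left (hfB x) (norm_nonneg _))
        _ = _ := by ring
    have h3 : ‖z x‖ * ‖p x‖ ≤ ‖z x‖ ^ 2 / η + η * ‖p x‖ ^ 2 := by
      rw [div_add' _ _ _ hη.ne', le_div_iff₀ hη]
      nlinarith [sq_nonneg (‖z x‖ - η * ‖p x‖), mul_nonneg (mul_nonneg (norm_nonneg (z x))
        (norm_nonneg (p x))) hη.le]
    refine h2.trans ((mul_le_mul_of_nonneg_left h3 hB).trans_eq ?_)
    ring
  rw [integral_add (hz.const_mul _) (hp.const_mul _), integral_const_mul, integral_const_mul] at h1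
  have h4 : |transport i z p f| ≤ B / η * (∫ x in Metric.ball 0 R, ‖z x‖ ^ 2)
      + B * η * ‖p‖ ^ 2 :=
    h1.trans (add_le_add le_rfl (mul_le_mul_of_nonneg_left (setIntegral_norm_sq_le p _)
      (by positivity)))
  rw [lintegral_ball_enorm_sq, ← ENNReal.ofReal_mul (by positivity),
    ← ENNReal.ofReal_add (by positivity) (by positivity), ← ofReal_norm, Real.norm_eq_abs]
  exact ENNReal.ofReal_le_ofReal h4

section Limit

variable {u : ℕ → ℝ → L2} {w : ℝ → L2} {T C : ℝ} {K : ℝ × E3 → E3}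

lemma tendsto_integral_pairing {x : ℕ → ℝ → L2} {z : ℝ → L2}
    (h : ∀ g : Lp L2 2 (volume.restrict (Ioo (0 : ℝ) T)),
      Tendsto (fun k => ∫ t in Ioo 0 T, inner ℝ (x k t) (g t)) atTop
        (𝓝 (∫ t in Ioo 0 T, inner ℝ (z t) (g t))))
    (hK : Continuous K) (hc : HasCompactSupport K) :
    Tendsto (fun k => ∫ t in Ioo 0 T, pairing (x k t) (fun y => K (t, y))) atTop
      (𝓝 (∫ t in Ioo 0 T, pairing (z t) (fun y => K (t, y)))) := by
  have hcurve := continuous_ccLp_curve K hK hc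
  set g : ℝ → L2 := fun t => ccLp (fun y => K (t, y)) (hK.comp (by fun_prop))
      (HasCompactSupport.slice hc t)
  have hg : MemLp g 2 (volume.restrict (Ioo (0 : ℝ) T)) := by
    obtain ⟨B, hB⟩ := isCompact_Icc.exists_bound_of_continuousOn
      (hcurve.continuousOn (s := Icc (0 : ℝ) T))
    refine MemLp.of_bound hcurve.aestronglyMeasurable B ?_
    filter_upwards [ae_restrict_mem measurableSet_Ioo] with t ht
    exact hB t ⟨ht.1.le, ht.2.le⟩
  have e : ∀ y : ℝ → L2, ∫ t in Ioo 0 T, inner ℝ (y t) (hg.toLp g t)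
      = ∫ t in Ioo 0 T, pairing (y t) (fun x => K (t, x)) := by
    intro y
    refine integral_congr_ae ?_
    filter_upwards [hg.coeFn_toLp] with t ht
    rw [ht]
    exact (pairing_eq_inner _ _ _).symm
  have h1 := h (hg.toLp g)
  simp only [e] at h1
  exact h1

lemma integrable_transport_curve {a b : ℝ → L2} (i : Fin 3) (hK : Continuous K)
    (hc : HasCompactSupport K) (ha : AEStronglyMeasurable a (volume.restrict (Ioo 0 T)))
    (haC : ∀ᵐ t ∂(volume.restrict (Ioo 0 T)), ‖a t‖ ≤ C)
    (hb : MemLp b 2 (volume.restrict (Ioo 0 T))) :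
    Integrable (fun t => transport i (a t) (b t) (fun x => K (t, x)))
      (volume.restrict (Ioo 0 T)) := by
  obtain ⟨B, hB⟩ := hK.bounded_above_of_compact_support hc
  have hB0 : 0 ≤ B := (norm_nonneg _).trans (hB 0)
  have hbi : Integrable (fun t => ‖b t‖) (volume.restrict (Ioo 0 T)) :=
    (hb.integrable (by norm_num)).norm
  refine (hbi.const_mul (B * C)).mono'
    (aestronglyMeasurable_transport i hK hc ha hb.1 aestronglyMeasurable_id) ?_
  filter_upwards [haC] with t ht
  refine (abs_transport_le i (hK.comp (by fun_prop)) (HasCompactSupport.slice hc t) hB0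
    (fun x => hB _) _ _).trans ?_
  gcongr

/-- With the transporting field fixed, the term is linear in the gradient: it is the pairing with
the product of `w` by a bounded matrix field, an element of `L²(0, T; L²)`. -/
lemma tendsto_integral_transport_right (i : Fin 3) (hK : Continuous K) (hc : HasCompactSupport K)
    {x : ℕ → ℝ → L2} {z : ℝ → L2} (hw : IsRegular w T C)
    (h : ∀ g : Lp L2 2 (volume.restrict (Ioo (0 : ℝ) T)),
      Tendsto (fun k => ∫ t in Ioo 0 T, inner ℝ (x k t) (g t)) atTop
        (𝓝 (∫ t in Ioo 0 T, inner ℝ (z t) (g t)))) :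
    Tendsto (fun k => ∫ t in Ioo 0 T, transport i (w t) (x k t) (fun y => K (t, y))) atTop
      (𝓝 (∫ t in Ioo 0 T, transport i (w t) (z t) (fun y => K (t, y)))) := by
  obtain ⟨k, hk, hkK⟩ := exists_bcf_curve (fun q => (coordL i).smulRight (K q))
    ((ContinuousLinearMap.smulRightL ℝ E3 E3 (coordL i)).continuous.comp hK)
    (hc.comp_left (g := fun y => (coordL i).smulRight y) (by ext; simp))
  have hg : MemLp (fun t => mulLp (k t) (w t)) 2 (volume.restrict (Ioo (0 : ℝ) T)) := by
    obtain ⟨D, hD⟩ := isCompact_Icc.exists_bound_of_continuousOn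
      (hk.continuousOn (s := Icc (0 : ℝ) T))
    refine MemLp.of_bound (continuous_mulLp.comp_aestronglyMeasurable
      ((hk.comp_aestronglyMeasurable aestronglyMeasurable_id).prodMk hw.meas)) (D * C) ?_
    filter_upwards [ae_restrict_mem measurableSet_Ioo, hw.ae_bound] with t ht h1
    have h2 := hD t ⟨ht.1.le, ht.2.le⟩
    exact (norm_mulLp_le _ _).trans
      (mul_le_mul h2 h1 (norm_nonneg _) ((norm_nonneg _).trans h2))
  have e : ∀ y : ℝ → L2, ∫ t in Ioo 0 T, inner ℝ (y t) (hg.toLp _ t)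
      = ∫ t in Ioo 0 T, transport i (w t) (y t) (fun x => K (t, x)) := by
    intro y
    refine integral_congr_ae ?_
    filter_upwards [hg.coeFn_toLp] with t ht
    rw [ht, inner_mulLp_transport i (fun x => hkK t x)]
    rfl
  have h1 := h (hg.toLp _)
  simp only [e] at h1
  exact h1

/-- The product is split as `(uₙ - w) ∂ᵢuₙ + w ∂ᵢuₙ`. The first part vanishes by local strong
convergence and the bound on the gradients, the second converges by weak convergence of the
gradients. -/
lemma tendsto_integral_transport (i : Fin 3) (hK : Continuous K) (hc : HasCompactSupport K)
    (hu : ∀ n, IsRegular (u n) T C) (hw : IsRegular w T C)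
    (hs : ∀ R > 0, Tendsto (fun k => ∫⁻ t in Ioo 0 T, ∫⁻ x in Metric.ball 0 R,
      ‖u k t x - w t x‖ₑ ^ 2) atTop (𝓝 0))
    (h : ∀ g : Lp L2 2 (volume.restrict (Ioo (0 : ℝ) T)),
      Tendsto (fun k => ∫ t in Ioo 0 T, inner ℝ (weakPartial i (u k t)) (g t)) atTop
        (𝓝 (∫ t in Ioo 0 T, inner ℝ (weakPartial i (w t)) (g t)))) :
    Tendsto (fun k => ∫ t in Ioo 0 T,
      transport i (u k t) (weakPartial i (u k t)) (fun y => K (t, y))) atTop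
      (𝓝 (∫ t in Ioo 0 T, transport i (w t) (weakPartial i (w t)) (fun y => K (t, y)))) := by
  obtain ⟨B, hB⟩ := hK.bounded_above_of_compact_support hc
  have hB0 : 0 ≤ B := (norm_nonneg _).trans (hB 0)
  obtain ⟨R, hR⟩ : ∃ R : ℝ, ∀ t, ∀ x ∉ Metric.ball (0 : E3) R, K (t, x) = 0 := by
    obtain ⟨R, hR⟩ := (hc.isCompact.image continuous_snd).isBounded.subset_ball (0 : E3)
    refine ⟨R, fun t x hx => ?_⟩
    by_contra h0
    exact hx (hR ⟨(t, x), subset_tsupport _ h0, rfl⟩)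
  have hKt : ∀ t, Continuous (fun x => K (t, x)) := fun t => hK.comp (by fun_prop)
  have hct : ∀ t, HasCompactSupport (fun x => K (t, x)) := HasCompactSupport.slice hc
  have hlin := tendsto_integral_transport_right i hK hc hw h
  have hdiff : Tendsto (fun k => ∫ t in Ioo 0 T,
      transport i (u k t - w t) (weakPartial i (u k t)) (fun y => K (t, y))) atTop (𝓝 0) := by
    rw [Metric.tendsto_atTop']
    intro κ hκ
    obtain ⟨η, hη, hηκ⟩ : ∃ η : ℝ, 0 < η ∧ B * η * C ^ 2 ≤ κ / 4 := by
      refine ⟨κ / (4 * (B * C ^ 2 + 1)), by positivity, ?_⟩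
      rw [show B * (κ / (4 * (B * C ^ 2 + 1))) * C ^ 2 = κ / 4 * (B * C ^ 2 / (B * C ^ 2 + 1)) by
        field_simp]
      refine mul_le_of_le_one_right (by positivity) ?_
      rw [div_le_one (by positivity)]; linarith
    -- The radius `R` comes from boundedness alone and may be nonpositive, hence the maximum with
    -- `1`.
    have h1 := ENNReal.Tendsto.const_mul (a := ENNReal.ofReal (B / η))
      (hs (max R 1) (by positivity)) (Or.inr ENNReal.ofReal_ne_top)
    rw [mul_zero] at h1
    obtain ⟨N, hN⟩ := eventually_atTop.1 (ENNReal.tendsto_nhds_zero.1 h1 (ENNReal.ofReal (κ / 4))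
      (ENNReal.ofReal_pos.2 (by positivity)))
    refine ⟨N, fun n hn => ?_⟩
    have hpi : Integrable (fun t => B * η * ‖weakPartial i (u n t)‖ ^ 2)
        (volume.restrict (Ioo 0 T)) := (((hu n).memLp i).integrable_norm_pow (by norm_num)).const_mul _
    have h2 : ‖∫ t in Ioo 0 T,
        transport i (u n t - w t) (weakPartial i (u n t)) (fun y => K (t, y))‖ₑ
        ≤ ENNReal.ofReal (κ / 2) := by
      calc _ ≤ ∫⁻ t in Ioo 0 T,
            ‖transport i (u n t - w t) (weakPartial i (u n t)) (fun y => K (t, y))‖ₑ :=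
            enorm_integral_le_lintegral_enorm _
        _ ≤ ∫⁻ t in Ioo 0 T, (ENNReal.ofReal (B / η)
              * (∫⁻ x in Metric.ball 0 (max R 1), ‖u n t x - w t x‖ₑ ^ 2)
              + ENNReal.ofReal (B * η * ‖weakPartial i (u n t)‖ ^ 2)) := by
            refine lintegral_mono fun t => ?_
            refine (enorm_transport_le i (R := max R 1) hB0 hη (fun x => hB _) (fun x hx => ?_)
              _ _).trans_eq ?_
            · exact hR t x fun h0 => hx (Metric.ball_subset_ball (le_max_left _ _) h0)
            · congr 2
              refine lintegral_congr_ae ?_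
              filter_upwards [ae_restrict_of_ae (Lp.coeFn_sub (u n t) (w t))] with x hx
              rw [hx, Pi.sub_apply]
        _ = ENNReal.ofReal (B / η) * (∫⁻ t in Ioo 0 T,
              ∫⁻ x in Metric.ball 0 (max R 1), ‖u n t x - w t x‖ₑ ^ 2)
              + ENNReal.ofReal (∫ t in Ioo 0 T, B * η * ‖weakPartial i (u n t)‖ ^ 2) := by
            rw [lintegral_add_right' _ hpi.1.aemeasurable.ennreal_ofReal,
              lintegral_const_mul' _ _ ENNReal.ofReal_ne_top,
              ofReal_integral_eq_lintegral_ofReal hpi (Eventually.of_forall fun t => by positivity)]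
        _ ≤ ENNReal.ofReal (κ / 4) + ENNReal.ofReal (κ / 4) := by
            refine add_le_add (hN n hn.le) (ENNReal.ofReal_le_ofReal ?_)
            rw [integral_const_mul]
            exact (mul_le_mul_of_nonneg_left ((hu n).bound_partial i) (by positivity)).trans hηκ
        _ = ENNReal.ofReal (κ / 2) := by
            rw [← ENNReal.ofReal_add (by positivity) (by positivity)]
            congr 1; ring
    rw [← ofReal_norm, ENNReal.ofReal_le_ofReal_iff (by positivity)] at h2
    rw [dist_zero_right]
    exact h2.trans_lt (half_lt_self hκ)
  have h3 := hdiff.add hlin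
  rw [zero_add] at h3
  refine h3.congr fun n => ?_
  have hd : ∀ t, transport i (u n t - w t) (weakPartial i (u n t)) (fun y => K (t, y))
      = transport i (u n t) (weakPartial i (u n t)) (fun y => K (t, y))
        - transport i (w t) (weakPartial i (u n t)) (fun y => K (t, y)) := fun t =>
    transport_sub i (hKt t) (hct t) _ _ _
  simp only [hd]
  rw [integral_sub (integrable_transport_curve i hK hc (hu n).meas (hu n).ae_bound
    ((hu n).memLp i)) (integrable_transport_curve i hK hc hw.meas hw.ae_bound ((hu n).memLp i)),
    sub_add_cancel]

end Limit

/-- The three terms of the weak formulation are integrable, for a regular field. -/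
lemma IsTest.integrable_terms {φ : ℝ → E3 → E3} (hφ : IsTest φ) {u : ℝ → L2} {T C : ℝ}
    (hu : IsRegular u T C) :
    Integrable (fun t => pairing (u t) (fun x => deriv (fun s => φ s x) t))
      (volume.restrict (Ioo 0 T)) ∧
    (∀ i, Integrable (fun t => pairing (weakPartial i (u t))
      (fun x => fderiv ℝ (fun p : ℝ × E3 => φ p.1 p.2) (t, x) (0, e i)))
      (volume.restrict (Ioo 0 T))) ∧
    ∀ i, Integrable (fun t => transport i (u t) (weakPartial i (u t)) (φ t))
      (volume.restrict (Ioo 0 T)) := by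
  have hid : AEStronglyMeasurable (fun t : ℝ => t) (volume.restrict (Ioo 0 T)) :=
    aestronglyMeasurable_id
  refine ⟨?_, fun i => ?_, fun i => integrable_transport_curve i hφ.smooth.continuous
    hφ.hasCompactSupport hu.meas hu.ae_bound (hu.memLp i)⟩
  · obtain ⟨B, hB0, hB⟩ := exists_pairing_bound hφ.continuous_deriv hφ.hasCompactSupport_deriv
    refine Integrable.of_bound (aestronglyMeasurable_pairing hφ.continuous_deriv
      hφ.hasCompactSupport_deriv hu.meas hid) (B * C) ?_
    filter_upwards [hu.ae_bound] with t ht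
    exact (hB t _).trans (mul_le_mul_of_nonneg_left ht hB0)
  · obtain ⟨B, hB0, hB⟩ := exists_pairing_bound (continuous_partial_space hφ.smooth (0, e i))
      (hφ.hasCompactSupport.fderiv_apply ℝ _)
    refine Integrable.mono' ((((hu.memLp i).integrable (by norm_num)).norm).const_mul B)
      (aestronglyMeasurable_pairing (continuous_partial_space hφ.smooth (0, e i))
      (hφ.hasCompactSupport.fderiv_apply ℝ _) (hu.memLp i).1 hid)
      (Eventually.of_forall fun t => hB t _)

lemma IsTest.integral_nsForm {φ : ℝ → E3 → E3} (hφ : IsTest φ) (ν : ℝ) {u : ℝ → L2} {T C : ℝ}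
    (hu : IsRegular u T C) :
    ∫ t in Ioo 0 T, nsForm ν φ (u t) t
      = - (∫ t in Ioo 0 T, pairing (u t) (fun x => deriv (fun s => φ s x) t))
        + ν * (∑ i, ∫ t in Ioo 0 T, pairing (weakPartial i (u t))
          (fun x => fderiv ℝ (fun p : ℝ × E3 => φ p.1 p.2) (t, x) (0, e i)))
        + ∑ i, ∫ t in Ioo 0 T, transport i (u t) (weakPartial i (u t)) (φ t) := by
  obtain ⟨i1, i2, i3⟩ := hφ.integrable_terms hu
  have h : ∀ t, nsForm ν φ (u t) t = - pairing (u t) (fun x => deriv (fun s => φ s x) t)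
      + ν * (∑ i, pairing (weakPartial i (u t))
          (fun x => fderiv ℝ (fun p : ℝ × E3 => φ p.1 p.2) (t, x) (0, e i)))
      + ∑ i, transport i (u t) (weakPartial i (u t)) (φ t) := by
    intro t
    rw [nsForm, ← viscous_slice hφ.smooth hφ.hasCompactSupport t (u t),
      convective_eq_sum _ (hφ.contDiff t).continuous
      (HasCompactSupport.slice hφ.hasCompactSupport t)]
    rfl
  simp only [h]
  have j2 := integrable_finsetSum Finset.univ fun i _ => i2 i
  have j3 := integrable_finsetSum Finset.univ fun i _ => i3 i
  have j1 : Integrable (fun t => - pairing (u t) (fun x => deriv (fun s => φ s x) t))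
      (volume.restrict (Ioo 0 T)) := i1.neg
  have j12 : Integrable (fun t => - pairing (u t) (fun x => deriv (fun s => φ s x) t)
      + ν * (∑ i, pairing (weakPartial i (u t))
          (fun x => fderiv ℝ (fun p : ℝ × E3 => φ p.1 p.2) (t, x) (0, e i))))
      (volume.restrict (Ioo 0 T)) := j1.add (j2.const_mul ν)
  rw [integral_add j12 j3, integral_add j1 (j2.const_mul ν), integral_neg, integral_const_mul,
    integral_finsetSum _ fun i _ => i2 i, integral_finsetSum _ fun i _ => i3 i]

section Equation

variable {ν : ℝ} {u : ℕ → ℝ → L2} {v₀ : L2} {w : ℝ → L2}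

lemma IsApproximateSolution.tendsto_integral_nsForm (hu : IsApproximateSolution ν u v₀)
    (hw : WeakAtEveryTime u w) {φ : ℝ → E3 → E3} (hφ : IsTest φ) {T : ℝ} (hT : 0 < T) :
    Tendsto (fun n => ∫ t in Ioo 0 T, nsForm ν φ (u n t) t) atTop
      (𝓝 (∫ t in Ioo 0 T, nsForm ν φ (w t) t)) := by
  obtain ⟨C, hC0, hreg, hwreg, hconv⟩ := hu.limit_regular hw hT
  rw [hφ.integral_nsForm ν hwreg]
  simp only [fun n => hφ.integral_nsForm ν (hreg n)]
  refine ((tendsto_integral_pairing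
    (K := fun p : ℝ × E3 => deriv (fun s => φ s p.2) p.1) (fun g => (hconv g).1)
    hφ.continuous_deriv hφ.hasCompactSupport_deriv).neg.add ((tendsto_finsetSum _ fun i _ => ?_).const_mul ν)).add
    (tendsto_finsetSum _ fun i _ => ?_)
  · exact tendsto_integral_pairing (K := fun q => fderiv ℝ (fun p : ℝ × E3 => φ p.1 p.2) q (0, e i))
      (fun g => (hconv g).2 i) (continuous_partial_space hφ.smooth (0, e i))
      (hφ.hasCompactSupport.fderiv_apply ℝ _)
  · exact tendsto_integral_transport (K := fun p : ℝ × E3 => φ p.1 p.2) i hφ.smooth.continuous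
      hφ.hasCompactSupport hreg hwreg (hu.strongConv hw T hT)
      fun g => (hconv g).2 i

/-- The approximate identity is used at a single time `T` at which `φ` has already vanished: the
pairing at time `T` drops out, and the remaining terms converge. Beyond `T` nothing is left to
integrate. -/
lemma IsApproximateSolution.isNSSolution (hu : IsApproximateSolution ν u v₀)
    (hw : WeakAtEveryTime u w) : IsNSSolution ν w v₀ := by
  refine ⟨fun t ht => hu.limit_divFree hw ht, hu.limit_zero hw, fun φ hφ => ?_⟩
  obtain ⟨T, hT, hφT⟩ : ∃ T : ℝ, 0 < T ∧ ∀ t, T ≤ t → ∀ᶠ s in 𝓝 t, ∀ x, φ s x = 0 := by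
    obtain ⟨R, hR⟩ := (hφ.hasCompactSupport.isCompact.image continuous_fst).isBounded.subset_ball
      (0 : ℝ)
    refine ⟨max R 0 + 1, by positivity, fun t ht => ?_⟩
    have h1 : max R 0 < t := by linarith
    filter_upwards [Ioi_mem_nhds h1] with s hs x
    by_contra h0
    have h2 := hR ⟨(s, x), subset_tsupport _ h0, rfl⟩
    rw [mem_ball_zero_iff, Real.norm_eq_abs] at h2
    have h3 : max R 0 < s := hs
    linarith [le_abs_self s, le_max_left R 0]
  obtain ⟨r, hr, hev⟩ := hu.identity φ hφ T hT
  obtain ⟨C, hC0, hreg, hwreg, -⟩ := hu.limit_regular hw hT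
  have hφ0 := isTestField_slice hφ.smooth hφ.hasCompactSupport 0
  have h1 : ∫ t in Ioo 0 T, nsForm ν φ (w t) t = pairing v₀ (φ 0) := by
    have e1 : Tendsto (fun n => pairing (u n 0) (φ 0)) atTop (𝓝 (pairing v₀ (φ 0))) := by
      have := hu.initial (ccLp (φ 0) hφ0.continuous hφ0.compact)
      simp only [← pairing_eq_inner] at this
      exact this
    have e2 := (hu.tendsto_integral_nsForm hw hφ hT).sub e1
    have e3 : Tendsto (fun n => (∫ t in Ioo 0 T, nsForm ν φ (u n t) t) - pairing (u n 0) (φ 0))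
        atTop (𝓝 0) := by
      refine squeeze_zero_norm' ?_ hr
      filter_upwards [hev] with n hn
      have h2 := hn T ⟨hT.le, le_rfl⟩
      have h3 : pairing (u n T) (φ T) = 0 := by
        have : ∀ x, φ T x = 0 := (hφT T le_rfl).self_of_nhds
        simp [pairing, this]
      rw [h3] at h2
      rw [Real.norm_eq_abs]
      convert h2 using 2
      ring
    exact sub_eq_zero.1 (tendsto_nhds_unique e2 e3)
  have hsub : Ioo 0 T ⊆ Ioi (0 : ℝ) := fun t ht => ht.1
  have hout : ∀ t ∈ Ioi (0 : ℝ) \ Ioo 0 T, ∀ᶠ s in 𝓝 t, ∀ x, φ s x = 0 := by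
    rintro t ⟨ht0, ht⟩
    refine hφT t ?_
    by_contra hc
    exact ht ⟨ht0, not_le.1 hc⟩
  have o1 : ∀ t ∈ Ioi (0 : ℝ) \ Ioo 0 T, pairing (w t) (fun x => deriv (fun s => φ s x) t) = 0 := by
    intro t ht
    have : ∀ x, deriv (fun s => φ s x) t = 0 := fun x => by
      have h2 : (fun s => φ s x) =ᶠ[𝓝 t] fun _ => 0 := (hout t ht).mono fun s hs => hs x
      rw [h2.deriv_eq, deriv_const]
    simp [pairing, this]
  have hz : ∀ t ∈ Ioi (0 : ℝ) \ Ioo 0 T, φ t = fun _ => 0 := fun t ht =>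
    funext (hout t ht).self_of_nhds
  have o2 : ∀ t ∈ Ioi (0 : ℝ) \ Ioo 0 T, viscous (w t) (φ t) = 0 := fun t ht => by
    rw [hz t ht]; simp [viscous]
  have o3 : ∀ t ∈ Ioi (0 : ℝ) \ Ioo 0 T, convective (w t) (φ t) = 0 := fun t ht => by
    rw [hz t ht]; simp [convective]
  change - (∫ t in Ioi (0 : ℝ), pairing (w t) (fun x => deriv (fun s => φ s x) t))
      + ν * (∫ t in Ioi (0 : ℝ), viscous (w t) (φ t))
      + (∫ t in Ioi (0 : ℝ), convective (w t) (φ t)) = pairing v₀ (φ 0)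
  rw [setIntegral_eq_of_subset_of_forall_sdiff_eq_zero measurableSet_Ioi hsub o1,
    setIntegral_eq_of_subset_of_forall_sdiff_eq_zero measurableSet_Ioi hsub o2,
    setIntegral_eq_of_subset_of_forall_sdiff_eq_zero measurableSet_Ioi hsub o3, ← h1,
    hφ.integral_nsForm ν hwreg]
  obtain ⟨-, i2, i3⟩ := hφ.integrable_terms hwreg
  congr 2
  · congr 1
    rw [← integral_finsetSum _ fun i _ => i2 i]
    refine integral_congr_ae (Eventually.of_forall fun t => ?_)
    exact viscous_slice hφ.smooth hφ.hasCompactSupport t (w t)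
  · rw [← integral_finsetSum _ fun i _ => i3 i]
    refine integral_congr_ae (Eventually.of_forall fun t => ?_)
    exact convective_eq_sum _ (hφ.contDiff t).continuous
      (HasCompactSupport.slice hφ.hasCompactSupport t)

end Equation

/-! ### The energy inequality. -/

/-- The map `y ↦ yᵢ eⱼ`. -/
def swapL (i j : Fin 3) : E3 →L[ℝ] E3 := (coordL i).smulRight (e j)

/-- The rows of the symmetric part of the gradient. -/
def symRow (i : Fin 3) (u : L2) : L2 :=
  (1 / 2 : ℝ) • (weakPartial i u + ∑ j, (swapL i j).compLpL 2 volume (weakPartial j u))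

lemma coeFn_symRow (i : Fin 3) (u : L2) :
    ∀ᵐ x, ∀ j, symRow i u x j = (weakPartial i u x j + weakPartial j u x i) / 2 := by
  set T : Fin 3 → L2 := fun j => (swapL i j).compLpL 2 volume (weakPartial j u)
  have hT : ∀ j, T j =ᵐ[volume] fun x => swapL i j (weakPartial j u x) := fun j =>
    (swapL i j).coeFn_compLpL _
  have h1 : symRow i u = (1 / 2 : ℝ) • (weakPartial i u + (T 0 + T 1 + T 2)) := by
    rw [symRow, Fin.sum_univ_three]
  rw [h1]
  filter_upwards [Lp.coeFn_smul (1 / 2 : ℝ) (weakPartial i u + (T 0 + T 1 + T 2)),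
    Lp.coeFn_add (weakPartial i u) (T 0 + T 1 + T 2), Lp.coeFn_add (T 0 + T 1) (T 2),
    Lp.coeFn_add (T 0) (T 1), hT 0, hT 1, hT 2] with x a1 a2 a3 a4 a5 a6 a7 j
  rw [a1, Pi.smul_apply, a2, Pi.add_apply, a3, Pi.add_apply, a4, Pi.add_apply, a5, a6, a7]
  fin_cases j <;> simp [swapL, e] <;> ring

lemma symGradSq_ae_eq (u : L2) : symGradSq u =ᵐ[volume] fun x => ∑ i, ‖symRow i u x‖ ^ 2 := by
  filter_upwards [ae_all_iff.2 fun i => coeFn_symRow i u] with x hx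
  simp only [symGradSq, E3.norm_sq_eq, hx]

/-- The antisymmetric part of `∇u` is orthogonal to the symmetric matrix `D(w)`. Weak convergence of
the gradients tested against `D(w)` is therefore enough to handle `D(u) : D(w)`. -/
lemma sum_inner_symRow (u w : L2) :
    ∑ i, inner ℝ (symRow i u) (symRow i w) = ∑ i, inner ℝ (weakPartial i u) (symRow i w) := by
  simp only [inner_eq_integral]
  rw [← integral_finsetSum _ fun i _ => integrable_inner _ _,
    ← integral_finsetSum _ fun i _ => integrable_inner _ _]
  refine integral_congr_ae ?_
  filter_upwards [ae_all_iff.2 fun i => coeFn_symRow i u, ae_all_iff.2 fun i => coeFn_symRow i w]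
    with x h1 h2
  simp only [E3.sum_inner, h1, h2, Fin.sum_univ_three]
  ring

lemma sum_norm_sq_symRow_le (u : L2) : ∑ i, ‖symRow i u‖ ^ 2 ≤ ∑ i, ‖weakPartial i u‖ ^ 2 := by
  have h1 := sum_inner_symRow u u
  simp only [real_inner_self_eq_norm_sq] at h1
  have h2 : ∑ i, ‖symRow i u‖ ^ 2
      ≤ ∑ i, (‖weakPartial i u‖ ^ 2 / 2 + ‖symRow i u‖ ^ 2 / 2) := by
    rw [h1]
    refine Finset.sum_le_sum fun i _ => (real_inner_le_norm _ _).trans ?_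
    nlinarith [sq_nonneg (‖weakPartial i u‖ - ‖symRow i u‖)]
  rw [Finset.sum_add_distrib, ← Finset.sum_div, ← Finset.sum_div] at h2
  linarith

lemma integral_symGradSq (u : L2) : ∫ x, symGradSq u x = ∑ i, ‖symRow i u‖ ^ 2 := by
  rw [integral_congr_ae (symGradSq_ae_eq u), integral_finsetSum _ fun i _ => integrable_norm_sq _]
  simp only [norm_sq_eq_integral]

/-- The mass of a field on a ball. -/
def ballMass (ε : ℝ) (c : E3) (u : L2) : ℝ := ∫ x in Metric.ball c ε, ‖u x‖ ^ 2

lemma ballMass_nonneg (ε : ℝ) (c : E3) (u : L2) : 0 ≤ ballMass ε c u :=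
  integral_nonneg fun _ => sq_nonneg _

lemma ballMass_le (ε : ℝ) (c : E3) (u : L2) : ballMass ε c u ≤ ‖u‖ ^ 2 :=
  setIntegral_norm_sq_le u _

lemma setIntegral_compl_ball (ε : ℝ) (c : E3) (u : L2) :
    ∫ x in (Metric.ball c ε)ᶜ, ‖u x‖ ^ 2 = ‖u‖ ^ 2 - ballMass ε c u := by
  rw [norm_sq_eq_integral, ballMass, ← integral_add_compl Metric.isOpen_ball.measurableSet
    (integrable_norm_sq u), add_sub_cancel_left]

lemma setIntegral_symGradSq (ε : ℝ) (c : E3) (u : L2) :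
    ∫ x in (Metric.ball c ε)ᶜ, symGradSq u x
      = ∑ i, (‖symRow i u‖ ^ 2 - ballMass ε c (symRow i u)) := by
  rw [integral_congr_ae (ae_restrict_of_ae (symGradSq_ae_eq u)),
    integral_finsetSum _ fun i _ => (integrable_norm_sq _).restrict]
  simp only [setIntegral_compl_ball]

/-- Outside the ball, `2 a · b ≤ |a|² + |b|²`; inside it, Young's inequality with weight `η`. The
lower bound is affine in `a` up to the error `η ‖a‖²`, and involves the ball only through the mass
of the fixed field `b`: this is lower semicontinuity in a form that tolerates a moving hole. -/
lemma exterior_norm_sq_ge (ε : ℝ) (c : E3) (a b : L2) {η : ℝ} (hη : 0 < η) :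
    2 * inner ℝ a b - ‖b‖ ^ 2 - 2 * (η * ‖a‖ ^ 2 + 1 / η * ballMass ε c b)
      ≤ ‖a‖ ^ 2 - ballMass ε c a := by
  have hB : MeasurableSet (Metric.ball c ε) := Metric.isOpen_ball.measurableSet
  have h1 : inner ℝ a b = (∫ x in Metric.ball c ε, inner ℝ (a x) (b x))
      + ∫ x in (Metric.ball c ε)ᶜ, inner ℝ (a x) (b x) := by
    rw [inner_eq_integral, integral_add_compl hB (integrable_inner a b)]
  have ia := integrable_norm_sq a
  have ib := integrable_norm_sq b
  have h2 : 2 * (∫ x in (Metric.ball c ε)ᶜ, inner ℝ (a x) (b x))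
      ≤ (‖a‖ ^ 2 - ballMass ε c a) + (‖b‖ ^ 2 - ballMass ε c b) := by
    rw [← setIntegral_compl_ball, ← setIntegral_compl_ball, ← integral_const_mul,
      ← integral_add ia.restrict ib.restrict]
    refine integral_mono ((integrable_inner a b).restrict.const_mul 2)
      (ia.restrict.add ib.restrict) fun x => ?_
    have h3 := real_inner_le_norm (a x) (b x)
    simp only
    nlinarith [sq_nonneg (‖a x‖ - ‖b x‖)]
  have h4 : (∫ x in Metric.ball c ε, inner ℝ (a x) (b x))
      ≤ η * ballMass ε c a + 1 / η * ballMass ε c b := by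
    unfold ballMass
    rw [← integral_const_mul, ← integral_const_mul,
      ← integral_add (ia.restrict.const_mul _) (ib.restrict.const_mul _)]
    refine integral_mono (integrable_inner a b).restrict
      ((ia.restrict.const_mul _).add (ib.restrict.const_mul _)) fun x => ?_
    have h3 := real_inner_le_norm (a x) (b x)
    have h5 : ‖a x‖ * ‖b x‖ ≤ η * ‖a x‖ ^ 2 + 1 / η * ‖b x‖ ^ 2 := by
      rw [one_div_mul_eq_div, add_div' _ _ _ hη.ne', le_div_iff₀ hη]
      nlinarith [sq_nonneg (η * ‖a x‖ - ‖b x‖), mul_nonneg (mul_nonneg (norm_nonneg (a x))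
        (norm_nonneg (b x))) hη.le]
    exact h3.trans h5
  have h6 : η * ballMass ε c a ≤ η * ‖a‖ ^ 2 :=
    mul_le_mul_of_nonneg_left (ballMass_le _ _ _) hη.le
  have h7 := ballMass_nonneg ε c b
  rw [h1]
  linarith

/-- Translating the field rather than the ball makes the mass jointly continuous in the centre and
the field, which yields measurability in time along a moving centre. -/
lemma ballMass_eq (ε : ℝ) (c : E3) (u : L2) :
    ballMass ε c u = ‖LpToLpRestrictCLM E3 E3 ℝ volume 2 (Metric.ball (0 : E3) ε)
      (translate (-c) u)‖ ^ 2 := by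
  rw [lp_norm_sq_eq_integral]
  have h1 := (measurePreserving_add_right (volume : Measure E3) c).setIntegral_preimage_emb
    (measurableEmbedding_addRight c) (fun x => ‖u x‖ ^ 2) (Metric.ball c ε)
  have h2 : (fun x => x + c) ⁻¹' Metric.ball c ε = Metric.ball (0 : E3) ε := by
    ext x; simp [dist_eq_norm]
  rw [h2] at h1
  rw [ballMass, ← h1]
  refine integral_congr_ae ?_
  filter_upwards [LpToLpRestrictCLM_coeFn ℝ (Metric.ball (0 : E3) ε) (translate (-c) u),
    ae_restrict_of_ae (coeFn_translate (-c) u)] with x h3 h4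
  rw [h3, h4, sub_neg_eq_add]

lemma continuous_translate_uncurry : Continuous (fun p : E3 × L2 => translate p.1 p.2) := by
  rw [continuous_iff_continuousAt]
  rintro ⟨c, u⟩
  rw [ContinuousAt, tendsto_iff_norm_sub_tendsto_zero]
  have h1 : Tendsto (fun p : E3 × L2 => ‖p.2 - u‖ + ‖translate p.1 u - translate c u‖)
      (𝓝 (c, u)) (𝓝 0) := by
    have h2 : Continuous (fun p : E3 × L2 => ‖p.2 - u‖ + ‖translate p.1 u - translate c u‖) :=
      (by fun_prop : Continuous fun p : E3 × L2 => ‖p.2 - u‖).add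
        (((continuous_translate u).comp continuous_fst).sub continuous_const).norm
    simpa using h2.tendsto (c, u)
  refine squeeze_zero (fun p => norm_nonneg _) (fun p => ?_) h1
  have h3 : translate p.1 p.2 - translate c u
      = translate p.1 (p.2 - u) + (translate p.1 u - translate c u) := by
    rw [translate_sub]; abel
  rw [h3]
  refine (norm_add_le _ _).trans_eq ?_
  rw [norm_translate]

lemma continuous_ballMass (ε : ℝ) : Continuous (fun p : E3 × L2 => ballMass ε p.1 p.2) := by
  simp only [ballMass_eq]
  exact ((LpToLpRestrictCLM E3 E3 ℝ volume 2 (Metric.ball (0 : E3) ε)).continuous.comp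
    (continuous_translate_uncurry.comp (by fun_prop : Continuous fun p : E3 × L2 => (-p.1, p.2)))
    ).norm.pow 2

/-- Absolute continuity of the integral: only the volume of the balls matters, so the centres are
arbitrary. -/
lemma tendsto_ballMass (u : L2) {ε : ℕ → ℝ} (hε : Tendsto ε atTop (𝓝 0)) (hε0 : ∀ n, 0 < ε n)
    (c : ℕ → E3) : Tendsto (fun n => ballMass (ε n) (c n) u) atTop (𝓝 0) := by
  refine (integrable_norm_sq u).tendsto_setIntegral_nhds_zero ?_
  have h1 : (volume : Measure E3) ∘ (fun n => Metric.ball (c n) (ε n))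
      = fun n => ENNReal.ofReal (ε n ^ 3) * volume (Metric.ball (0 : E3) 1) := by
    ext n
    simp only [Function.comp_apply]
    rw [Measure.addHaar_ball _ _ (hε0 n).le]
    simp
  rw [h1]
  have h2 : Tendsto (fun n => ENNReal.ofReal (ε n ^ 3)) atTop (𝓝 0) := by
    have := ENNReal.tendsto_ofReal (hε.pow 3)
    simpa using this
  simpa using ENNReal.Tendsto.mul_const h2 (Or.inr (measure_ball_lt_top (μ := volume)
    (x := (0 : E3)) (r := 1)).ne)

lemma memLp_symRow {u : ℝ → L2} {T C : ℝ} (hu : IsRegular u T C) (i : Fin 3) :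
    MemLp (fun t => symRow i (u t)) 2 (volume.restrict (Ioo 0 T)) := by
  set T' : Fin 3 → L2 →L[ℝ] L2 := fun j => (swapL i j).compLpL 2 volume
  have h1 : ∀ j, MemLp (fun t => T' j (weakPartial j (u t))) 2 (volume.restrict (Ioo 0 T)) :=
    fun j => (T' j).comp_memLp' (hu.memLp j)
  have h2 : MemLp (fun t => ∑ j, T' j (weakPartial j (u t))) 2 (volume.restrict (Ioo 0 T)) :=
    memLp_finsetSum _ fun j _ => h1 j
  exact ((hu.memLp i).add h2).const_smul (1 / 2 : ℝ)

section Dissipation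

variable {u w : ℝ → L2} {T C : ℝ} {c : ℝ → E3}

lemma integrable_ballMass {μ : Measure ℝ} {a : ℝ → L2} (ha : MemLp a 2 μ) (ε : ℝ)
    (hc : AEStronglyMeasurable c μ) : Integrable (fun s => ballMass ε (c s) (a s)) μ := by
  have h3 : Integrable (fun s => ‖a s‖ ^ 2) μ := ha.integrable_norm_pow (by norm_num)
  have h1 : AEStronglyMeasurable (fun s => (c s, a s)) μ := hc.prodMk ha.1
  have h2 := (continuous_ballMass ε).comp_aestronglyMeasurable h1
  refine h3.mono' h2 (Eventually.of_forall fun s => ?_)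
  rw [Real.norm_of_nonneg (ballMass_nonneg _ _ _)]
  exact ballMass_le _ _ _

lemma integrable_inner_of_memLp {a b : ℝ → L2} {μ : Measure ℝ} (ha : MemLp a 2 μ)
    (hb : MemLp b 2 μ) : Integrable (fun s => inner ℝ (a s) (b s)) μ := by
  refine ((ha.integrable_norm_pow (by norm_num)).add (hb.integrable_norm_pow (by norm_num))).mono'
    (ha.1.inner hb.1) (Eventually.of_forall fun s => (norm_inner_le_norm _ _).trans ?_)
  simp only [Pi.add_apply]
  nlinarith [sq_nonneg (‖a s‖ - ‖b s‖), mul_nonneg (norm_nonneg (a s)) (norm_nonneg (b s))]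

/-- The time integral of `exterior_norm_sq_ge` applied to the rows of the symmetric gradients, with
the cross term rewritten through `sum_inner_symRow` so that only the full gradient of `u` appears,
linearly. -/
lemma dissipation_ge (hu : IsRegular u T C) (hw : IsRegular w T C)
    (hc : AEStronglyMeasurable c (volume.restrict (Ioo 0 T))) (ε : ℝ) {η : ℝ} (hη : 0 < η) :
    2 * (∑ i, ∫ s in Ioo 0 T, inner ℝ (weakPartial i (u s)) (symRow i (w s)))
      - (∫ s in Ioo 0 T, ∫ x, symGradSq (w s) x)
      - 2 * (η * (3 * C ^ 2)
        + 1 / η * ∑ i, ∫ s in Ioo 0 T, ballMass ε (c s) (symRow i (w s)))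
      ≤ ∫ s in Ioo 0 T, ∫ x in (Metric.ball (c s) ε)ᶜ, symGradSq (u s) x := by
  simp only [setIntegral_symGradSq, integral_symGradSq]
  have iu : ∀ i, Integrable (fun s => ‖symRow i (u s)‖ ^ 2) (volume.restrict (Ioo 0 T)) :=
    fun i => (memLp_symRow hu i).integrable_norm_pow (by norm_num)
  have iw : ∀ i, Integrable (fun s => ‖symRow i (w s)‖ ^ 2) (volume.restrict (Ioo 0 T)) :=
    fun i => (memLp_symRow hw i).integrable_norm_pow (by norm_num)
  have ip : ∀ i, Integrable (fun s => inner ℝ (weakPartial i (u s)) (symRow i (w s)))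
      (volume.restrict (Ioo 0 T)) := fun i =>
    integrable_inner_of_memLp (hu.memLp i) (memLp_symRow hw i)
  have ibu := fun i => integrable_ballMass (memLp_symRow hu i) ε hc
  have ibw := fun i => integrable_ballMass (memLp_symRow hw i) ε hc
  have iq : ∀ i, Integrable (fun s => ‖weakPartial i (u s)‖ ^ 2) (volume.restrict (Ioo 0 T)) :=
    fun i => (hu.memLp i).integrable_norm_pow (by norm_num)
  have hpt : ∀ s, 2 * (∑ i, inner ℝ (weakPartial i (u s)) (symRow i (w s)))
      - (∑ i, ‖symRow i (w s)‖ ^ 2) - 2 * (η * (∑ i, ‖weakPartial i (u s)‖ ^ 2)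
        + 1 / η * ∑ i, ballMass ε (c s) (symRow i (w s)))
      ≤ ∑ i, (‖symRow i (u s)‖ ^ 2 - ballMass ε (c s) (symRow i (u s))) := by
    intro s
    have h1 := Finset.sum_le_sum fun i (_ : i ∈ Finset.univ) =>
      exterior_norm_sq_ge ε (c s) (symRow i (u s)) (symRow i (w s)) hη
    rw [Finset.sum_sub_distrib, Finset.sum_sub_distrib, ← Finset.mul_sum, ← Finset.mul_sum,
      Finset.sum_add_distrib, ← Finset.mul_sum, ← Finset.mul_sum, sum_inner_symRow] at h1
    have h2 := mul_le_mul_of_nonneg_left (sum_norm_sq_symRow_le (u s)) hη.le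
    linarith
  have i1 := (integrable_finsetSum Finset.univ fun i _ => ip i).const_mul 2
  have i2 := integrable_finsetSum Finset.univ fun i _ => iw i
  have i3 := (integrable_finsetSum Finset.univ fun i _ => iq i).const_mul η
  have i4 := (integrable_finsetSum Finset.univ fun i _ => ibw i).const_mul (1 / η)
  have i34 : Integrable (fun s => 2 * (η * (∑ i, ‖weakPartial i (u s)‖ ^ 2)
        + 1 / η * ∑ i, ballMass ε (c s) (symRow i (w s)))) (volume.restrict (Ioo 0 T)) :=
    (i3.add i4).const_mul 2
  have i12 : Integrable (fun s => 2 * (∑ i, inner ℝ (weakPartial i (u s)) (symRow i (w s)))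
      - (∑ i, ‖symRow i (w s)‖ ^ 2)) (volume.restrict (Ioo 0 T)) := i1.sub i2
  have h3 := integral_mono (i12.sub i34)
    (integrable_finsetSum Finset.univ fun i _ => (iu i).sub (ibu i)) hpt
  have e1 : ∫ s in Ioo 0 T, ((2 * (∑ i, inner ℝ (weakPartial i (u s)) (symRow i (w s)))
      - (∑ i, ‖symRow i (w s)‖ ^ 2)) - 2 * (η * (∑ i, ‖weakPartial i (u s)‖ ^ 2)
        + 1 / η * ∑ i, ballMass ε (c s) (symRow i (w s))))
      = 2 * (∑ i, ∫ s in Ioo 0 T, inner ℝ (weakPartial i (u s)) (symRow i (w s)))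
      - (∫ s in Ioo 0 T, ∑ i, ‖symRow i (w s)‖ ^ 2)
      - 2 * (η * (∑ i, ∫ s in Ioo 0 T, ‖weakPartial i (u s)‖ ^ 2)
        + 1 / η * ∑ i, ∫ s in Ioo 0 T, ballMass ε (c s) (symRow i (w s))) := by
    rw [integral_sub i12 i34, integral_sub i1 i2, integral_const_mul, integral_const_mul,
      integral_add i3 i4, integral_const_mul, integral_const_mul,
      integral_finsetSum _ fun i _ => ip i, integral_finsetSum _ fun i _ => iq i,
      integral_finsetSum _ fun i _ => ibw i]
  have h4 : ∑ i, ∫ s in Ioo 0 T, ‖weakPartial i (u s)‖ ^ 2 ≤ 3 * C ^ 2 := by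
    refine (Finset.sum_le_sum fun i _ => hu.bound_partial i).trans_eq ?_
    simp
  have h5 := mul_le_mul_of_nonneg_left h4 hη.le
  have h6 := e1.symm.le.trans h3
  simp only [Pi.sub_apply] at h6
  linarith

end Dissipation

lemma IsApproximateSolution.energyInequality {ν : ℝ} (hν : 0 ≤ ν) {u : ℕ → ℝ → L2} {v₀ : L2}
    {w : ℝ → L2} (hu : IsApproximateSolution ν u v₀) (hw : WeakAtEveryTime u w)
    {ε : ℕ → ℝ} (hε : Tendsto ε atTop (𝓝 0)) (hε0 : ∀ n, 0 < ε n) {h : ℕ → ℝ → E3}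
    (hh : ∀ n, ContinuousOn (h n) (Ici 0)) {r : ℕ → ℝ → ℝ}
    (hr : ∀ t ≥ 0, Tendsto (fun n => r n t) atTop (𝓝 0))
    (hE : ∀ n, ∀ t ≥ 0, exteriorEnergy ν (ε n) (h n) (u n) t ≤ ‖u n 0‖ ^ 2 + r n t)
    (h0 : Tendsto (fun n => u n 0) atTop (𝓝 v₀)) : EnergyInequality ν w v₀ := by
  intro t ht
  rcases ht.lt_or_eq with htpos | rfl
  swap
  -- At time zero the dissipation integral is over an empty interval and the limit equals `v₀`.
  · simp [hu.limit_zero hw]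
  obtain ⟨C, hC0, hreg, hwreg, hconv⟩ := hu.limit_regular hw htpos
  set W : ℝ := ∫ s in Ioo 0 t, ∫ x, symGradSq (w s) x
  have hc : ∀ n, AEStronglyMeasurable (h n) (volume.restrict (Ioo 0 t)) := fun n =>
    ((hh n).mono fun s hs => hs.1.le).aestronglyMeasurable measurableSet_Ioo
  have hlimD : Tendsto (fun n => ∑ i, ∫ s in Ioo 0 t,
      inner ℝ (weakPartial i (u n s)) (symRow i (w s))) atTop (𝓝 W) := by
    have hW : W = ∑ i, ∫ s in Ioo 0 t, inner ℝ (weakPartial i (w s)) (symRow i (w s)) := by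
      rw [← integral_finsetSum _ fun i _ =>
        integrable_inner_of_memLp (hwreg.memLp i) (memLp_symRow hwreg i)]
      refine integral_congr_ae (Eventually.of_forall fun s => ?_)
      simp only [integral_symGradSq, ← sum_inner_symRow, real_inner_self_eq_norm_sq]
    rw [hW]
    refine tendsto_finsetSum _ fun i _ => ?_
    have e : ∀ y : ℝ → L2, ∫ s in Ioo 0 t, inner ℝ (y s) ((memLp_symRow hwreg i).toLp _ s)
        = ∫ s in Ioo 0 t, inner ℝ (y s) (symRow i (w s)) := by
      intro y
      refine integral_congr_ae ?_
      filter_upwards [(memLp_symRow hwreg i).coeFn_toLp] with s hs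
      rw [hs]
    have h1 := (hconv ((memLp_symRow hwreg i).toLp _)).2 i
    simp only [e] at h1
    exact h1
  have hlimB : Tendsto (fun n => ∑ i, ∫ s in Ioo 0 t, ballMass (ε n) (h n s) (symRow i (w s)))
      atTop (𝓝 0) := by
    have h1 : ∀ i, Tendsto (fun n => ∫ s in Ioo 0 t, ballMass (ε n) (h n s) (symRow i (w s)))
        atTop (𝓝 0) := by
      intro i
      have h2 : Tendsto (fun n => ∫ s in Ioo 0 t, ballMass (ε n) (h n s) (symRow i (w s)))
          atTop (𝓝 (∫ s in Ioo 0 t, (0 : ℝ))) := by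
        refine tendsto_integral_of_dominated_convergence (fun s => ‖symRow i (w s)‖ ^ 2)
          (fun n => (integrable_ballMass (memLp_symRow hwreg i) (ε n) (hc n)).1)
          ((memLp_symRow hwreg i).integrable_norm_pow (by norm_num))
          (fun n => Eventually.of_forall fun s => ?_) (Eventually.of_forall fun s => ?_)
        · rw [Real.norm_of_nonneg (ballMass_nonneg _ _ _)]
          exact ballMass_le _ _ _
        · exact tendsto_ballMass _ hε hε0 _
      simpa using h2
    simpa using tendsto_finsetSum Finset.univ fun i _ => h1 i
  -- The order of limits matters: for fixed `η` the radii tend to zero first, which removes the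
  -- terms in `1 / η`; only then does `η` tend to zero. Strong convergence of the initial data is
  -- used for the right side.
  have hkey : ∀ η > 0, ‖w t‖ ^ 2 + 4 * ν * W ≤ ‖v₀‖ ^ 2 + η * (2 * C ^ 2 + 4 * ν * (6 * C ^ 2)) := by
    intro η hη
    have hl : Tendsto (fun n => (2 * inner ℝ (u n t) (w t) - ‖w t‖ ^ 2
        - 2 * (η * C ^ 2 + 1 / η * ballMass (ε n) (h n t) (w t)))
        + 4 * ν * (2 * (∑ i, ∫ s in Ioo 0 t, inner ℝ (weakPartial i (u n s)) (symRow i (w s))) - W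
          - 2 * (η * (3 * C ^ 2)
            + 1 / η * ∑ i, ∫ s in Ioo 0 t, ballMass (ε n) (h n s) (symRow i (w s))))) atTop
        (𝓝 ((2 * inner ℝ (w t) (w t) - ‖w t‖ ^ 2 - 2 * (η * C ^ 2 + 1 / η * 0))
          + 4 * ν * (2 * W - W - 2 * (η * (3 * C ^ 2) + 1 / η * 0)))) := by
      refine ((((hw t ht (w t)).const_mul 2).sub_const _).sub
        ((((tendsto_ballMass (w t) hε hε0 fun n => h n t).const_mul (1 / η)).const_add _).const_mul
          2)).add (((((hlimD.const_mul 2).sub_const _).sub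
        (((hlimB.const_mul (1 / η)).const_add _).const_mul 2))).const_mul _)
    have hrhs : Tendsto (fun n => ‖u n 0‖ ^ 2 + r n t) atTop (𝓝 (‖v₀‖ ^ 2 + 0)) :=
      (h0.norm.pow 2).add (hr t ht)
    have h1 := le_of_tendsto_of_tendsto' hl hrhs fun n => by
      refine le_trans ?_ (hE n t ht)
      unfold exteriorEnergy
      refine add_le_add ?_ (mul_le_mul_of_nonneg_left
        (dissipation_ge (hreg n) hwreg (hc n) (ε n) hη) (by positivity))
      rw [setIntegral_compl_ball]
      refine le_trans ?_ (exterior_norm_sq_ge (ε n) (h n t) (u n t) (w t) hη)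
      have h2 := (hreg n).bound t ⟨ht, le_rfl⟩
      have h3 : η * ‖u n t‖ ^ 2 ≤ η * C ^ 2 := by gcongr
      linarith
    rw [real_inner_self_eq_norm_sq] at h1
    linarith
  have hl : Tendsto (fun η : ℝ => ‖v₀‖ ^ 2 + η * (2 * C ^ 2 + 4 * ν * (6 * C ^ 2))) (𝓝[>] 0)
      (𝓝 (‖v₀‖ ^ 2)) := by
    have hc : Continuous (fun η : ℝ => ‖v₀‖ ^ 2 + η * (2 * C ^ 2 + 4 * ν * (6 * C ^ 2))) := by
      fun_prop
    simpa using (hc.tendsto 0).mono_left (nhdsWithin_le_nhds (s := Ioi 0))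
  refine ge_of_tendsto hl ?_
  filter_upwards [self_mem_nhdsWithin] with η hη using hkey η hη

end MovingBall

end

/-! ### Conclusion. -/

theorem theorem2 (ν : ℝ) (hν : 0 < ν) (ε₀ : ℝ) (hε₀ : 0 < ε₀)
    (v : ℝ → ℝ → MovingBall.L2) (h : ℝ → ℝ → MovingBall.E3) (v₀ : MovingBall.L2)
    (hspace : ∀ ε ∈ Ioo 0 ε₀, MovingBall.InEnergySpace (v ε))
    (hbound : MovingBall.UniformlyBounded ε₀ v)
    (hdiv : ∀ ε ∈ Ioo 0 ε₀, ∀ t ≥ 0, MovingBall.WeakDivFree (v ε t))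
    (hNS : ∀ ε ∈ Ioo 0 ε₀, MovingBall.SolvesNSOutsideBall ν ε (h ε) (v ε))
    (hinit : ∀ g : MovingBall.L2,
      Tendsto (fun ε => inner ℝ (v ε 0) g) (𝓝[>] 0) (𝓝 (inner ℝ v₀ g)))
    (hh : ∀ ε ∈ Ioo 0 ε₀, MovingBall.W1InfOn (h ε) (Ici 0))
    (hh' : ∀ T > 0, Tendsto
      (fun ε : ℝ => eLpNorm (fun t => ε ^ (3 / 2 : ℝ) • deriv (h ε) t) ⊤
        (volume.restrict (Ioo 0 T))) (𝓝[>] 0) (𝓝 0)) :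
    -- every sequence of radii tending to `0` has a subsequence with the asserted properties
    ∀ δ : ℕ → ℝ, (∀ n, δ n ∈ Ioo 0 ε₀) → Tendsto δ atTop (𝓝 0) →
      ∃ k : ℕ → ℕ, StrictMono k ∧ ∃ w : ℝ → MovingBall.L2,
        MovingBall.InEnergySpace w ∧
        MovingBall.WeakStarConv (fun n => v (δ (k n))) w ∧
        MovingBall.WeakConvH1 (fun n => v (δ (k n))) w ∧
        MovingBall.StrongConvL2Loc (fun n => v (δ (k n))) w ∧
        MovingBall.IsNSSolution ν w v₀ ∧
        (Tendsto (fun ε => v ε 0) (𝓝[>] 0) (𝓝 v₀) →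
          MovingBall.ExteriorEnergyInequality ν ε₀ h v →
          MovingBall.EnergyInequality ν w v₀) := by
  intro δ hδ hδ0
  have hδ' : Tendsto δ atTop (𝓝[>] 0) :=
    tendsto_nhdsWithin_iff.2 ⟨hδ0, Eventually.of_forall fun n => (hδ n).1⟩
  have hu : MovingBall.IsApproximateSolution ν (fun n => v (δ n)) v₀ :=
    { regular := fun T hT => by
        obtain ⟨C, hC0, hC⟩ := hbound.exists_isRegular hspace hT
        exact ⟨C, hC0, fun n => hC _ (hδ n)⟩
      divFree := fun n => hdiv _ (hδ n)
      initial := fun g => (hinit g).comp hδ'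
      identity := fun φ hφ T hT => by
        obtain ⟨r, hr, hev⟩ := MovingBall.exists_approximate_identity hε₀ hspace hbound hNS hh hh'
          hφ hT
        exact ⟨fun n => r (δ n), hr.comp hδ', hδ'.eventually hev⟩ }
  obtain ⟨k, hk, hweak⟩ := hu.exists_subseq_weak
  -- Negative times receive arbitrary values, which no conclusion sees.
  choose! w hw using hweak
  have huk := hu.comp hk
  have hδk := hδ'.comp hk.tendsto_atTop
  refine ⟨k, hk, w, huk.limit_inEnergySpace hw, huk.weakStarConv hw, huk.weakConvH1 hw,
    huk.strongConv hw, huk.isNSSolution hw, fun h0 hE => ?_⟩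
  obtain ⟨r, hr⟩ := hE
  refine huk.energyInequality hν.le hw (hδ0.comp hk.tendsto_atTop) (fun n => (hδ _).1)
    (h := fun n => h (δ (k n))) (fun n => ?_) (r := fun n => r (δ (k n)))
    (fun t ht => (hr t ht).1.comp hδk) (fun n t ht => (hr t ht).2 _ (hδ _)) (h0.comp hδk)
  obtain ⟨-, K, hK⟩ := hh _ (hδ (k n))
  exact hK.continuousOn
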